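/- **Setting.** Let $G$ be a (finite-dimensional, real) Lie group with Lie algebra $\mathfrak g$, and let $\sigma:Y\to X$ be a surjective submersion of smooth manifolds. Write $Y^{[2]}=Y\times_XY$ and $Y^{[3]}=Y\times_XY\times_XY$ for the fibre products, with their structures of embedded submanifolds of $Y^2$ and $Y^3$, and $\check{\mathcal C}(\sigma)=(Y^{[2]}\rightrightarrows Y)$ for the Čech groupoid, with $t(y_1,y_2)=y_1$, $s(y_1,y_2)=y_2$, $e_y=(y,y)$, $(y_1,y_2)\circ(y_2,y_3)=(y_1,y_3)$. For a manifold $M$ let $T[1]M$ be the dg-manifold with functions $\Omega^\bullet(M)$ and the de Rham differential; $T[1]\check{\mathcal C}(\sigma)=(T[1]Y^{[2]}\rightrightarrows T[1]Y)$, with the tangent maps of the structure maps of $\check{\mathcal C}(\sigma)$, is a dg-Lie groupoid. Let $W(\mathfrak g)=\mathrm{Sym}(\mathfrak g[1]^*\oplus\mathfrak g[2]^*)$ be the Weil algebra, with generators $\xi^a$ of degree 1 and $\bar\xi^a$ of degree 2 and the differential $d\xi^a=\bar\xi^a-\tfrac12 f^a_{bc}\xi^b\xi^c$, $d\bar\xi^a=-f^a_{bc}\xi^b\bar\xi^c$,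 where $f^a_{bc}$ are the structure constants of $\mathfrak g$; it is the algebra of functions of the dg-manifold $T[1]\mathfrak g[1]$. Let $\mathcal A^W_G=(T[1]\mathfrak g[1]\times T[1]G\rightrightarrows T[1]\mathfrak g[1])$ be the dg-Lie groupoid with the differential $d_{W(\mathfrak g)}\otimes\mathrm{id}+\mathrm{id}\otimes d_G$ on morphisms, $d_{W(\mathfrak g)}$ on objects, and the structure maps $$t(\nu,\bar\nu;g,\gamma)=(\nu,\bar\nu),\qquad s(\nu,\bar\nu;g,\gamma)=(g^{-1}\nu g+g^{-1}\gamma,\ g^{-1}\bar\nu g),\qquad e(\nu,\bar\nu)=(\nu,\bar\nu;1,0),$$ $$(\nu,\bar\nu;g_1,\gamma_1)\circ(g_1^{-1}\nu g_1+g_1^{-1}\gamma_1,\,g_1^{-1}\bar\nu g_1;g_2,\gamma_2)=(\nu,\bar\nu;g_1g_2,\,g_1\gamma_2+\gamma_1g_2).$$ A *differential cocycle* of a principal $G$-bundle with connection subordinate to $\sigma$ is a pair $(g,A)$ of a smooth map $g:Y^{[2]}\to G$ and a form $A\in\Omega^1(Y)\otimes\mathfrak g$ with $$g_{y_1y_2}g_{y_2y_3}=g_{y_1y_3}\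 \text{ on }Y^{[3]},\qquad A_{y_2}=g_{y_1y_2}^{-1}A_{y_1}g_{y_1y_2}+g_{y_1y_2}^{-1}dg_{y_1y_2}\ \text{ on }Y^{[2]}.$$ A *gauge transformation* $(g,A)\to(\tilde g,\tilde A)$ is a smooth map $p:Y\to G$ with $$\tilde g_{y_1y_2}=p_{y_1}^{-1}g_{y_1y_2}p_{y_2},\qquad \tilde A=p^{-1}Ap+p^{-1}dp.$$ A functor of dg-Lie groupoids $\Phi:T[1]\check{\mathcal C}(\sigma)\to\mathcal A^W_G$ consists of morphisms of dg-manifolds $\Phi_0:T[1]Y\to T[1]\mathfrak g[1]$ and $\Phi_1:T[1]Y^{[2]}\to T[1]\mathfrak g[1]\times T[1]G$ that are compatible with $t$, $s$, $e$ and $\circ$. A natural isomorphism $\Phi\Rightarrow\tilde\Phi$ is a morphism of dg-manifolds $\alpha:T[1]Y\to T[1]\mathfrak g[1]\times T[1]G$ with $t\circ\alpha=\Phi_0$, $s\circ\alpha=\tilde\Phi_0$ and $\Phi_1(y_1,y_2)\circ\alpha(y_2)=\alpha(y_1)\circ\tilde\Phi_1(y_1,y_2)$. **Theorem.** There is a bijection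 between the functors of dg-Lie groupoids $\Phi:T[1]\check{\mathcal C}(\sigma)\to\mathcal A^W_G$ and the differential cocycles $(g,A)$ of principal $G$-bundles with connection subordinate to $\sigma$. Here $g$ is the map $Y^{[2]}\to G$ of the spaces underlying $\Phi_1$, and $A$ is given by the images $\mu(A)=\Phi_0^\sharp(\mu)\in\Omega^1(Y)$ of the generators $\mu\in\mathfrak g[1]^*$ of degree 1 of $W(\mathfrak g)$. For functors $\Phi,\tilde\Phi$ with cocycles $(g,A),(\tilde g,\tilde A)$, sending $\alpha$ to the map $p:Y\to G$ of underlying spaces is a bijection between the natural isomorphisms $\alpha:\Phi\Rightarrow\tilde\Phi$ and the gauge transformations $(g,A)\to(\tilde g,\tilde A)$; and a natural isomorphism is the composition $y\mapsto\alpha(y)\circ\beta(y)$ of two others exactly if its map to $G$ is the product of theirs. -/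

import Mathlib

open scoped Manifold ContDiff TensorProduct
open TopologicalSpace Module

namespace DGBundle

noncomputable section

section Fibre

variable (𝔤 𝔥 V W : Type*) [AddCommGroup 𝔤] [Module ℝ 𝔤] [AddCommGroup 𝔥] [Module ℝ 𝔥]
  [AddCommGroup V] [Module ℝ V] [AddCommGroup W] [Module ℝ W]

/-- The algebra of functions on the graded vector space `𝔤[1] ⊕ 𝔤[2] ⊕ V[1]`: the free graded
commutative algebra on `𝔤* ⊕ V*` in degree one and a second copy of `𝔤*` in degree two. -/
abbrev Fib := SymmetricAlgebra ℝ (Dual ℝ 𝔤) ⊗[ℝ] ExteriorAlgebra ℝ (Dual ℝ 𝔤 × Dual ℝ V)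

/-- The generators of degree one. -/
def Fib.gen₁ : (Dual ℝ 𝔤 × Dual ℝ V) →ₗ[ℝ] Fib 𝔤 V :=
  (Algebra.TensorProduct.includeRight :
    ExteriorAlgebra ℝ (Dual ℝ 𝔤 × Dual ℝ V) →ₐ[ℝ] Fib 𝔤 V).toLinearMap ∘ₗ ExteriorAlgebra.ι ℝ

/-- The generators of degree two. -/
def Fib.gen₂ : Dual ℝ 𝔤 →ₗ[ℝ] Fib 𝔤 V :=
  (Algebra.TensorProduct.includeLeft :
    SymmetricAlgebra ℝ (Dual ℝ 𝔤) →ₐ[ℝ] Fib 𝔤 V).toLinearMap ∘ₗ SymmetricAlgebra.ι ℝ _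

/-- The homogeneous elements of degree `n`. -/
def Fib.deg (n : ℕ) : Submodule ℝ (Fib 𝔤 V) :=
  ⨆ (p : ℕ) (q : ℕ) (_ : 2 * p + q = n),
    LinearMap.range (Fib.gen₂ 𝔤 V) ^ p * LinearMap.range (Fib.gen₁ 𝔤 V) ^ q

/-- The augmentation, which sends all generators to zero. -/
def Fib.aug : Fib 𝔤 V →ₐ[ℝ] ℝ :=
  Algebra.TensorProduct.lift SymmetricAlgebra.algebraMapInv ExteriorAlgebra.algebraMapInv
    (fun _ _ => Commute.all _ _)

/-- The grading involution, which is `-1` on the generators of degree one and the identity on those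
of degree two. -/
def Fib.invol : Fib 𝔤 V →ₐ[ℝ] Fib 𝔤 V :=
  Algebra.TensorProduct.map (AlgHom.id ℝ _) CliffordAlgebra.involute

variable {𝔤 𝔥 V W}

/-- The algebra morphism with `(μ, l) ↦ (a μ, θ μ + l ∘ L)` on generators of degree one and
`μ ↦ a μ` on generators of degree two. -/
def Fib.hom (a : Dual ℝ 𝔥 →ₗ[ℝ] Dual ℝ 𝔤) (θ : Dual ℝ 𝔥 →ₗ[ℝ] Dual ℝ V) (L : V →ₗ[ℝ] W) :
    Fib 𝔥 W →ₐ[ℝ] Fib 𝔤 V :=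
  Algebra.TensorProduct.map (SymmetricAlgebra.lift (SymmetricAlgebra.ι ℝ _ ∘ₗ a))
    (ExteriorAlgebra.map ((a ∘ₗ LinearMap.fst ℝ _ _).prod
      (θ ∘ₗ LinearMap.fst ℝ _ _ + L.dualMap ∘ₗ LinearMap.snd ℝ _ _)))

@[simp] lemma Fib.hom_gen₁ (a : Dual ℝ 𝔥 →ₗ[ℝ] Dual ℝ 𝔤) (θ : Dual ℝ 𝔥 →ₗ[ℝ] Dual ℝ V)
    (L : V →ₗ[ℝ] W) (u : Dual ℝ 𝔥 × Dual ℝ W) :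
    Fib.hom a θ L (Fib.gen₁ 𝔥 W u) = Fib.gen₁ 𝔤 V (a u.1, θ u.1 + u.2 ∘ₗ L) := by
  simp [Fib.hom, Fib.gen₁, LinearMap.dualMap_apply']

@[simp] lemma Fib.hom_gen₂ (a : Dual ℝ 𝔥 →ₗ[ℝ] Dual ℝ 𝔤) (θ : Dual ℝ 𝔥 →ₗ[ℝ] Dual ℝ V)
    (L : V →ₗ[ℝ] W) (μ : Dual ℝ 𝔥) :
    Fib.hom a θ L (Fib.gen₂ 𝔥 W μ) = Fib.gen₂ 𝔤 V (a μ) := by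
  simp [Fib.hom, Fib.gen₂]

lemma Fib.algHom_ext {A : Type*} [Semiring A] [Algebra ℝ A] {f g : Fib 𝔤 V →ₐ[ℝ] A}
    (h₁ : ∀ u, f (Fib.gen₁ 𝔤 V u) = g (Fib.gen₁ 𝔤 V u))
    (h₂ : ∀ μ, f (Fib.gen₂ 𝔤 V μ) = g (Fib.gen₂ 𝔤 V μ)) : f = g := by
  apply Algebra.TensorProduct.ext
  · refine AlgHom.ext fun x => ?_
    show f (x ⊗ₜ 1) = g (x ⊗ₜ 1)
    induction x using SymmetricAlgebra.induction with
    | algebraMap r =>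
      rw [← Algebra.TensorProduct.algebraMap_apply, AlgHom.commutes, AlgHom.commutes]
    | ι μ => exact h₂ μ
    | mul a b ha hb =>
      have : (a * b) ⊗ₜ[ℝ] (1 : ExteriorAlgebra ℝ (Dual ℝ 𝔤 × Dual ℝ V)) = a ⊗ₜ 1 * b ⊗ₜ 1 := by
        simp
      rw [this, map_mul, map_mul, ha, hb]
    | add a b ha hb => rw [TensorProduct.add_tmul, map_add, map_add, ha, hb]
  · exact ExteriorAlgebra.hom_ext (LinearMap.ext fun u => h₁ u)

@[simp] lemma Fib.aug_gen₁ (u : Dual ℝ 𝔤 × Dual ℝ V) : Fib.aug 𝔤 V (Fib.gen₁ 𝔤 V u) = 0 := by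
  simp [Fib.aug, Fib.gen₁, ExteriorAlgebra.algebraMapInv]

@[simp] lemma Fib.aug_gen₂ (μ : Dual ℝ 𝔤) : Fib.aug 𝔤 V (Fib.gen₂ 𝔤 V μ) = 0 := by
  simp [Fib.aug, Fib.gen₂, SymmetricAlgebra.algebraMapInv]

lemma Fib.aug_hom (a : Dual ℝ 𝔥 →ₗ[ℝ] Dual ℝ 𝔤) (θ : Dual ℝ 𝔥 →ₗ[ℝ] Dual ℝ V)
    (L : V →ₗ[ℝ] W) (x : Fib 𝔥 W) : Fib.aug 𝔤 V (Fib.hom a θ L x) = Fib.aug 𝔥 W x := by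
  have : (Fib.aug 𝔤 V).comp (Fib.hom a θ L) = Fib.aug 𝔥 W := by
    apply Fib.algHom_ext <;> intro u <;> simp
  exact DFunLike.congr_fun this x

lemma Fib.hom_deg (a : Dual ℝ 𝔥 →ₗ[ℝ] Dual ℝ 𝔤) (θ : Dual ℝ 𝔥 →ₗ[ℝ] Dual ℝ V)
    (L : V →ₗ[ℝ] W) {n : ℕ} {x : Fib 𝔥 W} (hx : x ∈ Fib.deg 𝔥 W n) :
    Fib.hom a θ L x ∈ Fib.deg 𝔤 V n := by
  suffices h : (Fib.deg 𝔥 W n).map (Fib.hom a θ L).toLinearMap ≤ Fib.deg 𝔤 V n from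
    h (Submodule.mem_map_of_mem hx)
  simp only [Fib.deg, Submodule.map_iSup]
  refine iSup_mono fun p => iSup_mono fun q => iSup_mono fun _ => ?_
  rw [Submodule.map_mul, Submodule.map_pow, Submodule.map_pow]
  refine mul_le_mul' (pow_le_pow_left' ?_ p) (pow_le_pow_left' ?_ q)
  · rintro _ ⟨_, ⟨μ, rfl⟩, rfl⟩
    exact ⟨_, (Fib.hom_gen₂ a θ L μ).symm⟩
  · rintro _ ⟨_, ⟨μ, rfl⟩, rfl⟩
    exact ⟨_, (Fib.hom_gen₁ a θ L μ).symm⟩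

section Weil

variable (𝔤 V) [Bracket 𝔤 𝔤] [FiniteDimensional ℝ 𝔤]

/-- The image `ξ̄ᵃ - ½ fᵃ_{bc} ξᵇ ξᶜ` of `ξᵃ` under the differential of the Weil algebra, where `fᵃ_{bc}`
are the structure constants in a basis of `𝔤`, for a linear combination `μ` of the `ξᵃ`. -/
def Fib.weil₁ (μ : Dual ℝ 𝔤) : Fib 𝔤 V :=
  Fib.gen₂ 𝔤 V μ - (1 / 2 : ℝ) • ∑ b, ∑ c, μ ⁅finBasis ℝ 𝔤 b, finBasis ℝ 𝔤 c⁆ •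
    (Fib.gen₁ 𝔤 V ((finBasis ℝ 𝔤).coord b, 0) * Fib.gen₁ 𝔤 V ((finBasis ℝ 𝔤).coord c, 0))

/-- The image `- fᵃ_{bc} ξᵇ ξ̄ᶜ` of `ξ̄ᵃ` under the differential of the Weil algebra. -/
def Fib.weil₂ (μ : Dual ℝ 𝔤) : Fib 𝔤 V :=
  -∑ b, ∑ c, μ ⁅finBasis ℝ 𝔤 b, finBasis ℝ 𝔤 c⁆ •
    (Fib.gen₁ 𝔤 V ((finBasis ℝ 𝔤).coord b, 0) * Fib.gen₂ 𝔤 V ((finBasis ℝ 𝔤).coord c))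

end Weil

end Fibre

section Sheaf

variable {E H : Type*} [NormedAddCommGroup E] [NormedSpace ℝ E] [TopologicalSpace H]
  (I : ModelWithCorners ℝ E H) (𝔤 : Type*) [AddCommGroup 𝔤] [Module ℝ 𝔤]
  {M : Type*} [TopologicalSpace M] [ChartedSpace H M] [IsManifold I ∞ M]

/-- Families of elements of the fibres `W(𝔤) ⊗ Λ(T*ₓM)`, over an open set. -/
abbrev Raw (U : Opens M) := ∀ x : U, Fib 𝔤 (TangentSpace I x.1)

variable {I 𝔤}

/-- Restriction to a smaller open set. -/
def Raw.res {U V : Opens M} (h : V ≤ U) : Raw I 𝔤 U →ₐ[ℝ] Raw I 𝔤 V where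
  toFun w x := w ⟨x.1, h x.2⟩
  map_one' := rfl
  map_mul' _ _ := rfl
  map_zero' := rfl
  map_add' _ _ := rfl
  commutes' _ := rfl

variable (I) in
/-- A one-form (a family of linear forms on the tangent spaces) is smooth on `V` if it is smooth as a
function on the tangent bundle. -/
def SmoothForm (θ : ∀ x : M, Dual ℝ (TangentSpace I x)) (V : Set M) : Prop :=
  ContMDiffOn I.tangent 𝓘(ℝ, ℝ) ∞ (fun p : TangentBundle I M => θ p.1 p.2)
    (Bundle.TotalSpace.proj ⁻¹' V)

/-- The generators of the algebra of functions of `T[1]𝔤[1] × T[1]M` over `V ⊆ M`: smooth functions,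
smooth one-forms, and the coordinates `ξ` and `ξ̄` on `T[1]𝔤[1]`, of degrees 0, 1, 1 and 2. -/
inductive IsGen (V : Opens M) : Raw I 𝔤 V → Prop
  | fn (f : M → ℝ) (hf : ContMDiffOn I 𝓘(ℝ, ℝ) ∞ f V) :
      IsGen V (fun x => algebraMap ℝ _ (f x))
  | form (θ : ∀ x : M, Dual ℝ (TangentSpace I x)) (hθ : SmoothForm I θ V) :
      IsGen V (fun x => Fib.gen₁ 𝔤 _ (0, θ x))
  | xi (μ : Dual ℝ 𝔤) : IsGen V (fun _ => Fib.gen₁ 𝔤 _ (μ, 0))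
  | xibar (μ : Dual ℝ 𝔤) : IsGen V (fun _ => Fib.gen₂ 𝔤 _ μ)

lemma IsGen.res {U V : Opens M} (h : V ≤ U) {w : Raw I 𝔤 U} (hw : IsGen U w) :
    IsGen V (Raw.res h w) := by
  cases hw with
  | fn f hf => exact .fn f (hf.mono h)
  | form θ hθ => exact .form θ (hθ.mono (Set.preimage_mono h))
  | xi μ => exact .xi μ
  | xibar μ => exact .xibar μ

lemma adjoin_res {U V : Opens M} (h : V ≤ U) {w : Raw I 𝔤 U}
    (hw : w ∈ Algebra.adjoin ℝ {w | IsGen U w}) :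
    Raw.res h w ∈ Algebra.adjoin ℝ {w : Raw I 𝔤 V | IsGen V w} := by
  have : Algebra.adjoin ℝ {w : Raw I 𝔤 U | IsGen U w} ≤
      (Algebra.adjoin ℝ {w : Raw I 𝔤 V | IsGen V w}).comap (Raw.res h) :=
    Algebra.adjoin_le fun w hw => Algebra.subset_adjoin (IsGen.res h hw)
  exact this hw

variable (I 𝔤)

/-- The algebra of functions over `U ⊆ M` of the graded manifold `T[1]𝔤[1] × T[1]M`, that is,
`W(𝔤) ⊗ Ω(U)`: the families that are, near each point, polynomials in the generators. -/
def Fun (U : Opens M) : Subalgebra ℝ (Raw I 𝔤 U) where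
  carrier := {w | ∀ x ∈ U, ∃ (V : Opens M) (h : V ≤ U), x ∈ V ∧
    Raw.res h w ∈ Algebra.adjoin ℝ {w : Raw I 𝔤 V | IsGen V w}}
  mul_mem' := by
    intro w η hw hη x hx
    obtain ⟨V, hV, hxV, h₁⟩ := hw x hx
    obtain ⟨V', hV', hxV', h₂⟩ := hη x hx
    refine ⟨V ⊓ V', inf_le_left.trans hV, ⟨hxV, hxV'⟩, ?_⟩
    rw [map_mul]
    exact mul_mem (adjoin_res inf_le_left h₁) (adjoin_res inf_le_right h₂)
  add_mem' := by
    intro w η hw hη x hx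
    obtain ⟨V, hV, hxV, h₁⟩ := hw x hx
    obtain ⟨V', hV', hxV', h₂⟩ := hη x hx
    refine ⟨V ⊓ V', inf_le_left.trans hV, ⟨hxV, hxV'⟩, ?_⟩
    rw [map_add]
    exact add_mem (adjoin_res inf_le_left h₁) (adjoin_res inf_le_right h₂)
  algebraMap_mem' r x hx := ⟨U, le_rfl, hx, by
    rw [AlgHom.commutes]; exact Subalgebra.algebraMap_mem _ r⟩

variable {I 𝔤}

lemma IsGen.mem {U : Opens M} {w : Raw I 𝔤 U} (h : IsGen U w) : w ∈ Fun I 𝔤 U :=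
  fun _ hx => ⟨U, le_rfl, hx, Algebra.subset_adjoin h⟩

lemma Fun.res_mem {U V : Opens M} (h : V ≤ U) {w : Raw I 𝔤 U} (hw : w ∈ Fun I 𝔤 U) :
    Raw.res h w ∈ Fun I 𝔤 V := by
  intro x hx
  obtain ⟨V', hV', hxV', h₁⟩ := hw x (h hx)
  exact ⟨V ⊓ V', inf_le_left, ⟨hx, hxV'⟩, adjoin_res inf_le_right h₁⟩

/-- Restriction of functions to a smaller open set. -/
def Fun.res {U V : Opens M} (h : V ≤ U) : Fun I 𝔤 U →ₐ[ℝ] Fun I 𝔤 V :=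
  ((Raw.res h).comp (Fun I 𝔤 U).val).codRestrict _ fun w => Fun.res_mem h w.2

/-- Functions are homogeneous of degree `n` if they are so at every point. -/
def Fun.IsHomogeneous {U : Opens M} (n : ℕ) (w : Fun I 𝔤 U) : Prop :=
  ∀ x, w.1 x ∈ Fib.deg 𝔤 (TangentSpace I x.1) n

/-- The value of a function at a point: its component of degree zero there. -/
def Fun.value {U : Opens M} (w : Fun I 𝔤 U) (x : U) : ℝ := Fib.aug 𝔤 _ (w.1 x)

/-- A family of elements of the fibres which is locally in the algebra is in the algebra. -/
lemma Fun.mem_of_local {U : Opens M} {w : Raw I 𝔤 U}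
    (h : ∀ x ∈ U, ∃ (V : Opens M) (hV : V ≤ U), x ∈ V ∧ Raw.res hV w ∈ Fun I 𝔤 V) :
    w ∈ Fun I 𝔤 U := by
  intro x hx
  obtain ⟨V, hV, hxV, h₁⟩ := h x hx
  obtain ⟨V', hV', hxV', h₂⟩ := h₁ x hxV
  exact ⟨V', hV'.trans hV, hxV', h₂⟩

section Differential

variable [Bracket 𝔤 𝔤] [FiniteDimensional ℝ 𝔤]

/-- `η = Q w` on `V`, for polynomials in generators: here `Q` is the odd derivation with
`Q f = df`, `Q df = 0`, `Q ξᵃ = ξ̄ᵃ - ½ fᵃ_{bc} ξᵇ ξᶜ` and `Q ξ̄ᵃ = - fᵃ_{bc} ξᵇ ξ̄ᶜ`, that is, the sum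
of the de Rham differential of `M` and of the differential of the Weil algebra of `𝔤`. -/
inductive HasD (V : Opens M) : Raw I 𝔤 V → Raw I 𝔤 V → Prop
  | fn (f : M → ℝ) (hf : ContMDiffOn I 𝓘(ℝ, ℝ) ∞ f V) :
      HasD V (fun x => algebraMap ℝ _ (f x))
        (fun x => Fib.gen₁ 𝔤 _ (0, (mfderiv I 𝓘(ℝ, ℝ) f x.1).toLinearMap))
  | dfn (f : M → ℝ) (hf : ContMDiffOn I 𝓘(ℝ, ℝ) ∞ f V) :
      HasD V (fun x => Fib.gen₁ 𝔤 _ (0, (mfderiv I 𝓘(ℝ, ℝ) f x.1).toLinearMap)) 0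
  | xi (μ : Dual ℝ 𝔤) : HasD V (fun _ => Fib.gen₁ 𝔤 _ (μ, 0)) (fun _ => Fib.weil₁ 𝔤 _ μ)
  | xibar (μ : Dual ℝ 𝔤) : HasD V (fun _ => Fib.gen₂ 𝔤 _ μ) (fun _ => Fib.weil₂ 𝔤 _ μ)
  | add {w w' η η' : Raw I 𝔤 V} : HasD V w η → HasD V w' η' → HasD V (w + w') (η + η')
  | mul {w w' η η' : Raw I 𝔤 V} : HasD V w η → HasD V w' η' →
      HasD V (w * w') (η * w' + (fun x => Fib.invol 𝔤 _ (w x)) * η')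

end Differential
end Sheaf

section Maps

variable {E H : Type*} [NormedAddCommGroup E] [NormedSpace ℝ E] [TopologicalSpace H]
  (I : ModelWithCorners ℝ E H) (𝔤 : Type*) [AddCommGroup 𝔤] [Module ℝ 𝔤]
  (M : Type*) [TopologicalSpace M] [ChartedSpace H M] [IsManifold I ∞ M]
  {F K : Type*} [NormedAddCommGroup F] [NormedSpace ℝ F] [TopologicalSpace K]
  (J : ModelWithCorners ℝ F K) (𝔥 : Type*) [AddCommGroup 𝔥] [Module ℝ 𝔥]
  (N : Type*) [TopologicalSpace N] [ChartedSpace K N] [IsManifold J ∞ N]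

/-- Morphisms of graded manifolds `T[1]𝔤[1] × T[1]M → T[1]𝔥[1] × T[1]N`: a continuous map of the
underlying spaces and a morphism of sheaves of graded algebras over it, which is local, that is, it
maps functions that vanish at the image of a point to functions that vanish at that point. -/
@[ext]
structure GrMap where
  body : C(M, N)
  pull (U : Opens N) : Fun J 𝔥 U →ₐ[ℝ] Fun I 𝔤 (U.comap body)
  pull_res {U V : Opens N} (h : V ≤ U) (w : Fun J 𝔥 U) :
    pull V (Fun.res h w) = Fun.res (Opens.comap_mono body h) (pull U w)
  pull_homogeneous {U : Opens N} {n : ℕ} {w : Fun J 𝔥 U} (h : Fun.IsHomogeneous n w) :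
    Fun.IsHomogeneous n (pull U w)
  pull_local {U : Opens N} (w : Fun J 𝔥 U) (x : M) (hx : body x ∈ U) :
    Fun.value w ⟨body x, hx⟩ = 0 → Fun.value (pull U w) ⟨x, hx⟩ = 0

variable {I 𝔤 M J 𝔥 N}

variable {F' K' : Type*} [NormedAddCommGroup F'] [NormedSpace ℝ F'] [TopologicalSpace K']
  {J' : ModelWithCorners ℝ F' K'} {𝔨 : Type*} [AddCommGroup 𝔨] [Module ℝ 𝔨]
  {P : Type*} [TopologicalSpace P] [ChartedSpace K' P] [IsManifold J' ∞ P]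

/-- Composition of morphisms of graded manifolds. -/
def GrMap.comp (ψ : GrMap J 𝔥 N J' 𝔨 P) (φ : GrMap I 𝔤 M J 𝔥 N) : GrMap I 𝔤 M J' 𝔨 P where
  body := ψ.body.comp φ.body
  pull U := (φ.pull (U.comap ψ.body)).comp (ψ.pull U)
  pull_res {_ V} h w :=
    (congrArg (φ.pull (V.comap ψ.body)) (ψ.pull_res h w)).trans (φ.pull_res _ _)
  pull_homogeneous h := φ.pull_homogeneous (ψ.pull_homogeneous h)
  pull_local w x hx h := φ.pull_local _ x hx (ψ.pull_local w _ hx h)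

end Maps

section Lie

variable {E H : Type*} [NormedAddCommGroup E] [NormedSpace ℝ E] [TopologicalSpace H]
  {I : ModelWithCorners ℝ E H} {G : Type*} [TopologicalSpace G] [ChartedSpace H G]

variable {F K : Type*} [NormedAddCommGroup F] [NormedSpace ℝ F] [TopologicalSpace K]
  {J : ModelWithCorners ℝ F K} {N : Type*} [TopologicalSpace N] [ChartedSpace K N]
variable {F' K' : Type*} [NormedAddCommGroup F'] [NormedSpace ℝ F'] [TopologicalSpace K']
  {J' : ModelWithCorners ℝ F' K'} {P : Type*} [TopologicalSpace P] [ChartedSpace K' P]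
variable {F'' K'' : Type*} [NormedAddCommGroup F''] [NormedSpace ℝ F''] [TopologicalSpace K'']
  {J'' : ModelWithCorners ℝ F'' K''} {Z : Type*} [TopologicalSpace Z] [ChartedSpace K'' Z]

lemma contMDiff_vector [IsManifold I ∞ G] {f : Z → TangentBundle I G} {g : G}
    (hf : ContMDiff J'' I.tangent ∞ f) (hg : ∀ z, (f z).1 = g) :
    ContMDiff J'' 𝓘(ℝ, E) ∞ (fun z => ((f z).2 : E)) := by
  intro z₀
  have h := (Bundle.contMDiffAt_totalSpace.1 (hf z₀)).2
  refine h.congr_of_eventuallyEq (Filter.Eventually.of_forall fun z => ?_)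
  have key : ∀ p q : TangentBundle I G, p.1 = q.1 →
      (trivializationAt E (TangentSpace I) q.1 p).2 = (p.2 : E) := by
    rintro ⟨p, v⟩ ⟨q, w⟩ (rfl : p = q)
    rw [TangentBundle.trivializationAt_apply]
    have h2 := (tangentBundleCore I G).coordChange_self (achart H p) p (by simp) v
    rw [tangentBundleCore_coordChange] at h2
    exact h2
  exact (key _ _ ((hg z).trans (hg z₀).symm)).symm

lemma contMDiff_partial [IsManifold I ∞ G] [IsManifold J ∞ N] [IsManifold J' ∞ P] {m : N × P → G}
    (hm : ContMDiff (J.prod J') I ∞ m)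
    {a : Z → N} (ha : ContMDiff J'' J ∞ a) {b : Z → TangentBundle J' P}
    (hb : ContMDiff J'' J'.tangent ∞ b) {g : G} (hg : ∀ z, m (a z, (b z).1) = g) :
    ContMDiff J'' 𝓘(ℝ, E) ∞
      (fun z => (mfderiv J' I (fun y => m (a z, y)) (b z).1 (b z).2 : E)) := by
  have hz : ContMDiff J J.tangent ∞ (fun x : N => (⟨x, 0⟩ : TangentBundle J N)) :=
    Bundle.contMDiff_zeroSection ℝ (TangentSpace J (M := N))
  have h₁ : ContMDiff J'' (J.tangent.prod J'.tangent) ∞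
      (fun z => ((⟨a z, 0⟩ : TangentBundle J N), b z)) :=
    (hz.comp ha).prodMk hb
  have h₂ := ((hm.contMDiff_tangentMap (m := ∞) le_rfl).comp
    (contMDiff_equivTangentBundleProd_symm (I := J) (I' := J') (M := N) (M' := P) (n := ∞))).comp h₁
  have h₃ := contMDiff_vector h₂ (g := g) hg
  refine h₃.congr fun z => ?_
  have h₄ := mfderiv_prod_eq_add_apply (f := m) (p := (a z, (b z).1))
    (v := (show TangentSpace (J.prod J') (a z, (b z).1) from ((0 : F), ((b z).2 : F'))))
    (hm.mdifferentiableAt (by simp))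
  refine Eq.trans ?_ h₄.symm
  have h₅ : (mfderiv J I (fun y => m (y, (b z).1)) (a z)) 0 = 0 := ContinuousLinearMap.map_zero _
  have h₆ : ∀ s t : E, s = 0 → t = s + t := fun s t h => by rw [h, zero_add]
  exact h₆ _ _ h₅

variable [Group G]

variable (I) in
/-- The adjoint action of `g` on the Lie algebra: the derivative of `h ↦ g h g⁻¹` at `1`. -/
def Ad (g : G) : GroupLieAlgebra I G →ₗ[ℝ] GroupLieAlgebra I G :=
  (mfderiv I I (fun h : G => g * h * g⁻¹) 1).toLinearMap

variable (I J) in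
/-- The form `u⁻¹ du` with values in the Lie algebra, for a map `u` to the group: at `x`, it is the
derivative of `y ↦ u(x)⁻¹ u(y)`. -/
def mc (u : N → G) (x : N) : TangentSpace J x →ₗ[ℝ] GroupLieAlgebra I G :=
  (mfderiv J I (fun y => (u x)⁻¹ * u y) x).toLinearMap

instance [FiniteDimensional ℝ E] : FiniteDimensional ℝ (GroupLieAlgebra I G) :=
  inferInstanceAs (FiniteDimensional ℝ E)

lemma contMDiff_dual [FiniteDimensional ℝ E] (μ : Dual ℝ (GroupLieAlgebra I G)) {f : Z → E}
    (hf : ContMDiff J'' 𝓘(ℝ, E) ∞ f) : ContMDiff J'' 𝓘(ℝ, ℝ) ∞ (fun z => μ (f z)) :=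
  (LinearMap.toContinuousLinearMap (show E →ₗ[ℝ] ℝ from μ)).contMDiff.comp hf

lemma contMDiff_Ad [LieGroup I ∞ G] [FiniteDimensional ℝ E] {u : N → G} (hu : ContMDiff J I ∞ u)
    (μ : Dual ℝ (GroupLieAlgebra I G)) (v : GroupLieAlgebra I G) :
    ContMDiff J 𝓘(ℝ, ℝ) ∞ (fun x => μ (Ad I (u x)⁻¹ v)) := by
  have hm : ContMDiff (I.prod I) I ∞ (fun p : G × G => p.1⁻¹ * p.2 * p.1⁻¹⁻¹) :=
    ((contMDiff_fst.inv).mul contMDiff_snd).mul contMDiff_fst.inv.inv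
  exact contMDiff_dual μ (contMDiff_partial hm hu
    (b := fun _ => (⟨1, v⟩ : TangentBundle I G)) contMDiff_const (g := 1) fun z => by simp)

lemma smoothForm_mc [LieGroup I ∞ G] [IsManifold J ∞ N] [FiniteDimensional ℝ E] {u : N → G}
    (hu : ContMDiff J I ∞ u) (μ : Dual ℝ (GroupLieAlgebra I G)) :
    ContMDiff J.tangent 𝓘(ℝ, ℝ) ∞ (fun p : TangentBundle J N => μ (mc I J u p.1 p.2)) := by
  have hm : ContMDiff (I.prod J) I ∞ (fun p : G × N => p.1⁻¹ * u p.2) :=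
    contMDiff_fst.inv.mul (hu.comp contMDiff_snd)
  exact contMDiff_dual μ (contMDiff_partial hm
    (hu.comp (Bundle.contMDiff_proj (TangentSpace J (M := N)))) (b := id)
    contMDiff_id (g := 1) fun z => by simp)

end Lie

section Construct

variable {E H : Type*} [NormedAddCommGroup E] [NormedSpace ℝ E] [TopologicalSpace H]
  {I : ModelWithCorners ℝ E H} {𝔤 : Type*} [AddCommGroup 𝔤] [Module ℝ 𝔤]
  {M : Type*} [TopologicalSpace M] [ChartedSpace H M] [IsManifold I ∞ M]
  {F K : Type*} [NormedAddCommGroup F] [NormedSpace ℝ F] [TopologicalSpace K]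
  {J : ModelWithCorners ℝ F K} {𝔥 : Type*} [AddCommGroup 𝔥] [Module ℝ 𝔥]
  {N : Type*} [TopologicalSpace N] [ChartedSpace K N] [IsManifold J ∞ N]

/-- `η = Q w` over `U`, where `Q` is the vector field of degree one on `T[1]𝔤[1] × T[1]M` given by the
differential of the Weil algebra of `𝔤` and the de Rham differential of `M`; near each point, `w` is a
polynomial in functions, their differentials, `ξ` and `ξ̄`, on which `Q` is given by the Leibniz rule. -/
def Fun.IsD [Bracket 𝔤 𝔤] [FiniteDimensional ℝ 𝔤] {U : Opens M} (w η : Fun I 𝔤 U) : Prop :=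
  ∀ x ∈ U, ∃ (V : Opens M) (h : V ≤ U), x ∈ V ∧ HasD V (Raw.res h w.1) (Raw.res h η.1)

/-- A morphism of graded manifolds is one of dg-manifolds if it intertwines the differentials. -/
def GrMap.IsDG [Bracket 𝔤 𝔤] [FiniteDimensional ℝ 𝔤] [Bracket 𝔥 𝔥] [FiniteDimensional ℝ 𝔥]
    (φ : GrMap I 𝔤 M J 𝔥 N) : Prop :=
  ∀ (U : Opens N) (w η : Fun J 𝔥 U), Fun.IsD w η → Fun.IsD (φ.pull U w) (φ.pull U η)

/-- The pull-back of families along a map `h`, a bundle map `a` of trivial bundles and a form `θ`. -/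
def rawPull (h : M → N) (a : M → Dual ℝ 𝔥 →ₗ[ℝ] Dual ℝ 𝔤)
    (θ : ∀ x : M, Dual ℝ 𝔥 →ₗ[ℝ] Dual ℝ (TangentSpace I x)) (U : Opens N) (V : Opens M)
    (hV : ∀ x ∈ V, h x ∈ U) : Raw J 𝔥 U →ₐ[ℝ] Raw I 𝔤 V where
  toFun w x := Fib.hom (a x) (θ x) (mfderiv I J h x.1).toLinearMap (w ⟨h x, hV x x.2⟩)
  map_one' := funext fun _ => map_one _
  map_mul' _ _ := funext fun _ => map_mul _ _ _
  map_zero' := funext fun _ => map_zero _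
  map_add' _ _ := funext fun _ => map_add _ _ _
  commutes' _ := funext fun _ => AlgHom.commutes _ _

lemma mem_gen₁ [FiniteDimensional ℝ 𝔤] {V : Opens M} {c : M → Dual ℝ 𝔤}
    (hc : ∀ v, ContMDiff I 𝓘(ℝ, ℝ) ∞ (fun x => c x v)) :
    (fun x => Fib.gen₁ 𝔤 _ (c x, 0) : Raw I 𝔤 V) ∈ Fun I 𝔤 V := by
  have : (fun x => Fib.gen₁ 𝔤 _ (c x, 0) : Raw I 𝔤 V) = ∑ b,
      ((fun x => algebraMap ℝ _ (c x (finBasis ℝ 𝔤 b)) : Raw I 𝔤 V) *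
        (fun _ => Fib.gen₁ 𝔤 _ ((finBasis ℝ 𝔤).coord b, 0))) := by
    funext x
    simp only [Finset.sum_apply, Pi.mul_apply, ← Algebra.smul_def]
    have e := congrArg (Fib.gen₁ 𝔤 (TangentSpace I x.1) ∘ₗ LinearMap.inl ℝ _ _)
      ((finBasis ℝ 𝔤).sum_dual_apply_smul_coord (c x)).symm
    simpa only [map_sum, map_smul, LinearMap.comp_apply, LinearMap.inl_apply] using e
  rw [this]
  exact sum_mem fun b _ => mul_mem (IsGen.fn _ (hc _).contMDiffOn).mem (IsGen.xi _).mem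

lemma mem_gen₂ [FiniteDimensional ℝ 𝔤] {V : Opens M} {c : M → Dual ℝ 𝔤}
    (hc : ∀ v, ContMDiff I 𝓘(ℝ, ℝ) ∞ (fun x => c x v)) :
    (fun x => Fib.gen₂ 𝔤 _ (c x) : Raw I 𝔤 V) ∈ Fun I 𝔤 V := by
  have : (fun x => Fib.gen₂ 𝔤 _ (c x) : Raw I 𝔤 V) = ∑ b,
      ((fun x => algebraMap ℝ _ (c x (finBasis ℝ 𝔤 b)) : Raw I 𝔤 V) *
        (fun _ => Fib.gen₂ 𝔤 _ ((finBasis ℝ 𝔤).coord b))) := by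
    funext x
    simp only [Finset.sum_apply, Pi.mul_apply, ← Algebra.smul_def]
    have e := congrArg (Fib.gen₂ 𝔤 (TangentSpace I x.1))
      ((finBasis ℝ 𝔤).sum_dual_apply_smul_coord (c x)).symm
    simpa only [map_sum, map_smul] using e
  rw [this]
  exact sum_mem fun b _ => mul_mem (IsGen.fn _ (hc _).contMDiffOn).mem (IsGen.xibar _).mem

lemma rawPull_mem [FiniteDimensional ℝ 𝔤] {h : M → N} (hh : ContMDiff I J ∞ h)
    {a : M → Dual ℝ 𝔥 →ₗ[ℝ] Dual ℝ 𝔤} (ha : ∀ μ v, ContMDiff I 𝓘(ℝ, ℝ) ∞ (fun x => a x μ v))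
    {θ : ∀ x : M, Dual ℝ 𝔥 →ₗ[ℝ] Dual ℝ (TangentSpace I x)}
    (hθ : ∀ μ, ContMDiff I.tangent 𝓘(ℝ, ℝ) ∞ (fun p : TangentBundle I M => θ p.1 μ p.2))
    (U : Opens N) (V : Opens M) (hV : ∀ x ∈ V, h x ∈ U) {w : Raw J 𝔥 U} (hw : w ∈ Fun J 𝔥 U) :
    rawPull h a θ U V hV w ∈ Fun I 𝔤 V := by
  have key : ∀ (U : Opens N) (V : Opens M) (hV : ∀ x ∈ V, h x ∈ U),
      Algebra.adjoin ℝ {w : Raw J 𝔥 U | IsGen U w} ≤ (Fun I 𝔤 V).comap (rawPull h a θ U V hV) := by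
    intro U V hV
    refine Algebra.adjoin_le fun w hw => ?_
    show rawPull h a θ U V hV w ∈ Fun I 𝔤 V
    cases hw with
    | fn f hf =>
      have := (IsGen.fn (I := I) (𝔤 := 𝔤) (V := V) (fun x => f (h x))
        (hf.comp hh.contMDiffOn hV)).mem
      convert this using 1
      funext x
      exact AlgHom.commutes (Fib.hom (a x) (θ x) (mfderiv I J h x.1).toLinearMap) (f (h x))
    | form φ hφ =>
      have := (IsGen.form (I := I) (𝔤 := 𝔤) (V := V)
        (fun x => φ (h x) ∘ₗ (mfderiv I J h x).toLinearMap)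
        (hφ.comp (hh.contMDiff_tangentMap (m := ∞) le_rfl).contMDiffOn fun p hp => hV _ hp)).mem
      convert this using 1
      funext x
      simp [rawPull]
    | xi μ =>
      have := add_mem (mem_gen₁ (V := V) (ha μ)) (IsGen.form (I := I) (𝔤 := 𝔤) (V := V)
        (fun x => θ x μ) (hθ μ).contMDiffOn).mem
      convert this using 1
      funext x
      simp [rawPull, ← map_add]
    | xibar μ =>
      convert mem_gen₂ (V := V) (ha μ) using 1
      funext x
      simp [rawPull]
  refine Fun.mem_of_local fun x hx => ?_
  obtain ⟨U', hU', hxU', hw'⟩ := hw (h x) (hV x hx)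
  exact ⟨V ⊓ U'.comap ⟨h, hh.continuous⟩, inf_le_left, ⟨hx, hxU'⟩,
    key U' (V ⊓ U'.comap ⟨h, hh.continuous⟩) (fun x hx => hx.2) hw'⟩

/-- The morphism of graded manifolds over `h` which is given by the pull-back of forms along `h`, by
`ξ ↦ a ξ + θ ξ` and by `ξ̄ ↦ a ξ̄`. -/
def GrMap.ofData [FiniteDimensional ℝ 𝔤] (h : M → N) (hh : ContMDiff I J ∞ h)
    (a : M → Dual ℝ 𝔥 →ₗ[ℝ] Dual ℝ 𝔤) (ha : ∀ μ v, ContMDiff I 𝓘(ℝ, ℝ) ∞ (fun x => a x μ v))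
    (θ : ∀ x : M, Dual ℝ 𝔥 →ₗ[ℝ] Dual ℝ (TangentSpace I x))
    (hθ : ∀ μ, ContMDiff I.tangent 𝓘(ℝ, ℝ) ∞ (fun p : TangentBundle I M => θ p.1 μ p.2)) :
    GrMap I 𝔤 M J 𝔥 N where
  body := ⟨h, hh.continuous⟩
  pull U := ((rawPull h a θ U (U.comap ⟨h, hh.continuous⟩) (fun _ hx => hx)).comp
    (Fun J 𝔥 U).val).codRestrict _ fun w => rawPull_mem hh ha hθ U _ (fun _ hx => hx) w.2
  pull_res _ _ := rfl
  pull_homogeneous hw x := Fib.hom_deg _ _ _ (hw ⟨h x, x.2⟩)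
  pull_local _ _ _ hw := (Fib.aug_hom _ _ _ _).trans hw

variable (𝔤) in
/-- The morphism `id × T[1]h : T[1]𝔤[1] × T[1]M → T[1]𝔤[1] × T[1]N` for a smooth map `h`. -/
def GrMap.tangent [FiniteDimensional ℝ 𝔤] (h : M → N) (hh : ContMDiff I J ∞ h) :
    GrMap I 𝔤 M J 𝔤 N :=
  GrMap.ofData h hh (fun _ => LinearMap.id) (fun _ _ => contMDiff_const) 0
    (fun _ => contMDiff_const)

variable {EG HG : Type*} [NormedAddCommGroup EG] [NormedSpace ℝ EG] [FiniteDimensional ℝ EG]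
  [TopologicalSpace HG] {IG : ModelWithCorners ℝ EG HG} {G : Type*} [Group G] [TopologicalSpace G]
  [ChartedSpace HG G] [LieGroup IG ∞ G]

variable (IG) in
/-- The morphism `T[1]𝔤[1] × T[1]M → T[1]𝔤[1] × T[1]N` given by `T[1]h` and by
`(ν, ν̄) ↦ (u⁻¹ ν u + u⁻¹ du, u⁻¹ ν̄ u)`, for smooth maps `h : M → N` and `u : M → G`. -/
def GrMap.gauge (h : M → N) (hh : ContMDiff I J ∞ h) (u : M → G) (hu : ContMDiff I IG ∞ u) :
    GrMap I (GroupLieAlgebra IG G) M J (GroupLieAlgebra IG G) N :=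
  GrMap.ofData h hh (fun x => (Ad IG (u x)⁻¹).dualMap) (contMDiff_Ad hu)
    (fun x => (mc IG I u x).dualMap) (smoothForm_mc hu)

end Construct

/-- The bracket of the zero Lie algebra; with it, `T[1]M` is the case `𝔤 = 0` of
`T[1]𝔤[1] × T[1]M`. -/
instance : Bracket Unit Unit := ⟨fun _ _ => 0⟩

section Weil

variable {E H : Type*} [NormedAddCommGroup E] [NormedSpace ℝ E] [FiniteDimensional ℝ E]
  [TopologicalSpace H] (I : ModelWithCorners ℝ E H) (G : Type*) [Group G] [TopologicalSpace G]
  [ChartedSpace H G] [LieGroup I ∞ G]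

/-! The structure maps of the groupoid with objects `T[1]𝔤[1]` and morphisms `T[1]𝔤[1] × T[1]G`. Its
composable pairs of morphisms `(ν, ν̄; g₁, γ₁)`, `(s(ν, ν̄; g₁, γ₁); g₂, γ₂)` form the dg-manifold
`T[1]𝔤[1] × T[1](G × G)`. -/

/-- The target map `(ν, ν̄; g, γ) ↦ (ν, ν̄)`. -/
def weilTarget : GrMap I (GroupLieAlgebra I G) G 𝓘(ℝ, Unit) (GroupLieAlgebra I G) Unit :=
  GrMap.tangent _ (fun _ => ()) contMDiff_const

/-- The source map `(ν, ν̄; g, γ) ↦ (g⁻¹ ν g + g⁻¹ γ, g⁻¹ ν̄ g)`. -/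
def weilSource : GrMap I (GroupLieAlgebra I G) G 𝓘(ℝ, Unit) (GroupLieAlgebra I G) Unit :=
  GrMap.gauge I (fun _ => ()) contMDiff_const (fun g : G => g) contMDiff_id

/-- The unit map `(ν, ν̄) ↦ (ν, ν̄; 1, 0)`. -/
def weilUnit : GrMap 𝓘(ℝ, Unit) (GroupLieAlgebra I G) Unit I (GroupLieAlgebra I G) G :=
  GrMap.tangent _ (fun _ => 1) contMDiff_const

/-- The first morphism `(ν, ν̄; g₁, γ₁)` of a composable pair. -/
def weilFst : GrMap (I.prod I) (GroupLieAlgebra I G) (G × G) I (GroupLieAlgebra I G) G :=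
  GrMap.tangent _ (fun p => p.1) contMDiff_fst

/-- The second morphism `(g₁⁻¹ ν g₁ + g₁⁻¹ γ₁, g₁⁻¹ ν̄ g₁; g₂, γ₂)` of a composable pair. -/
def weilSnd : GrMap (I.prod I) (GroupLieAlgebra I G) (G × G) I (GroupLieAlgebra I G) G :=
  GrMap.gauge I (fun p => p.2) contMDiff_snd (fun p : G × G => p.1) contMDiff_fst

/-- The composition `(ν, ν̄; g₁ g₂, g₁ γ₂ + γ₁ g₂)` of a composable pair. -/
def weilMul : GrMap (I.prod I) (GroupLieAlgebra I G) (G × G) I (GroupLieAlgebra I G) G :=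
  GrMap.tangent _ (fun p => p.1 * p.2) (contMDiff_mul I ∞)

/-- The coordinate function `ξ` of degree one on `T[1]𝔤[1]` given by a linear form on `𝔤`. -/
def xi (μ : Dual ℝ (GroupLieAlgebra I G)) :
    Fun 𝓘(ℝ, Unit) (GroupLieAlgebra I G) (⊤ : Opens Unit) :=
  ⟨fun _ => Fib.gen₁ _ _ (μ, 0), (IsGen.xi μ).mem⟩

end Weil

section Cech

variable {X Y : Type*} (σ : Y → X)

/-- The morphisms of the Čech groupoid. -/
abbrev Cech₂ := {p : Y × Y // σ p.1 = σ p.2}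

/-- The composable pairs of morphisms of the Čech groupoid. -/
abbrev Cech₃ := {p : Y × Y × Y // σ p.1 = σ p.2.1 ∧ σ p.2.1 = σ p.2.2}

variable {σ}

/-- The target map `(y₁, y₂) ↦ y₁`. -/
def Cech₂.fst (p : Cech₂ σ) : Y := p.1.1

/-- The source map `(y₁, y₂) ↦ y₂`. -/
def Cech₂.snd (p : Cech₂ σ) : Y := p.1.2

variable (σ) in
/-- The unit map `y ↦ (y, y)`. -/
def Cech₂.diag (y : Y) : Cech₂ σ := ⟨(y, y), rfl⟩

/-- The first morphism `(y₁, y₂)` of a composable pair. -/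
def Cech₃.p₁₂ (p : Cech₃ σ) : Cech₂ σ := ⟨(p.1.1, p.1.2.1), p.2.1⟩

/-- The second morphism `(y₂, y₃)` of a composable pair. -/
def Cech₃.p₂₃ (p : Cech₃ σ) : Cech₂ σ := ⟨(p.1.2.1, p.1.2.2), p.2.2⟩

/-- The composition `(y₁, y₃)` of a composable pair. -/
def Cech₃.p₁₃ (p : Cech₃ σ) : Cech₂ σ := ⟨(p.1.1, p.1.2.2), p.2.1.trans p.2.2⟩

variable {E H : Type*} [NormedAddCommGroup E] [NormedSpace ℝ E] [TopologicalSpace H]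
  (I : ModelWithCorners ℝ E H) [TopologicalSpace Y] [ChartedSpace H Y] [IsManifold I ∞ Y]
  {E₂ H₂ : Type*} [NormedAddCommGroup E₂] [NormedSpace ℝ E₂] [TopologicalSpace H₂]
  (I₂ : ModelWithCorners ℝ E₂ H₂) [ChartedSpace H₂ (Cech₂ σ)] [IsManifold I₂ ∞ (Cech₂ σ)]
  {E₃ H₃ : Type*} [NormedAddCommGroup E₃] [NormedSpace ℝ E₃] [TopologicalSpace H₃]
  (I₃ : ModelWithCorners ℝ E₃ H₃) [ChartedSpace H₃ (Cech₃ σ)] [IsManifold I₃ ∞ (Cech₃ σ)]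

variable (σ) in
/-- The manifold structures of the fibre products `Y ×_X Y` and `Y ×_X Y ×_X Y` are those of
embedded submanifolds of `Y × Y` and `Y × Y × Y`. -/
structure IsCech : Prop where
  emb₂ : Manifold.IsSmoothEmbedding I₂ (I.prod I) ∞ (Subtype.val : Cech₂ σ → Y × Y)
  emb₃ : Manifold.IsSmoothEmbedding I₃ (I.prod (I.prod I)) ∞ (Subtype.val : Cech₃ σ → Y × Y × Y)

variable {I I₂ I₃}

namespace IsCech

set_option linter.unusedSectionVars false

lemma contMDiff_fst (h : IsCech σ I I₂ I₃) : ContMDiff I₂ I ∞ (Cech₂.fst (σ := σ)) :=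
  _root_.contMDiff_fst.comp h.emb₂.contMDiff

lemma contMDiff_snd (h : IsCech σ I I₂ I₃) : ContMDiff I₂ I ∞ (Cech₂.snd (σ := σ)) :=
  _root_.contMDiff_snd.comp h.emb₂.contMDiff

lemma contMDiff_diag (h : IsCech σ I I₂ I₃) : ContMDiff I I₂ ∞ (Cech₂.diag σ) :=
  (ContMDiff.iff_comp_isImmersion h.emb₂.isImmersion).2
    ⟨by unfold Cech₂.diag; fun_prop, contMDiff_id.prodMk contMDiff_id⟩

lemma contMDiff_p₁₂ (h : IsCech σ I I₂ I₃) : ContMDiff I₃ I₂ ∞ (Cech₃.p₁₂ (σ := σ)) := by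
  have h₃ := h.emb₃.contMDiff
  exact (ContMDiff.iff_comp_isImmersion h.emb₂.isImmersion).2
    ⟨by unfold Cech₃.p₁₂; fun_prop, (_root_.contMDiff_fst.comp h₃).prodMk
      (_root_.contMDiff_fst.comp (_root_.contMDiff_snd.comp h₃))⟩

lemma contMDiff_p₂₃ (h : IsCech σ I I₂ I₃) : ContMDiff I₃ I₂ ∞ (Cech₃.p₂₃ (σ := σ)) := by
  have h₃ := h.emb₃.contMDiff
  exact (ContMDiff.iff_comp_isImmersion h.emb₂.isImmersion).2
    ⟨by unfold Cech₃.p₂₃; fun_prop, _root_.contMDiff_snd.comp h₃⟩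

lemma contMDiff_p₁₃ (h : IsCech σ I I₂ I₃) : ContMDiff I₃ I₂ ∞ (Cech₃.p₁₃ (σ := σ)) := by
  have h₃ := h.emb₃.contMDiff
  exact (ContMDiff.iff_comp_isImmersion h.emb₂.isImmersion).2
    ⟨by unfold Cech₃.p₁₃; fun_prop, (_root_.contMDiff_fst.comp h₃).prodMk
      (_root_.contMDiff_snd.comp (_root_.contMDiff_snd.comp h₃))⟩

/-- The target map of `T[1]` of the Čech groupoid. -/
def target (h : IsCech σ I I₂ I₃) : GrMap I₂ Unit (Cech₂ σ) I Unit Y :=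
  GrMap.tangent _ Cech₂.fst h.contMDiff_fst

/-- The source map of `T[1]` of the Čech groupoid. -/
def source (h : IsCech σ I I₂ I₃) : GrMap I₂ Unit (Cech₂ σ) I Unit Y :=
  GrMap.tangent _ Cech₂.snd h.contMDiff_snd

/-- The unit map of `T[1]` of the Čech groupoid. -/
def unit (h : IsCech σ I I₂ I₃) : GrMap I Unit Y I₂ Unit (Cech₂ σ) :=
  GrMap.tangent _ (Cech₂.diag σ) h.contMDiff_diag

/-- The first morphism of a composable pair in `T[1]` of the Čech groupoid. -/
def fst (h : IsCech σ I I₂ I₃) : GrMap I₃ Unit (Cech₃ σ) I₂ Unit (Cech₂ σ) :=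
  GrMap.tangent _ Cech₃.p₁₂ h.contMDiff_p₁₂

/-- The second morphism of a composable pair in `T[1]` of the Čech groupoid. -/
def snd (h : IsCech σ I I₂ I₃) : GrMap I₃ Unit (Cech₃ σ) I₂ Unit (Cech₂ σ) :=
  GrMap.tangent _ Cech₃.p₂₃ h.contMDiff_p₂₃

/-- The composition of a composable pair in `T[1]` of the Čech groupoid. -/
def mul (h : IsCech σ I I₂ I₃) : GrMap I₃ Unit (Cech₃ σ) I₂ Unit (Cech₂ σ) :=
  GrMap.tangent _ Cech₃.p₁₃ h.contMDiff_p₁₃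

end IsCech

section Functors

variable {EG HG : Type*} [NormedAddCommGroup EG] [NormedSpace ℝ EG] [FiniteDimensional ℝ EG]
  [TopologicalSpace HG] (IG : ModelWithCorners ℝ EG HG) (G : Type*) [Group G] [TopologicalSpace G]
  [ChartedSpace HG G] [LieGroup IG ∞ G] (h : IsCech σ I I₂ I₃)

/-- Functors of dg-Lie groupoids from `T[1]` of the Čech groupoid to `T[1]𝔤[1] × T[1]G ⇉ T[1]𝔤[1]`:
morphisms of dg-manifolds on objects and on morphisms which are compatible with targets, sources,
units and compositions. -/
@[ext]
structure DGFunctor where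
  obj : GrMap I Unit Y 𝓘(ℝ, Unit) (GroupLieAlgebra IG G) Unit
  mor : GrMap I₂ Unit (Cech₂ σ) IG (GroupLieAlgebra IG G) G
  obj_dg : obj.IsDG
  mor_dg : mor.IsDG
  map_target : (weilTarget IG G).comp mor = obj.comp h.target
  map_source : (weilSource IG G).comp mor = obj.comp h.source
  map_unit : mor.comp h.unit = (weilUnit IG G).comp obj
  map_mul : ∃ c : GrMap I₃ Unit (Cech₃ σ) (IG.prod IG) (GroupLieAlgebra IG G) (G × G), c.IsDG ∧
    (weilFst IG G).comp c = mor.comp h.fst ∧ (weilSnd IG G).comp c = mor.comp h.snd ∧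
    (weilMul IG G).comp c = mor.comp h.mul

variable {IG G h}

/-- Natural isomorphisms of functors of dg-Lie groupoids: a morphism of dg-manifolds `α` from the
objects to the morphisms such that `α(y)` is a morphism with target `Φ(y)` and source `Ψ(y)`, with
`Φ(y₁, y₂) ∘ α(y₂) = α(y₁) ∘ Ψ(y₁, y₂)`. -/
@[ext]
structure DGNatIso (Φ Ψ : DGFunctor IG G h) where
  app : GrMap I Unit Y IG (GroupLieAlgebra IG G) G
  app_dg : app.IsDG
  app_target : (weilTarget IG G).comp app = Φ.obj
  app_source : (weilSource IG G).comp app = Ψ.obj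
  natural : ∃ c c' : GrMap I₂ Unit (Cech₂ σ) (IG.prod IG) (GroupLieAlgebra IG G) (G × G),
    c.IsDG ∧ c'.IsDG ∧
    (weilFst IG G).comp c = Φ.mor ∧ (weilSnd IG G).comp c = app.comp h.source ∧
    (weilFst IG G).comp c' = app.comp h.target ∧ (weilSnd IG G).comp c' = Ψ.mor ∧
    (weilMul IG G).comp c = (weilMul IG G).comp c'

/-- The natural isomorphism `γ` is the composition of `α` and `β`: `γ(y) = α(y) ∘ β(y)`. -/
def DGNatIso.IsComp {Φ Ψ Ξ : DGFunctor IG G h} (α : DGNatIso Φ Ψ) (β : DGNatIso Ψ Ξ)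
    (γ : DGNatIso Φ Ξ) : Prop :=
  ∃ c : GrMap I Unit Y (IG.prod IG) (GroupLieAlgebra IG G) (G × G), c.IsDG ∧
    (weilFst IG G).comp c = α.app ∧ (weilSnd IG G).comp c = β.app ∧
    (weilMul IG G).comp c = γ.app

end Functors

section Cocycles

variable {EG HG : Type*} [NormedAddCommGroup EG] [NormedSpace ℝ EG] [TopologicalSpace HG]
  (IG : ModelWithCorners ℝ EG HG) (G : Type*) [Group G] [TopologicalSpace G] [ChartedSpace HG G]

variable (σ I I₂) in
/-- Differential cocycles of principal `G`-bundles with connection subordinate to `σ`: transition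
functions `g` on `Y ×_X Y` and a one-form `A` on `Y` with values in the Lie algebra, with
`g(y₁, y₂) g(y₂, y₃) = g(y₁, y₃)` and `A(y₂) = g⁻¹ A(y₁) g + g⁻¹ dg` on `Y ×_X Y`. -/
@[ext]
structure DiffCocycle where
  g : Cech₂ σ → G
  A (y : Y) : TangentSpace I y →ₗ[ℝ] GroupLieAlgebra IG G
  smooth_g : ContMDiff I₂ IG ∞ g
  smooth_A (μ : Dual ℝ (GroupLieAlgebra IG G)) : SmoothForm I (fun y => μ ∘ₗ A y) Set.univ
  cocycle (p : Cech₃ σ) : g p.p₁₂ * g p.p₂₃ = g p.p₁₃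
  glue (p : Cech₂ σ) (v : TangentSpace I₂ p) :
    A p.snd (mfderiv I₂ I Cech₂.snd p v) =
      Ad IG (g p)⁻¹ (A p.fst (mfderiv I₂ I Cech₂.fst p v)) + mc IG I₂ g p v

variable {IG G}

/-- Gauge transformations between differential cocycles: maps `p : Y → G` with
`g̃(y₁, y₂) = p(y₁)⁻¹ g(y₁, y₂) p(y₂)` and `Ã = p⁻¹ A p + p⁻¹ dp`. -/
@[ext]
structure GaugeTrafo (a b : DiffCocycle σ I I₂ IG G) where
  p : Y → G
  smooth_p : ContMDiff I IG ∞ p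
  map_g (q : Cech₂ σ) : b.g q = (p q.fst)⁻¹ * a.g q * p q.snd
  map_A (y : Y) (v : TangentSpace I y) : b.A y v = Ad IG (p y)⁻¹ (a.A y v) + mc IG I p y v

end Cocycles

end Cech

end

end DGBundle

open DGBundle

namespace DGBundle

noncomputable section

/-! Everything rests on one classification: morphisms of dg-manifolds from $T[1]M$ to $T[1]\mathfrak
h[1]\times T[1]N$ are the same as pairs of a smooth map $h:M\to N$ and a one-form $A$ on $M$ with
values in $\mathfrak h$. Locality and degree force functions to be pulled back along the body;
compatibility with the differential then forces the same for $df$, hence for all forms. The $\xi$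
must go to one-forms, since $T[1]M$ has no other functions of degree one, and these one-forms are
the components of $A$. Finally $\bar\xi=d\xi+\tfrac12[\xi,\xi]$ must go to the curvature
$F=dA+\tfrac12[A,A]$. This is `GrMap.IsDG.eq_ofConn`. Conversely every pair gives a morphism
`GrMap.ofConn`, and the one condition that is not automatic, the one on $d\bar\xi$, is the Bianchi
identity (`bianchi_sum`, `GrMap.ofConn_isDG`).

Composition with structure maps then becomes an operation on pairs: forms are pulled back along maps
of the Čech groupoid, and the source map of the target groupoid replaces $A$ by $u^{-1}Au+u^{-1}du$.
The latter needs $F$ to transform by the adjoint action (`Conn.curv_gauge`), which follows from the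
Maurer–Cartan equation (`dForm_mc`) and the derivative of $\mathrm{Ad}$ (`diff_dual_Ad`). A functor
is therefore a form $A$ on $Y$ together with a map $g$ and a form on $Y^{[2]}$. Targets say that the
second form is the pull-back of $A$ along $y_1$, sources are the gluing law, compositions are the
cocycle condition, and units are automatic. Natural isomorphisms are read in the same way: the form
of $\alpha$ is that of $\Phi_0$, so only $p$ remains.

The differential is given as a relation generated by the Leibniz rule, so its values must be shown
to be unique where they are used. Evaluation on two tangent vectors, with values in `Lam`, yields
Cartan's formulas (`HasD.components`), and these determine the differential whenever it is known to
be a one-form or a two-form. -/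

/-- The exterior algebra of the plane: `⟨a, b, c, d⟩` stands for `a + b θ₁ + c θ₂ + d θ₁ θ₂`. -/
@[ext]
structure Lam where
  a : ℝ
  b : ℝ
  c : ℝ
  d : ℝ

/-! ### Arithmetic in the exterior algebra of the plane -/

namespace Lam

instance : Zero Lam := ⟨⟨0, 0, 0, 0⟩⟩
instance : One Lam := ⟨⟨1, 0, 0, 0⟩⟩
instance : Add Lam := ⟨fun x y => ⟨x.a + y.a, x.b + y.b, x.c + y.c, x.d + y.d⟩⟩
instance : Neg Lam := ⟨fun x => ⟨-x.a, -x.b, -x.c, -x.d⟩⟩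
instance : Mul Lam := ⟨fun x y => ⟨x.a * y.a, x.a * y.b + x.b * y.a, x.a * y.c + x.c * y.a,
  x.a * y.d + x.d * y.a + x.b * y.c - x.c * y.b⟩⟩

@[simp] lemma zero_a : (0 : Lam).a = 0 := rfl
@[simp] lemma zero_b : (0 : Lam).b = 0 := rfl
@[simp] lemma zero_c : (0 : Lam).c = 0 := rfl
@[simp] lemma zero_d : (0 : Lam).d = 0 := rfl
@[simp] lemma one_a : (1 : Lam).a = 1 := rfl
@[simp] lemma one_b : (1 : Lam).b = 0 := rfl
@[simp] lemma one_c : (1 : Lam).c = 0 := rfl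
@[simp] lemma one_d : (1 : Lam).d = 0 := rfl
@[simp] lemma add_a (x y : Lam) : (x + y).a = x.a + y.a := rfl
@[simp] lemma add_b (x y : Lam) : (x + y).b = x.b + y.b := rfl
@[simp] lemma add_c (x y : Lam) : (x + y).c = x.c + y.c := rfl
@[simp] lemma add_d (x y : Lam) : (x + y).d = x.d + y.d := rfl
@[simp] lemma neg_a (x : Lam) : (-x).a = -x.a := rfl
@[simp] lemma neg_b (x : Lam) : (-x).b = -x.b := rfl
@[simp] lemma neg_c (x : Lam) : (-x).c = -x.c := rfl
@[simp] lemma neg_d (x : Lam) : (-x).d = -x.d := rfl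
@[simp] lemma mul_a (x y : Lam) : (x * y).a = x.a * y.a := rfl
@[simp] lemma mul_b (x y : Lam) : (x * y).b = x.a * y.b + x.b * y.a := rfl
@[simp] lemma mul_c (x y : Lam) : (x * y).c = x.a * y.c + x.c * y.a := rfl
@[simp] lemma mul_d (x y : Lam) :
    (x * y).d = x.a * y.d + x.d * y.a + x.b * y.c - x.c * y.b := rfl

instance : Ring Lam where
  add_assoc _ _ _ := by ext <;> simp <;> ring
  zero_add _ := by ext <;> simp
  add_zero _ := by ext <;> simp
  add_comm _ _ := by ext <;> simp <;> ring
  left_distrib _ _ _ := by ext <;> simp <;> ring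
  right_distrib _ _ _ := by ext <;> simp <;> ring
  zero_mul _ := by ext <;> simp
  mul_zero _ := by ext <;> simp
  mul_assoc _ _ _ := by ext <;> simp <;> ring
  one_mul _ := by ext <;> simp
  mul_one _ := by ext <;> simp
  neg_add_cancel _ := by ext <;> simp
  nsmul := nsmulRec
  zsmul := zsmulRec

instance : Algebra ℝ Lam where
  smul r x := ⟨r * x.a, r * x.b, r * x.c, r * x.d⟩
  algebraMap :=
    { toFun := fun r => ⟨r, 0, 0, 0⟩
      map_one' := rfl
      map_mul' := fun _ _ => by ext <;> simp
      map_zero' := rfl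
      map_add' := fun _ _ => by ext <;> simp }
  commutes' r x := by ext <;> simp [mul_comm]
  smul_def' r x := by ext <;> simp <;> rfl

@[simp] lemma smul_a (r : ℝ) (x : Lam) : (r • x).a = r * x.a := rfl
@[simp] lemma smul_b (r : ℝ) (x : Lam) : (r • x).b = r * x.b := rfl
@[simp] lemma smul_c (r : ℝ) (x : Lam) : (r • x).c = r * x.c := rfl
@[simp] lemma smul_d (r : ℝ) (x : Lam) : (r • x).d = r * x.d := rfl
@[simp] lemma algebraMap_a (r : ℝ) : (algebraMap ℝ Lam r).a = r := rfl
@[simp] lemma algebraMap_b (r : ℝ) : (algebraMap ℝ Lam r).b = 0 := rfl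
@[simp] lemma algebraMap_c (r : ℝ) : (algebraMap ℝ Lam r).c = 0 := rfl
@[simp] lemma algebraMap_d (r : ℝ) : (algebraMap ℝ Lam r).d = 0 := rfl

/-- The coefficient of `θ₁ θ₂`, as a linear map. -/
def dLin : Lam →ₗ[ℝ] ℝ where
  toFun := d
  map_add' _ _ := rfl
  map_smul' _ _ := rfl

end Lam

/-! ### Fibrewise algebra: evaluation on two vectors, signs and degrees -/

section Fibre

variable {𝔤 𝔥 V W : Type*} [AddCommGroup 𝔤] [Module ℝ 𝔤] [AddCommGroup 𝔥] [Module ℝ 𝔥]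
  [AddCommGroup V] [Module ℝ V] [AddCommGroup W] [Module ℝ W]

/-- Evaluation on two tangent vectors: restriction of elements of the fibre to the plane which the
vectors span, with the coordinates `ξ` and `ξ̄` set to zero. -/
def Fib.ev (u v : V) : Fib 𝔤 V →ₐ[ℝ] Lam :=
  Algebra.TensorProduct.lift ((Algebra.ofId ℝ Lam).comp SymmetricAlgebra.algebraMapInv)
    (ExteriorAlgebra.lift ℝ ⟨
      { toFun := fun l => ⟨0, l.2 u, l.2 v, 0⟩
        map_add' := fun _ _ => by ext <;> simp
        map_smul' := fun _ _ => by ext <;> simp },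
      fun l => by ext <;> simp [mul_comm]⟩)
    (fun x _ => Algebra.commutes (SymmetricAlgebra.algebraMapInv x) _)

@[simp] lemma Fib.ev_gen₁ (u v : V) (l : Dual ℝ 𝔤 × Dual ℝ V) :
    Fib.ev u v (Fib.gen₁ 𝔤 V l) = ⟨0, l.2 u, l.2 v, 0⟩ := by
  refine (Algebra.TensorProduct.lift_tmul _ _ _ 1 (ExteriorAlgebra.ι ℝ l)).trans ?_
  rw [map_one, one_mul]
  exact ExteriorAlgebra.lift_ι_apply _ _ _ _

@[simp] lemma Fib.ev_gen₂ (u v : V) (μ : Dual ℝ 𝔤) : Fib.ev u v (Fib.gen₂ 𝔤 V μ) = 0 := by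
  simp [Fib.ev, Fib.gen₂, SymmetricAlgebra.algebraMapInv]

@[elab_as_elim]
lemma Fib.induction {p : Fib 𝔤 V → Prop} (algebraMap : ∀ r, p (algebraMap ℝ _ r))
    (gen₁ : ∀ l, p (Fib.gen₁ 𝔤 V l)) (gen₂ : ∀ μ, p (Fib.gen₂ 𝔤 V μ))
    (mul : ∀ x y, p x → p y → p (x * y)) (add : ∀ x y, p x → p y → p (x + y)) (x : Fib 𝔤 V) :
    p x := by
  induction x using TensorProduct.induction_on with
  | zero => simpa using algebraMap 0
  | add x y hx hy => exact add x y hx hy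
  | tmul s t =>
    -- A pure tensor is a product of an element of the symmetric algebra and one of the exterior
    -- algebra, so each factor can be treated by its own induction.
    have h : s ⊗ₜ[ℝ] t = (s ⊗ₜ[ℝ] 1 : Fib 𝔤 V) * 1 ⊗ₜ[ℝ] t := by simp
    rw [h]
    clear h
    apply mul
    · induction s using SymmetricAlgebra.induction with
      | algebraMap r => simpa using algebraMap r
      | ι μ => exact gen₂ μ
      | mul a b ha hb => simpa using mul _ _ ha hb
      | add a b ha hb => rw [TensorProduct.add_tmul]; exact add _ _ ha hb
    · induction t using ExteriorAlgebra.induction with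
      | algebraMap r =>
        have := algebraMap r
        rwa [Algebra.TensorProduct.algebraMap_apply, Algebra.algebraMap_eq_smul_one,
          TensorProduct.smul_tmul, ← Algebra.algebraMap_eq_smul_one] at this
      | ι l => exact gen₁ l
      | mul a b ha hb => simpa using mul _ _ ha hb
      | add a b ha hb => rw [TensorProduct.tmul_add]; exact add _ _ ha hb

@[simp] lemma Fib.invol_gen₁ (l : Dual ℝ 𝔤 × Dual ℝ V) :
    Fib.invol 𝔤 V (Fib.gen₁ 𝔤 V l) = (-1 : ℝ) • Fib.gen₁ 𝔤 V l := by
  have : CliffordAlgebra.involute (ExteriorAlgebra.ι ℝ l) = (-1 : ℝ) • ExteriorAlgebra.ι ℝ l := by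
    rw [neg_one_smul]
    exact CliffordAlgebra.involute_ι _
  simp only [Fib.invol, Fib.gen₁, LinearMap.comp_apply, AlgHom.toLinearMap_apply,
    Algebra.TensorProduct.includeRight_apply, Algebra.TensorProduct.map_tmul, map_one, this,
    TensorProduct.tmul_smul]

@[simp] lemma Fib.invol_gen₂ (μ : Dual ℝ 𝔤) :
    Fib.invol 𝔤 V (Fib.gen₂ 𝔤 V μ) = Fib.gen₂ 𝔤 V μ := by
  simp [Fib.invol, Fib.gen₂]

/-- Evaluation respects parity: the components $1$ and $\theta_1\theta_2$ are even, the other two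
are odd. This carries the sign in the Leibniz rule over to `Lam`. -/
lemma Fib.ev_invol (u v : V) (x : Fib 𝔤 V) : Fib.ev u v (Fib.invol 𝔤 V x) =
    ⟨(Fib.ev u v x).a, -(Fib.ev u v x).b, -(Fib.ev u v x).c, (Fib.ev u v x).d⟩ := by
  induction x using Fib.induction with
  | algebraMap r => rw [AlgHom.commutes, AlgHom.commutes]; ext <;> simp
  | gen₁ l => ext <;> simp
  | gen₂ μ => ext <;> simp
  | mul x y hx hy => ext <;> simp [map_mul, hx, hy] <;> ring
  | add x y hx hy => ext <;> simp [map_add, hx, hy] <;> ring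

lemma Fib.ev_a (u v : V) (x : Fib 𝔤 V) : (Fib.ev u v x).a = Fib.aug 𝔤 V x := by
  induction x using Fib.induction with
  | algebraMap r => rw [AlgHom.commutes, AlgHom.commutes]; rfl
  | gen₁ l => simp
  | gen₂ μ => simp
  | mul x y hx hy => simp [map_mul, hx, hy]
  | add x y hx hy => simp [map_add, hx, hy]

lemma Fib.gen₁_mul_self (l : Dual ℝ 𝔤 × Dual ℝ V) : Fib.gen₁ 𝔤 V l * Fib.gen₁ 𝔤 V l = 0 := by
  simp [Fib.gen₁]

/-- Polarisation of the vanishing of squares. The sign is kept as a scalar $-1$. -/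
lemma Fib.gen₁_mul_gen₁ (l m : Dual ℝ 𝔤 × Dual ℝ V) :
    Fib.gen₁ 𝔤 V l * Fib.gen₁ 𝔤 V m = (-1 : ℝ) • (Fib.gen₁ 𝔤 V m * Fib.gen₁ 𝔤 V l) := by
  have h := Fib.gen₁_mul_self (l + m)
  simp only [map_add, mul_add, add_mul, Fib.gen₁_mul_self, zero_add, add_zero] at h
  rw [add_comm] at h
  exact (eq_neg_of_add_eq_zero_left h).trans (neg_one_smul ℝ _).symm

lemma Fib.commute_gen₂ (μ : Dual ℝ 𝔤) (x : Fib 𝔤 V) : Commute (Fib.gen₂ 𝔤 V μ) x := by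
  induction x using Fib.induction with
  | algebraMap r => exact (Algebra.commutes r _).symm
  | gen₁ l => simp [Commute, SemiconjBy, Fib.gen₁, Fib.gen₂]
  | gen₂ ν => simp [Commute, SemiconjBy, Fib.gen₂, mul_comm]
  | mul x y hx hy => exact hx.mul_right hy
  | add x y hx hy => exact hx.add_right hy

/-- Moving a generator of degree one past the product costs two signs, which cancel. -/
lemma Fib.commute_gen₁_mul (l m : Dual ℝ 𝔤 × Dual ℝ V) (x : Fib 𝔤 V) :
    Commute (Fib.gen₁ 𝔤 V l * Fib.gen₁ 𝔤 V m) x := by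
  induction x using Fib.induction with
  | algebraMap r => exact (Algebra.commutes r _).symm
  | gen₁ k =>
    show _ * _ * _ = _ * (_ * _)
    rw [mul_assoc, Fib.gen₁_mul_gen₁ m, mul_smul_comm, ← mul_assoc, Fib.gen₁_mul_gen₁ l k,
      smul_mul_assoc, smul_smul, mul_assoc]
    norm_num
  | gen₂ ν => exact (Fib.commute_gen₂ ν _).symm
  | mul x y hx hy => exact hx.mul_right hy
  | add x y hx hy => exact hx.add_right hy

variable (𝔤 V) in
/-- The elements of the fibre which are linear forms on the tangent space. -/
def Fib.forms : Submodule ℝ (Fib 𝔤 V) :=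
  LinearMap.range (Fib.gen₁ 𝔤 V ∘ₗ LinearMap.inr ℝ _ _)

lemma Fib.gen₁_mem_forms (l : Dual ℝ V) : Fib.gen₁ 𝔤 V (0, l) ∈ Fib.forms 𝔤 V := ⟨l, rfl⟩

lemma Fib.mul_mem_forms (l m : Dual ℝ V) :
    Fib.gen₁ 𝔤 V (0, l) * Fib.gen₁ 𝔤 V (0, m) ∈ Fib.forms 𝔤 V * Fib.forms 𝔤 V :=
  Submodule.mul_mem_mul (Fib.gen₁_mem_forms l) (Fib.gen₁_mem_forms m)

lemma Fib.commute_of_mem_forms {x : Fib 𝔤 V} (hx : x ∈ Fib.forms 𝔤 V * Fib.forms 𝔤 V)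
    (y : Fib 𝔤 V) : Commute x y := by
  induction hx using Submodule.mul_induction_on' with
  | mem_mul_mem m hm n hn =>
    obtain ⟨l, rfl⟩ := hm
    obtain ⟨k, rfl⟩ := hn
    exact Fib.commute_gen₁_mul _ _ y
  | add x _ y _ hx hy => exact hx.add_left hy

lemma Fib.invol_of_mem_forms {x : Fib 𝔤 V} (hx : x ∈ Fib.forms 𝔤 V * Fib.forms 𝔤 V) :
    Fib.invol 𝔤 V x = x := by
  induction hx using Submodule.mul_induction_on' with
  | mem_mul_mem m hm n hn =>
    obtain ⟨l, rfl⟩ := hm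
    obtain ⟨k, rfl⟩ := hn
    rw [map_mul, LinearMap.comp_apply, LinearMap.comp_apply, Fib.invol_gen₁, Fib.invol_gen₁,
      smul_mul_smul_comm]
    norm_num
  | add x _ y _ hx hy => rw [map_add, hx, hy]

lemma Fib.sum_coord_gen₁ [FiniteDimensional ℝ V] (l : Dual ℝ V) :
    ∑ b, l (finBasis ℝ V b) • Fib.gen₁ 𝔤 V (0, (finBasis ℝ V).coord b) = Fib.gen₁ 𝔤 V (0, l) := by
  have e := congrArg (Fib.gen₁ 𝔤 V ∘ₗ LinearMap.inr ℝ _ _)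
    ((finBasis ℝ V).sum_dual_apply_smul_coord l)
  simpa only [map_sum, map_smul, LinearMap.comp_apply, LinearMap.inr_apply] using e

/-- A two-form is determined by its values on pairs of vectors. -/
lemma Fib.eq_sum_of_mem_forms [FiniteDimensional ℝ V] {x : Fib 𝔤 V}
    (hx : x ∈ Fib.forms 𝔤 V * Fib.forms 𝔤 V) :
    x = (1 / 2 : ℝ) • ∑ b, ∑ c, (Fib.ev (finBasis ℝ V b) (finBasis ℝ V c) x).d •
      (Fib.gen₁ 𝔤 V (0, (finBasis ℝ V).coord b) * Fib.gen₁ 𝔤 V (0, (finBasis ℝ V).coord c)) := by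
  induction hx using Submodule.mul_induction_on' with
  | mem_mul_mem m hm n hn =>
    obtain ⟨l, rfl⟩ := hm
    obtain ⟨k, rfl⟩ := hn
    have key : ∀ l k : Dual ℝ V, ∑ b, ∑ c, (l (finBasis ℝ V b) * k (finBasis ℝ V c)) •
      (Fib.gen₁ 𝔤 V (0, (finBasis ℝ V).coord b) * Fib.gen₁ 𝔤 V (0, (finBasis ℝ V).coord c)) =
        Fib.gen₁ 𝔤 V (0, l) * Fib.gen₁ 𝔤 V (0, k) := by
      intro l k
      rw [← Fib.sum_coord_gen₁ l, ← Fib.sum_coord_gen₁ k, Finset.sum_mul_sum]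
      simp only [smul_mul_smul_comm]
    have key' : ∑ b, ∑ c, (l (finBasis ℝ V c) * k (finBasis ℝ V b)) •
      (Fib.gen₁ 𝔤 V (0, (finBasis ℝ V).coord b) * Fib.gen₁ 𝔤 V (0, (finBasis ℝ V).coord c)) =
        Fib.gen₁ 𝔤 V (0, k) * Fib.gen₁ 𝔤 V (0, l) := by
      rw [← key k l]
      simp only [mul_comm]
    -- The value of $l\wedge k$ on a pair of basis vectors is antisymmetrised, so the sum over
    -- ordered pairs gives $l\wedge k-k\wedge l=2\,l\wedge k$. The factor $\tfrac12$ corrects this.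
    simp only [LinearMap.comp_apply, LinearMap.inr_apply, map_mul, Fib.ev_gen₁, Lam.mul_d,
      mul_zero, zero_add, sub_eq_add_neg, add_smul, Finset.sum_add_distrib,
      ← neg_one_mul (_ * _ : ℝ), mul_smul (-1 : ℝ), ← Finset.smul_sum]
    rw [key, key', Fib.gen₁_mul_gen₁ (0, k), smul_smul, neg_one_mul, neg_neg, one_smul,
      ← two_smul ℝ, smul_smul]
    norm_num
  | add x _ y _ hx hy =>
    conv_lhs => rw [hx, hy]
    simp only [map_add, Lam.add_d, add_smul, Finset.sum_add_distrib, smul_add]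

lemma Fib.eq_of_ev_d [FiniteDimensional ℝ V] {x y : Fib 𝔤 V}
    (hx : x ∈ Fib.forms 𝔤 V * Fib.forms 𝔤 V) (hy : y ∈ Fib.forms 𝔤 V * Fib.forms 𝔤 V)
    (h : ∀ u v, (Fib.ev u v x).d = (Fib.ev u v y).d) : x = y := by
  rw [Fib.eq_sum_of_mem_forms hx, Fib.eq_sum_of_mem_forms hy]
  simp only [h]

lemma Fib.gen₁_inr_injective {l m : Dual ℝ V} (h : Fib.gen₁ 𝔤 V (0, l) = Fib.gen₁ 𝔤 V (0, m)) :
    l = m := by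
  ext u
  have := congrArg (fun x => (Fib.ev u 0 x).b) h
  simpa using this

lemma Fib.eq_of_ev_b {x y : Fib 𝔤 V} (hx : x ∈ Fib.forms 𝔤 V) (hy : y ∈ Fib.forms 𝔤 V)
    (h : ∀ u, (Fib.ev u 0 x).b = (Fib.ev u 0 y).b) : x = y := by
  obtain ⟨l, rfl⟩ := hx
  obtain ⟨m, rfl⟩ := hy
  have : l = m := by
    ext u
    simpa using h u
  rw [this]

lemma pow_zero_mul_pow {A : Type*} [Semiring A] [Algebra ℝ A] (M N : Submodule ℝ A) (n : ℕ) :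
    M ^ 0 * N ^ n = N ^ n := by
  rw [pow_zero, one_mul]

/-- $2p+q=0$ forces $p=q=0$, so only scalars have degree zero, and the augmentation recovers a
scalar. -/
lemma Fib.mem_deg_zero {x : Fib 𝔤 V} (hx : x ∈ Fib.deg 𝔤 V 0) :
    x = algebraMap ℝ _ (Fib.aug 𝔤 V x) := by
  have h : Fib.deg 𝔤 V 0 ≤ 1 := by
    refine iSup_le fun p => iSup_le fun q => iSup_le fun hpq => ?_
    obtain rfl : p = 0 := by omega
    obtain rfl : q = 0 := by omega
    exact ((pow_zero_mul_pow _ _ 0).trans (pow_zero _)).le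
  obtain ⟨r, rfl⟩ := Submodule.mem_one.1 (h hx)
  rw [AlgHom.commutes]
  rfl

lemma Fib.gen₁_unit (l : Dual ℝ Unit × Dual ℝ V) : Fib.gen₁ Unit V l = Fib.gen₁ Unit V (0, l.2) := by
  congr 1
  exact Prod.ext (Subsingleton.elim _ _) rfl

lemma Fib.range_gen₁_unit : LinearMap.range (Fib.gen₁ Unit V) = Fib.forms Unit V := by
  apply le_antisymm
  · rintro _ ⟨l, rfl⟩
    exact ⟨l.2, (Fib.gen₁_unit l).symm⟩
  · rintro _ ⟨l, rfl⟩
    exact ⟨(0, l), rfl⟩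

lemma Fib.range_gen₂_unit : LinearMap.range (Fib.gen₂ Unit V) = ⊥ := by
  rw [LinearMap.range_eq_bot]
  ext x
  rw [Subsingleton.elim x 0, map_zero, map_zero]

/-- For the zero Lie algebra there are no generators of degree two, and those of degree one are the
linear forms. Hence preservation of degree by a morphism from $T[1]M$ says that images are honest
$n$-forms. -/
lemma Fib.deg_unit (n : ℕ) : Fib.deg Unit V n = Fib.forms Unit V ^ n := by
  apply le_antisymm
  · refine iSup_le fun p => iSup_le fun q => iSup_le fun hpq => ?_
    rw [Fib.range_gen₁_unit, Fib.range_gen₂_unit]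
    rcases Nat.eq_zero_or_pos p with rfl | hp
    · obtain rfl : q = n := by omega
      exact (pow_zero_mul_pow _ _ _).le
    · rw [Submodule.bot_pow hp.ne', Submodule.bot_mul]
      exact bot_le
  · refine le_trans (le_of_eq ?_) (le_iSup_of_le 0 (le_iSup_of_le n (le_iSup_of_le (by simp) le_rfl)))
    rw [Fib.range_gen₁_unit]
    exact (pow_zero_mul_pow _ _ _).symm

end Fibre

/-! ### Cartan's formulas for the differential -/

section Uniqueness

set_option linter.unusedSectionVars false

open Filter Topology

variable {E H : Type*} [NormedAddCommGroup E] [NormedSpace ℝ E] [TopologicalSpace H]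
  {I : ModelWithCorners ℝ E H} {𝔤 : Type*} [AddCommGroup 𝔤] [Module ℝ 𝔤]
  {M : Type*} [TopologicalSpace M] [ChartedSpace H M] [IsManifold I ∞ M]
  {F : Type*} [NormedAddCommGroup F] [NormedSpace ℝ F]

/-- The components of a family, along a map `ψ` from a vector space, in the directions `u` and `v`. -/
def evAlong (I : ModelWithCorners ℝ E H) (ψ : F → M) (u v : F) (z : F)
    (x : Fib 𝔤 (TangentSpace I (ψ z))) : Lam :=
  Fib.ev (mfderiv 𝓘(ℝ, F) I ψ z u) (mfderiv 𝓘(ℝ, F) I ψ z v) x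

/-- `W` describes the components of degree at most one of the family `w` near `z₀`. -/
def IsComponents {V : Opens M} (ψ : F → M) (u v : F) (z₀ : F) (w : Raw I 𝔤 V)
    (a b c : F → ℝ) : Prop :=
  ∀ᶠ z in 𝓝 z₀, ∀ hz : ψ z ∈ V, (evAlong I ψ u v z (w ⟨ψ z, hz⟩)).a = a z ∧
    (evAlong I ψ u v z (w ⟨ψ z, hz⟩)).b = b z ∧ (evAlong I ψ u v z (w ⟨ψ z, hz⟩)).c = c z

lemma mfderiv_comp_eq_fderiv {ψ : F → M} {f : M → ℝ} {z : F}
    (hf : MDifferentiableAt I 𝓘(ℝ, ℝ) f (ψ z)) (hψ : MDifferentiableAt 𝓘(ℝ, F) I ψ z) (u : F) :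
    mfderiv I 𝓘(ℝ, ℝ) f (ψ z) (mfderiv 𝓘(ℝ, F) I ψ z u) = fderiv ℝ (fun z => f (ψ z)) z u := by
  have h := mfderiv_comp z hf hψ
  rw [← mfderiv_eq_fderiv]
  exact (DFunLike.congr_fun h u).symm

/-- The formulas of Cartan for the differential of a family, in degrees one and two. -/
lemma HasD.components [Bracket 𝔤 𝔤] [FiniteDimensional ℝ 𝔤] {V : Opens M} {w η : Raw I 𝔤 V}
    (h : HasD V w η) {ψ : F → M} {z₀ : F} (hψ : ContMDiffAt 𝓘(ℝ, F) I ∞ ψ z₀) (u v : F)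
    (hz₀ : ψ z₀ ∈ V) : ∃ a b c : F → ℝ, DifferentiableAt ℝ a z₀ ∧ DifferentiableAt ℝ b z₀ ∧
      DifferentiableAt ℝ c z₀ ∧ IsComponents ψ u v z₀ w a b c ∧
      (evAlong I ψ u v z₀ (η ⟨ψ z₀, hz₀⟩)).a = 0 ∧
      (evAlong I ψ u v z₀ (η ⟨ψ z₀, hz₀⟩)).b = fderiv ℝ a z₀ u ∧
      (evAlong I ψ u v z₀ (η ⟨ψ z₀, hz₀⟩)).c = fderiv ℝ a z₀ v ∧
      (evAlong I ψ u v z₀ (η ⟨ψ z₀, hz₀⟩)).d = fderiv ℝ c z₀ u - fderiv ℝ b z₀ v := by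
  have hψ' : ∀ᶠ z in 𝓝 z₀, MDifferentiableAt 𝓘(ℝ, F) I ψ z := by
    have h₁ : ContMDiffAt 𝓘(ℝ, F) I 1 ψ z₀ := hψ.of_le (by norm_cast)
    filter_upwards [(contMDiffAt_iff_contMDiffAt_nhds (by simp)).1 h₁] with z hz
    exact ContMDiffAt.mdifferentiableAt hz (by simp)
  have hfV : ∀ {f : M → ℝ}, ContMDiffOn I 𝓘(ℝ, ℝ) ∞ f V → ∀ x ∈ V, ContMDiffAt I 𝓘(ℝ, ℝ) ∞ f x :=
    fun hf x hx => hf.contMDiffAt (V.2.mem_nhds hx)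
  have hchain : ∀ {f : M → ℝ}, ContMDiffOn I 𝓘(ℝ, ℝ) ∞ f V → ∀ᶠ z in 𝓝 z₀, ∀ _ : ψ z ∈ V, ∀ u : F,
      mfderiv I 𝓘(ℝ, ℝ) f (ψ z) (mfderiv 𝓘(ℝ, F) I ψ z u) = fderiv ℝ (fun z => f (ψ z)) z u := by
    intro f hf
    filter_upwards [hψ'] with z hz hzV u
    exact mfderiv_comp_eq_fderiv ((hfV hf _ hzV).mdifferentiableAt (by simp)) hz u
  have hsmooth : ∀ {f : M → ℝ}, ContMDiffOn I 𝓘(ℝ, ℝ) ∞ f V →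
      ContDiffAt ℝ ∞ (fun z => f (ψ z)) z₀ :=
    fun hf => ((hfV hf _ hz₀).comp z₀ hψ).contDiffAt
  -- The components are described in a neighbourhood of $z_0$, but their differentiability is
  -- recorded only at $z_0$: the formulas use nothing beyond first derivatives there, and this
  -- passes through sums and products.
  induction h with
  | fn f hf =>
    refine ⟨fun z => f (ψ z), fun _ => 0, fun _ => 0, (hsmooth hf).differentiableAt (by simp),
      differentiableAt_const _, differentiableAt_const _, .of_forall fun z hz => ?_, ?_⟩
    · simp only [evAlong, AlgHom.commutes]
      exact ⟨rfl, rfl, rfl⟩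
    · have := (hchain hf).self_of_nhds hz₀
      simp only [evAlong, Fib.ev_gen₁]
      refine ⟨trivial, this u, this v, by simp⟩
  | dfn f hf =>
    have h₂ : ContDiffAt ℝ 1 (fderiv ℝ (fun z => f (ψ z))) z₀ :=
      (hsmooth hf).fderiv_right (by norm_cast)
    have h₃ := h₂.differentiableAt (by simp)
    refine ⟨fun _ => 0, fun z => fderiv ℝ (fun z => f (ψ z)) z u,
      fun z => fderiv ℝ (fun z => f (ψ z)) z v, differentiableAt_const _,
      h₃.clm_apply (differentiableAt_const _), h₃.clm_apply (differentiableAt_const _), ?_, ?_⟩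
    · filter_upwards [hchain hf] with z hz hzV
      simp only [evAlong, Fib.ev_gen₁]
      exact ⟨trivial, hz hzV u, hz hzV v⟩
    · have e : evAlong I ψ u v z₀ ((0 : Raw I 𝔤 V) ⟨ψ z₀, hz₀⟩) = 0 := map_zero _
      rw [e]
      -- Here $d(df)=0$ is the symmetry of second derivatives.
      have hs : IsSymmSndFDerivAt ℝ (fun z => f (ψ z)) z₀ :=
        (hsmooth hf).isSymmSndFDerivAt (by rw [minSmoothness_of_isRCLikeNormedField]; norm_cast)
      have key : ∀ u v : F, fderiv ℝ (fun z => fderiv ℝ (fun z => f (ψ z)) z v) z₀ u =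
          fderiv ℝ (fderiv ℝ (fun z => f (ψ z))) z₀ u v := by
        intro u v
        rw [fderiv_clm_apply h₃ (differentiableAt_const _)]
        simp
      refine ⟨rfl, by simp, by simp, ?_⟩
      rw [key, key, hs u v, sub_self]
      rfl
  | xi μ =>
    refine ⟨fun _ => 0, fun _ => 0, fun _ => 0, differentiableAt_const _, differentiableAt_const _,
      differentiableAt_const _, .of_forall fun z hz => ?_, ?_⟩
    · simp [evAlong]
    -- Evaluation sets $\xi$ and $\bar\xi$ to zero, which kills every term of the Weil differential.
    · have e : evAlong I ψ u v z₀ (Fib.weil₁ 𝔤 (TangentSpace I (ψ z₀)) μ) = 0 := by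
        have : (⟨0, (0 : Dual ℝ (TangentSpace I (ψ z₀))) (mfderiv 𝓘(ℝ, F) I ψ z₀ u),
          (0 : Dual ℝ (TangentSpace I (ψ z₀))) (mfderiv 𝓘(ℝ, F) I ψ z₀ v), 0⟩ : Lam) = 0 := rfl
        simp only [evAlong, Fib.weil₁, map_sub, map_smul, map_sum, map_mul, Fib.ev_gen₂,
          Fib.ev_gen₁, this]
        simp
      rw [e]
      simp
  | xibar μ =>
    refine ⟨fun _ => 0, fun _ => 0, fun _ => 0, differentiableAt_const _, differentiableAt_const _,
      differentiableAt_const _, .of_forall fun z hz => ?_, ?_⟩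
    · simp [evAlong]
    · have e : evAlong I ψ u v z₀ (Fib.weil₂ 𝔤 (TangentSpace I (ψ z₀)) μ) = 0 := by
        simp [evAlong, Fib.weil₂, map_neg, map_smul, map_sum, map_mul]
      rw [e]
      simp
  | @add w w' η η' _ _ ih ih' =>
    obtain ⟨a, b, c, ha, hb, hc, hw, h₀, h₁, h₂, h₃⟩ := ih
    obtain ⟨a', b', c', ha', hb', hc', hw', h₀', h₁', h₂', h₃'⟩ := ih'
    refine ⟨fun z => a z + a' z, fun z => b z + b' z, fun z => c z + c' z, ha.add ha', hb.add hb',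
      hc.add hc', ?_, ?_⟩
    · filter_upwards [hw, hw'] with z hz hz' hzV
      have e : evAlong I ψ u v z ((w + w') ⟨ψ z, hzV⟩) =
        evAlong I ψ u v z (w ⟨ψ z, hzV⟩) + evAlong I ψ u v z (w' ⟨ψ z, hzV⟩) := map_add _ _ _
      rw [e]
      obtain ⟨e₁, e₂, e₃⟩ := hz hzV
      obtain ⟨e₁', e₂', e₃'⟩ := hz' hzV
      exact ⟨by simp [e₁, e₁'], by simp [e₂, e₂'], by simp [e₃, e₃']⟩
    · have e : evAlong I ψ u v z₀ ((η + η') ⟨ψ z₀, hz₀⟩) =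
        evAlong I ψ u v z₀ (η ⟨ψ z₀, hz₀⟩) + evAlong I ψ u v z₀ (η' ⟨ψ z₀, hz₀⟩) := map_add _ _ _
      rw [e, fderiv_fun_add ha ha', fderiv_fun_add hb hb', fderiv_fun_add hc hc']
      simp only [Lam.add_a, Lam.add_b, Lam.add_c, Lam.add_d, h₀, h₁, h₂, h₃, h₀', h₁', h₂', h₃',
        _root_.add_apply, true_and]
      refine ⟨by simp, by ring⟩
  | @mul w w' η η' _ _ ih ih' =>
    obtain ⟨a, b, c, ha, hb, hc, hw, h₀, h₁, h₂, h₃⟩ := ih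
    obtain ⟨a', b', c', ha', hb', hc', hw', h₀', h₁', h₂', h₃'⟩ := ih'
    obtain ⟨i₀, i₁, i₂⟩ := hw.self_of_nhds hz₀
    obtain ⟨i₀', i₁', i₂'⟩ := hw'.self_of_nhds hz₀
    refine ⟨fun z => a z * a' z, fun z => a z * b' z + b z * a' z, fun z => a z * c' z + c z * a' z,
      ha.mul ha', (ha.mul hb').add (hb.mul ha'), (ha.mul hc').add (hc.mul ha'), ?_, ?_⟩
    · filter_upwards [hw, hw'] with z hz hz' hzV
      have e : evAlong I ψ u v z ((w * w') ⟨ψ z, hzV⟩) =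
        evAlong I ψ u v z (w ⟨ψ z, hzV⟩) * evAlong I ψ u v z (w' ⟨ψ z, hzV⟩) := map_mul _ _ _
      rw [e]
      obtain ⟨e₁, e₂, e₃⟩ := hz hzV
      obtain ⟨e₁', e₂', e₃'⟩ := hz' hzV
      exact ⟨by simp [e₁, e₁'], by simp [e₁, e₁', e₂, e₂'], by simp [e₁, e₁', e₃, e₃']⟩
    · have e : evAlong I ψ u v z₀ ((η * w' + (fun x => Fib.invol 𝔤 _ (w x)) * η') ⟨ψ z₀, hz₀⟩) =
          evAlong I ψ u v z₀ (η ⟨ψ z₀, hz₀⟩) * evAlong I ψ u v z₀ (w' ⟨ψ z₀, hz₀⟩) +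
          ⟨(evAlong I ψ u v z₀ (w ⟨ψ z₀, hz₀⟩)).a, -(evAlong I ψ u v z₀ (w ⟨ψ z₀, hz₀⟩)).b,
            -(evAlong I ψ u v z₀ (w ⟨ψ z₀, hz₀⟩)).c, (evAlong I ψ u v z₀ (w ⟨ψ z₀, hz₀⟩)).d⟩ *
          evAlong I ψ u v z₀ (η' ⟨ψ z₀, hz₀⟩) := by
        refine (map_add _ _ _).trans (congrArg₂ _ (map_mul _ _ _) ((map_mul _ _ _).trans ?_))
        exact congrArg (· * _) (Fib.ev_invol _ _ _)
      rw [e, fderiv_fun_mul ha ha', fderiv_fun_add (ha.fun_mul hb') (hb.fun_mul ha'),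
        fderiv_fun_add (ha.fun_mul hc') (hc.fun_mul ha'), fderiv_fun_mul ha hb', fderiv_fun_mul hb ha',
        fderiv_fun_mul ha hc', fderiv_fun_mul hc ha']
      -- Nothing is known about the $\theta_1\theta_2$-components of the two factors. They occur
      -- only multiplied by the degree-zero components of the differentials, which vanish by `h₀`
      -- and `h₀'`; this is why that vanishing is part of the induction.
      simp only [Lam.add_a, Lam.add_b, Lam.add_c, Lam.add_d, Lam.mul_a, Lam.mul_b, Lam.mul_c,
        Lam.mul_d, h₀, h₁, h₂, h₃, h₀', h₁', h₂', h₃', i₀, i₁, i₂, i₀', i₁', i₂',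
        _root_.add_apply, _root_.smul_apply, smul_eq_mul]
      refine ⟨by ring, by ring, by ring, by ring⟩

/-- The values of the differential on two vectors, for a family whose components are known. -/
lemma HasD.ev_eq [Bracket 𝔤 𝔤] [FiniteDimensional ℝ 𝔤] {V : Opens M} {w η : Raw I 𝔤 V}
    (h : HasD V w η) {ψ : F → M} {z₀ : F} (hψ : ContMDiffAt 𝓘(ℝ, F) I ∞ ψ z₀) (u v : F)
    (hz₀ : ψ z₀ ∈ V) {a b c : F → ℝ} (hw : IsComponents ψ u v z₀ w a b c) :
    (evAlong I ψ u v z₀ (η ⟨ψ z₀, hz₀⟩)).b = fderiv ℝ a z₀ u ∧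
    (evAlong I ψ u v z₀ (η ⟨ψ z₀, hz₀⟩)).d = fderiv ℝ c z₀ u - fderiv ℝ b z₀ v := by
  obtain ⟨a', b', c', ha', hb', hc', hw', -, h₁, -, h₃⟩ := h.components hψ u v hz₀
  have hV : ∀ᶠ z in 𝓝 z₀, ψ z ∈ V := hψ.continuousAt.eventually (V.2.mem_nhds hz₀)
  -- Any two descriptions of the components agree near $z_0$, so they have the same derivatives
  -- there.
  have ea : a' =ᶠ[𝓝 z₀] a := by
    filter_upwards [hw, hw', hV] with z hz hz' hzV
    rw [← (hz hzV).1, ← (hz' hzV).1]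
  have eb : b' =ᶠ[𝓝 z₀] b := by
    filter_upwards [hw, hw', hV] with z hz hz' hzV
    rw [← (hz hzV).2.1, ← (hz' hzV).2.1]
  have ec : c' =ᶠ[𝓝 z₀] c := by
    filter_upwards [hw, hw', hV] with z hz hz' hzV
    rw [← (hz hzV).2.2, ← (hz' hzV).2.2]
  rw [h₁, h₃, ea.fderiv_eq, eb.fderiv_eq, ec.fderiv_eq]
  exact ⟨rfl, rfl⟩

end Uniqueness

/-! ### Uniqueness of the differential, exterior derivatives of one-forms, smoothness -/

section Charts

set_option linter.unusedSectionVars false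

open Filter Topology

variable {E H : Type*} [NormedAddCommGroup E] [NormedSpace ℝ E] [TopologicalSpace H]
  {I : ModelWithCorners ℝ E H} {𝔤 : Type*} [AddCommGroup 𝔤] [Module ℝ 𝔤]
  {M : Type*} [TopologicalSpace M] [ChartedSpace H M] [IsManifold I ∞ M]

lemma contMDiffAt_chart_symm [I.Boundaryless] {x : M} {z : E} (hz : z ∈ (extChartAt I x).target) :
    ContMDiffAt 𝓘(ℝ, E) I ∞ (extChartAt I x).symm z :=
  (contMDiffOn_extChartAt_symm x).contMDiffAt ((isOpen_extChartAt_target x).mem_nhds hz)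

lemma mfderiv_chart_symm_comp [I.Boundaryless] {x y : M} (hy : y ∈ (extChartAt I x).source)
    (v : TangentSpace I y) :
    (mfderiv 𝓘(ℝ, E) I (extChartAt I x).symm (extChartAt I x y)
      (mfderiv I 𝓘(ℝ, E) (extChartAt I x) y v) : E) = v := by
  have h := mfderivWithin_extChartAt_symm_comp_mfderiv_extChartAt' (I := I) (x := x) hy
  rw [I.range_eq_univ, mfderivWithin_univ] at h
  exact DFunLike.congr_fun h v

lemma mfderiv_chart_comp_symm [I.Boundaryless] {x : M} {z : E} (hz : z ∈ (extChartAt I x).target)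
    (v : E) :
    (mfderiv I 𝓘(ℝ, E) (extChartAt I x) ((extChartAt I x).symm z)
      (mfderiv 𝓘(ℝ, E) I (extChartAt I x).symm z v) : E) = v := by
  have h := mfderiv_extChartAt_comp_mfderivWithin_extChartAt_symm (I := I) (x := x) hz
  rw [I.range_eq_univ, mfderivWithin_univ] at h
  exact DFunLike.congr_fun h v

/-- The inverse of a chart serves. Surjectivity of its differential lets tangent vectors at the
point be replaced by constant vectors of the model space, the form in which `HasD.components` takes
them. -/
lemma exists_parametrization [I.Boundaryless] (x : M) : ∃ (ψ : E → M) (z : E), ψ z = x ∧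
    ContMDiffAt 𝓘(ℝ, E) I ∞ ψ z ∧ Function.Surjective (mfderiv 𝓘(ℝ, E) I ψ z) := by
  refine ⟨(extChartAt I x).symm, extChartAt I x x, extChartAt_to_inv x,
    contMDiffAt_chart_symm (mem_extChartAt_target x), fun v => ?_⟩
  have h := mfderiv_chart_symm_comp (I := I) (x := x) (mem_extChartAt_source x) v
  exact ⟨_, h⟩

section Differential

variable [Bracket 𝔤 𝔤] [FiniteDimensional ℝ 𝔤]

/-- By Cartan's formulas the one-form and two-form values of the differential depend only on the
components of the family near the point. Different neighbourhoods $V$, $V'$ are allowed so that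
local constructions can be compared. -/
lemma HasD.ev_unique [I.Boundaryless] {V V' : Opens M} {w η : Raw I 𝔤 V} {w' η' : Raw I 𝔤 V'}
    (h : HasD V w η) (h' : HasD V' w' η') {x : M} (hx : x ∈ V) (hx' : x ∈ V')
    (e : ∀ y (hy : y ∈ V) (hy' : y ∈ V'), w ⟨y, hy⟩ = w' ⟨y, hy'⟩) (u v : TangentSpace I x) :
    (Fib.ev u v (η ⟨x, hx⟩)).b = (Fib.ev u v (η' ⟨x, hx'⟩)).b ∧
    (Fib.ev u v (η ⟨x, hx⟩)).d = (Fib.ev u v (η' ⟨x, hx'⟩)).d := by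
  obtain ⟨ψ, z, rfl, hψ, hs⟩ := exists_parametrization (I := I) x
  obtain ⟨u, rfl⟩ := hs u
  obtain ⟨v, rfl⟩ := hs v
  obtain ⟨a, b, c, ha, hb, hc, hw, -⟩ := h.components hψ u v hx
  have hw' : IsComponents ψ u v z w' a b c := by
    have hV : ∀ᶠ z in 𝓝 z, ψ z ∈ V := hψ.continuousAt.eventually (V.2.mem_nhds hx)
    filter_upwards [hw, hV] with z hz hzV hzV'
    rw [← e _ hzV hzV']
    exact hz hzV
  have h₁ := h.ev_eq hψ u v hx hw
  have h₂ := h'.ev_eq hψ u v hx' hw'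
  exact ⟨h₁.1.trans h₂.1.symm, h₁.2.trans h₂.2.symm⟩

/-- The differential is unique, if it is a two-form. -/
lemma HasD.unique_two [I.Boundaryless] [FiniteDimensional ℝ E] {V V' : Opens M} {w η : Raw I 𝔤 V}
    {w' η' : Raw I 𝔤 V'} (h : HasD V w η) (h' : HasD V' w' η') {x : M} (hx : x ∈ V) (hx' : x ∈ V')
    (e : ∀ y (hy : y ∈ V) (hy' : y ∈ V'), w ⟨y, hy⟩ = w' ⟨y, hy'⟩)
    (hη : η ⟨x, hx⟩ ∈ Fib.forms 𝔤 (TangentSpace I x) * Fib.forms 𝔤 (TangentSpace I x))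
    (hη' : η' ⟨x, hx'⟩ ∈ Fib.forms 𝔤 (TangentSpace I x) * Fib.forms 𝔤 (TangentSpace I x)) :
    η ⟨x, hx⟩ = η' ⟨x, hx'⟩ := by
  have : FiniteDimensional ℝ (TangentSpace I x) := inferInstanceAs (FiniteDimensional ℝ E)
  exact Fib.eq_of_ev_d hη hη' fun u v => (h.ev_unique h' hx hx' e u v).2

/-- The differential is unique, if it is a one-form. -/
lemma HasD.unique_one [I.Boundaryless] {V V' : Opens M} {w η : Raw I 𝔤 V}
    {w' η' : Raw I 𝔤 V'} (h : HasD V w η) (h' : HasD V' w' η') {x : M} (hx : x ∈ V) (hx' : x ∈ V')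
    (e : ∀ y (hy : y ∈ V) (hy' : y ∈ V'), w ⟨y, hy⟩ = w' ⟨y, hy'⟩)
    (hη : η ⟨x, hx⟩ ∈ Fib.forms 𝔤 (TangentSpace I x))
    (hη' : η' ⟨x, hx'⟩ ∈ Fib.forms 𝔤 (TangentSpace I x)) :
    η ⟨x, hx⟩ = η' ⟨x, hx'⟩ :=
  Fib.eq_of_ev_b hη hη' fun u => (h.ev_unique h' hx hx' e u 0).1

lemma HasD.congr {V : Opens M} {w η w' η' : Raw I 𝔤 V} (h : HasD V w η) (hw : w' = w)
    (hη : η' = η) : HasD V w' η' := by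
  rwa [hw, hη]

lemma HasD.const (V : Opens M) (r : ℝ) : HasD (I := I) (𝔤 := 𝔤) V (fun _ => algebraMap ℝ _ r) 0 := by
  convert HasD.fn (I := I) (𝔤 := 𝔤) (V := V) (fun _ => r) contMDiffOn_const using 1
  funext x
  rw [mfderiv_const]
  exact (map_zero (Fib.gen₁ 𝔤 (TangentSpace I x.1))).symm

lemma HasD.zero (V : Opens M) : HasD (I := I) (𝔤 := 𝔤) V 0 0 := by
  convert HasD.const (I := I) (𝔤 := 𝔤) V 0 using 1
  funext x
  exact (map_zero _).symm

lemma HasD.fn_mul {V : Opens M} {w η : Raw I 𝔤 V} (h : HasD V w η) {f : M → ℝ}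
    (hf : ContMDiffOn I 𝓘(ℝ, ℝ) ∞ f V) :
    HasD V (fun x => f x • w x)
      (fun x => Fib.gen₁ 𝔤 _ (0, (mfderiv I 𝓘(ℝ, ℝ) f x.1).toLinearMap) * w x + f x • η x) := by
  convert (HasD.fn f hf).mul h using 1
  · funext x
    exact Algebra.smul_def (A := Fib 𝔤 (TangentSpace I x.1)) (f x) (w x)
  · funext x
    refine congrArg (Fib.gen₁ 𝔤 _ (0, (mfderiv I 𝓘(ℝ, ℝ) f x.1).toLinearMap) * w x + ·) ?_
    refine (Algebra.smul_def (A := Fib 𝔤 (TangentSpace I x.1)) (f x) (η x)).trans ?_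
    exact congrArg (· * η x) (AlgHom.commutes (Fib.invol 𝔤 (TangentSpace I x.1)) (f x)).symm

lemma HasD.smul {V : Opens M} {w η : Raw I 𝔤 V} (h : HasD V w η) (r : ℝ) :
    HasD V (r • w) (r • η) := by
  convert (HasD.const V r).mul h using 1
  · funext x
    exact Algebra.smul_def (A := Fib 𝔤 (TangentSpace I x.1)) r (w x)
  · rw [zero_mul, zero_add]
    funext x
    refine (Algebra.smul_def (A := Fib 𝔤 (TangentSpace I x.1)) r (η x)).trans ?_
    exact congrArg (· * η x) (AlgHom.commutes (Fib.invol 𝔤 (TangentSpace I x.1)) r).symm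

lemma HasD.sum {V : Opens M} {ι : Type*} (s : Finset ι) {w η : ι → Raw I 𝔤 V}
    (h : ∀ i, HasD V (w i) (η i)) : HasD V (∑ i ∈ s, w i) (∑ i ∈ s, η i) := by
  classical
  induction s using Finset.induction_on with
  | empty => simpa using HasD.zero V
  | insert a s ha ih =>
    rw [Finset.sum_insert ha, Finset.sum_insert ha]
    exact (h a).add ih

lemma HasD.res {U V : Opens M} (hV : V ≤ U) {w η : Raw I 𝔤 U} (h : HasD U w η) :
    HasD V (Raw.res hV w) (Raw.res hV η) := by
  induction h with
  | fn f hf => exact .fn f (hf.mono hV)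
  | dfn f hf => exact .dfn f (hf.mono hV)
  | xi μ => exact .xi μ
  | xibar μ => exact .xibar μ
  | add _ _ h h' => exact h.add h'
  | mul _ _ h h' => exact h.mul h'

end Differential

/-- Near every point, a smooth form is a combination of differentials of functions. -/
lemma SmoothForm.exists_sum [I.Boundaryless] [FiniteDimensional ℝ E]
    {θ : ∀ x : M, Dual ℝ (TangentSpace I x)} {V : Opens M} (hθ : SmoothForm I θ V) {x : M}
    (hx : x ∈ V) : ∃ (V' : Opens M) (_ : V' ≤ V) (_ : x ∈ V')
      (f g : Fin (finrank ℝ E) → M → ℝ), (∀ i, ContMDiffOn I 𝓘(ℝ, ℝ) ∞ (f i) V') ∧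
      (∀ i, ContMDiffOn I 𝓘(ℝ, ℝ) ∞ (g i) V') ∧
      ∀ y ∈ V', θ y = ∑ i, f i y • (mfderiv I 𝓘(ℝ, ℝ) (g i) y).toLinearMap := by
  let φ := extChartAt I x
  let V' : Opens M := V ⊓ ⟨φ.source, isOpen_extChartAt_source x⟩
  let B := finBasis ℝ E
  have hφ : ContMDiffOn I 𝓘(ℝ, E) ∞ φ V' := contMDiffOn_extChartAt.mono (by
    intro y hy
    have h₂ : y ∈ (extChartAt I x).source := hy.2
    rwa [extChartAt_source] at h₂)
  have hB : ∀ i, ContMDiff 𝓘(ℝ, E) 𝓘(ℝ, ℝ) ∞ (B.coord i) := fun i =>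
    (LinearMap.toContinuousLinearMap (B.coord i)).contMDiff
  refine ⟨V', inf_le_left, ⟨hx, mem_extChartAt_source x⟩,
    -- The usual expansion $\theta=\sum_i\theta(\partial_i)\,dx^i$: the coefficients are the values
    -- on the coordinate vector fields, and the functions $g_i$ are the coordinates of the chart.
    fun i y => θ y (((mfderiv 𝓘(ℝ, E) I φ.symm (φ y) (B i) : E)) : TangentSpace I y),
    fun i y => B.coord i (φ y), fun i => ?_, fun i => (hB i).comp_contMDiffOn hφ, ?_⟩
  · have h₁ : ContMDiffOn I I.tangent ∞ (fun y => (⟨φ.symm (φ y),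
        mfderiv 𝓘(ℝ, E) I φ.symm (φ y) (B i)⟩ : TangentBundle I M)) V' := by
      have h₂ : ContMDiffOn 𝓘(ℝ, E).tangent I.tangent ∞
          (tangentMapWithin 𝓘(ℝ, E) I φ.symm φ.target) (Bundle.TotalSpace.proj ⁻¹' φ.target) :=
        (contMDiffOn_extChartAt_symm x).contMDiffOn_tangentMapWithin (n := ∞) (m := ∞) le_rfl
          (isOpen_extChartAt_target x).uniqueMDiffOn
      have h₃ : ContMDiff 𝓘(ℝ, E) 𝓘(ℝ, E).tangent ∞
          (fun z : E => (⟨z, B i⟩ : TangentBundle 𝓘(ℝ, E) E)) :=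
        contMDiff_vectorSpace_iff_contDiff.2 contDiff_const
      have h₄ := h₂.comp (h₃.comp_contMDiffOn hφ) (fun y hy => φ.map_source hy.2)
      refine h₄.congr fun y hy => ?_
      simp only [Function.comp, tangentMapWithin]
      rw [mfderivWithin_of_isOpen (isOpen_extChartAt_target x) (φ.map_source hy.2)]
    have h₅ := hθ.comp h₁ (fun y hy => by
      show φ.symm (φ y) ∈ V
      rw [φ.left_inv hy.2]
      exact hy.1)
    refine h₅.congr fun y hy => ?_
    -- The point `φ.symm (φ y)` equals `y` only propositionally. All tangent spaces are the model
    -- space, so the vector can be held fixed while the base point is replaced.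
    have e : ∀ (y' : M) (w : E), y' = y → θ y w = θ y' w := by rintro _ w rfl; rfl
    exact e _ _ (φ.left_inv hy.2)
  · intro y hy
    ext v
    have h₁ : ∀ i, mfderiv I 𝓘(ℝ, ℝ) (fun y => B.coord i (φ y)) y v =
        B.coord i (mfderiv I 𝓘(ℝ, E) φ y v) := by
      intro i
      have h₂ : MDifferentiableAt I 𝓘(ℝ, E) φ y :=
        (hφ.contMDiffAt (V'.2.mem_nhds hy)).mdifferentiableAt (by simp)
      have h₃ := mfderiv_comp y ((hB i).mdifferentiableAt (by simp)) h₂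
      refine (DFunLike.congr_fun h₃ v).trans ?_
      have h₄ : mfderiv 𝓘(ℝ, E) 𝓘(ℝ, ℝ) (B.coord i) (φ y) =
          LinearMap.toContinuousLinearMap (B.coord i) := by
        rw [mfderiv_eq_fderiv]
        exact (LinearMap.toContinuousLinearMap (B.coord i)).fderiv
      exact DFunLike.congr_fun h₄ _
    have h₅ := mfderiv_chart_symm_comp (I := I) (x := x) hy.2 v
    have h₆ := B.sum_repr (mfderiv I 𝓘(ℝ, E) φ y v : E)
    conv_lhs => rw [show v = (mfderiv 𝓘(ℝ, E) I φ.symm (φ y)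
      (mfderiv I 𝓘(ℝ, E) φ y v) : E) from h₅.symm, ← h₆]
    refine Eq.trans ?_ (LinearMap.sum_apply _ _ _).symm
    refine Eq.trans (b := ∑ i, B.repr (mfderiv I 𝓘(ℝ, E) φ y v : E) i •
      θ y (mfderiv 𝓘(ℝ, E) I φ.symm (φ y) (B i) : E)) ?_ ?_
    · have h₇ : ∀ (c : Fin (finrank ℝ E) → ℝ), (mfderiv 𝓘(ℝ, E) I φ.symm (φ y)
        (∑ i, c i • B i : E) : E) = ∑ i, c i • (mfderiv 𝓘(ℝ, E) I φ.symm (φ y) (B i) : E) := by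
        intro c
        have := map_sum (mfderiv 𝓘(ℝ, E) I φ.symm (φ y)) (fun i => c i • B i) Finset.univ
        refine this.trans (Finset.sum_congr rfl fun i _ => ?_)
        exact map_smul (mfderiv 𝓘(ℝ, E) I φ.symm (φ y)) (c i) (B i)
      refine (congrArg (θ y) (h₇ _)).trans ?_
      refine (map_sum (θ y) _ _).trans (Finset.sum_congr rfl fun i _ => ?_)
      exact map_smul (θ y) _ _
    · refine Finset.sum_congr rfl fun i _ => ?_
      refine (mul_comm _ _).trans ?_
      exact congrArg (θ y (mfderiv 𝓘(ℝ, E) I φ.symm (φ y) (B i) : E) * ·) (h₁ i).symm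

lemma smoothForm_mfderiv {V : Opens M} {f : M → ℝ} (hf : ContMDiffOn I 𝓘(ℝ, ℝ) ∞ f V) :
    SmoothForm I (fun x => (mfderiv I 𝓘(ℝ, ℝ) f x).toLinearMap) V := by
  have h := (contMDiff_snd_tangentBundle_modelSpace ℝ 𝓘(ℝ, ℝ)).comp_contMDiffOn
    (hf.contMDiffOn_tangentMapWithin (n := ∞) (m := ∞) le_rfl V.2.uniqueMDiffOn)
  refine h.congr fun p hp => ?_
  exact (DFunLike.congr_fun (mfderivWithin_of_isOpen V.2 hp) p.2).symm

section ExteriorDerivative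

variable [Bracket 𝔤 𝔤] [FiniteDimensional ℝ 𝔤]

variable (𝔤) in
/-- Near every point, a smooth form has a differential, which is closed. -/
lemma SmoothForm.exists_hasD [I.Boundaryless] [FiniteDimensional ℝ E]
    {θ : ∀ x : M, Dual ℝ (TangentSpace I x)} {V : Opens M} (hθ : SmoothForm I θ V) {x : M}
    (hx : x ∈ V) : ∃ (V' : Opens M) (_ : V' ≤ V) (_ : x ∈ V') (η : Raw I 𝔤 V'),
      HasD V' (fun y => Fib.gen₁ 𝔤 _ (0, θ y)) η ∧ HasD V' η 0 ∧ η ∈ Fun I 𝔤 V' ∧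
      ∀ y, η y ∈ Fib.forms 𝔤 (TangentSpace I y.1) * Fib.forms 𝔤 (TangentSpace I y.1) := by
  obtain ⟨V', hV', hx', f, g, hf, hg, e⟩ := hθ.exists_sum hx
  -- For $\theta=\sum f_i\,dg_i$ the differential is $\sum df_i\wedge dg_i$. It is closed because
  -- each factor is exact.
  refine ⟨V', hV', hx', ∑ i, fun y => Fib.gen₁ 𝔤 _ (0, (mfderiv I 𝓘(ℝ, ℝ) (f i) y.1).toLinearMap) *
    Fib.gen₁ 𝔤 _ (0, (mfderiv I 𝓘(ℝ, ℝ) (g i) y.1).toLinearMap), ?_, ?_, ?_, fun y => ?_⟩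
  · convert HasD.sum Finset.univ fun i => (HasD.dfn (𝔤 := 𝔤) (g i) (hg i)).fn_mul (hf i) using 1
    · funext y
      rw [e y y.2, Finset.sum_apply]
      have := map_sum (Fib.gen₁ 𝔤 (TangentSpace I y.1) ∘ₗ LinearMap.inr ℝ _ _)
        (fun i => f i y • (mfderiv I 𝓘(ℝ, ℝ) (g i) y).toLinearMap) Finset.univ
      refine this.trans (Finset.sum_congr rfl fun i _ => ?_)
      exact map_smul (Fib.gen₁ 𝔤 (TangentSpace I y.1) ∘ₗ LinearMap.inr ℝ _ _) (f i y)
        (mfderiv I 𝓘(ℝ, ℝ) (g i) y).toLinearMap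
    · refine Finset.sum_congr rfl fun i _ => funext fun y => ?_
      rw [Pi.zero_apply, smul_zero, add_zero]
  · refine (HasD.sum Finset.univ fun i =>
      (HasD.dfn (𝔤 := 𝔤) (f i) (hf i)).mul (HasD.dfn (g i) (hg i))).congr rfl ?_
    simp only [zero_mul, mul_zero, add_zero, Finset.sum_const_zero]
  · exact sum_mem fun i _ => mul_mem (IsGen.form _ (smoothForm_mfderiv (hf i))).mem
      (IsGen.form _ (smoothForm_mfderiv (hg i))).mem
  · rw [Finset.sum_apply]
    exact Submodule.sum_mem _ fun i _ => Fib.mul_mem_forms _ _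

variable (𝔤) in
/-- The exterior derivative of a one-form, at a point. -/
def extDer (θ : ∀ x : M, Dual ℝ (TangentSpace I x)) (x : M) : Fib 𝔤 (TangentSpace I x) :=
  Classical.epsilon fun ζ => ∃ (V : Opens M) (hx : x ∈ V) (η : Raw I 𝔤 V),
    HasD V (fun y => Fib.gen₁ 𝔤 _ (0, θ y)) η ∧ η ⟨x, hx⟩ = ζ ∧
      ζ ∈ Fib.forms 𝔤 (TangentSpace I x) * Fib.forms 𝔤 (TangentSpace I x)

/-- Two candidates agree at the point by `HasD.unique_two`. Being a two-form there is part of the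
characterisation, since the evaluations see only the parts of low degree in the tangent directions.
-/
lemma extDer_eq [I.Boundaryless] [FiniteDimensional ℝ E] {θ : ∀ x : M, Dual ℝ (TangentSpace I x)}
    {V : Opens M} {η : Raw I 𝔤 V} (h : HasD V (fun y => Fib.gen₁ 𝔤 _ (0, θ y)) η) {x : M}
    (hx : x ∈ V) (hη : η ⟨x, hx⟩ ∈ Fib.forms 𝔤 (TangentSpace I x) * Fib.forms 𝔤 (TangentSpace I x)) :
    extDer 𝔤 θ x = η ⟨x, hx⟩ := by
  obtain ⟨V', hx', η', h', e, hm⟩ := Classical.epsilon_spec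
    (p := fun ζ => ∃ (V : Opens M) (hx : x ∈ V) (η : Raw I 𝔤 V),
    HasD V (fun y => Fib.gen₁ 𝔤 _ (0, θ y)) η ∧ η ⟨x, hx⟩ = ζ ∧
      ζ ∈ Fib.forms 𝔤 (TangentSpace I x) * Fib.forms 𝔤 (TangentSpace I x))
    ⟨_, V, hx, η, h, rfl, hη⟩
  refine e.symm.trans (HasD.unique_two h' h hx' hx (fun _ _ _ => rfl) ?_ hη)
  rw [e]
  exact hm

/-- Although `extDer` is chosen point by point, uniqueness makes it coincide with the local
differential of `SmoothForm.exists_hasD` on a whole neighbourhood, from which it inherits smoothness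
and closedness. -/
lemma SmoothForm.exists_hasD_extDer [I.Boundaryless] [FiniteDimensional ℝ E]
    {θ : ∀ x : M, Dual ℝ (TangentSpace I x)} {V : Opens M} (hθ : SmoothForm I θ V) {x : M}
    (hx : x ∈ V) : ∃ (V' : Opens M) (_ : V' ≤ V) (_ : x ∈ V'),
      HasD V' (fun y => Fib.gen₁ 𝔤 _ (0, θ y)) (fun y => extDer 𝔤 θ y) ∧
      HasD V' (fun y => extDer 𝔤 θ y) 0 ∧ (fun y => extDer 𝔤 θ y : Raw I 𝔤 V') ∈ Fun I 𝔤 V' ∧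
      ∀ y ∈ V', extDer 𝔤 θ y ∈ Fib.forms 𝔤 (TangentSpace I y) * Fib.forms 𝔤 (TangentSpace I y) := by
  obtain ⟨V', hV', hx', η, h, h', hm, hη⟩ := hθ.exists_hasD 𝔤 hx
  have e : (fun y => extDer 𝔤 θ y : Raw I 𝔤 V') = η := funext fun y => extDer_eq h y.2 (hη y)
  refine ⟨V', hV', hx', ?_, ?_, ?_, fun y hy => ?_⟩
  · rwa [e]
  · rwa [e]
  · rwa [e]
  · rw [extDer_eq h hy (hη ⟨y, hy⟩)]
    exact hη ⟨y, hy⟩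

lemma extDer_add [I.Boundaryless] [FiniteDimensional ℝ E] {θ ζ : ∀ x : M, Dual ℝ (TangentSpace I x)}
    (hθ : SmoothForm I θ (⊤ : Opens M)) (hζ : SmoothForm I ζ (⊤ : Opens M)) (x : M) :
    extDer 𝔤 (fun y => θ y + ζ y) x = extDer 𝔤 θ x + extDer 𝔤 ζ x := by
  obtain ⟨V, -, hx, h, -, -, hη⟩ := hθ.exists_hasD_extDer (𝔤 := 𝔤) (x := x) trivial
  obtain ⟨V', -, hx', h', -, -, hη'⟩ := hζ.exists_hasD_extDer (𝔤 := 𝔤) (x := x) trivial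
  have key := (h.res (V := V ⊓ V') inf_le_left).add (h'.res (V := V ⊓ V') inf_le_right)
  refine extDer_eq (V := V ⊓ V') (η := fun y => extDer 𝔤 θ y + extDer 𝔤 ζ y) ?_ ⟨hx, hx'⟩
    (add_mem (hη x hx) (hη' x hx'))
  refine key.congr (funext fun y => ?_) rfl
  exact map_add (Fib.gen₁ 𝔤 (TangentSpace I y.1) ∘ₗ LinearMap.inr ℝ _ _) (θ y) (ζ y)

lemma extDer_smul [I.Boundaryless] [FiniteDimensional ℝ E] {θ : ∀ x : M, Dual ℝ (TangentSpace I x)}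
    (hθ : SmoothForm I θ (⊤ : Opens M)) (r : ℝ) (x : M) :
    extDer 𝔤 (fun y => r • θ y) x = r • extDer 𝔤 θ x := by
  obtain ⟨V, -, hx, h, -, -, hη⟩ := hθ.exists_hasD_extDer (𝔤 := 𝔤) (x := x) trivial
  refine extDer_eq (η := fun y => r • extDer 𝔤 θ y) ?_ hx (Submodule.smul_mem _ r (hη x hx))
  refine (h.smul r).congr (funext fun y => ?_) rfl
  exact map_smul (Fib.gen₁ 𝔤 (TangentSpace I y.1) ∘ₗ LinearMap.inr ℝ _ _) r (θ y)

end ExteriorDerivative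

section Smooth

/-- The components of degree zero and one of a polynomial in generators are smooth. -/
lemma exists_components {V : Opens M} {w : Raw I 𝔤 V}
    (hw : w ∈ Algebra.adjoin ℝ {w : Raw I 𝔤 V | IsGen V w}) :
    ∃ (f : M → ℝ) (θ : ∀ x : M, Dual ℝ (TangentSpace I x)), ContMDiffOn I 𝓘(ℝ, ℝ) ∞ f V ∧
      SmoothForm I θ V ∧ ∀ (x : V) (u : TangentSpace I x.1),
        (Fib.ev u 0 (w x)).a = f x ∧ (Fib.ev u 0 (w x)).b = θ x u := by
  have h0 : SmoothForm I (fun x : M => (0 : Dual ℝ (TangentSpace I x))) V := contMDiffOn_const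
  induction hw using Algebra.adjoin_induction with
  | mem w hw =>
    cases hw with
    | fn f hf =>
      refine ⟨f, fun _ => 0, hf, h0, fun x u => ?_⟩
      rw [AlgHom.commutes]
      exact ⟨rfl, rfl⟩
    | form θ hθ =>
      refine ⟨fun _ => 0, θ, contMDiffOn_const, hθ, fun x u => ?_⟩
      rw [Fib.ev_gen₁]
      exact ⟨rfl, rfl⟩
    | xi μ =>
      refine ⟨fun _ => 0, fun _ => 0, contMDiffOn_const, h0, fun x u => ?_⟩
      rw [Fib.ev_gen₁]
      exact ⟨rfl, rfl⟩
    | xibar μ =>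
      refine ⟨fun _ => 0, fun _ => 0, contMDiffOn_const, h0, fun x u => ?_⟩
      rw [Fib.ev_gen₂]
      exact ⟨rfl, rfl⟩
  | algebraMap r =>
    refine ⟨fun _ => r, fun _ => 0, contMDiffOn_const, h0, fun x u => ?_⟩
    have e : Fib.ev u 0 ((algebraMap ℝ (Raw I 𝔤 V) r) x) = algebraMap ℝ Lam r :=
      AlgHom.commutes _ r
    rw [e]
    exact ⟨rfl, rfl⟩
  | add w w' _ _ h h' =>
    obtain ⟨f, θ, hf, hθ, e⟩ := h
    obtain ⟨f', θ', hf', hθ', e'⟩ := h'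
    refine ⟨fun x => f x + f' x, fun x => θ x + θ' x, hf.add hf', ContMDiffOn.add hθ hθ',
      fun x u => ?_⟩
    have i : Fib.ev u 0 ((w + w') x) = Fib.ev u 0 (w x) + Fib.ev u 0 (w' x) := map_add _ _ _
    rw [i, Lam.add_a, Lam.add_b, (e x u).1, (e x u).2, (e' x u).1, (e' x u).2]
    exact ⟨rfl, rfl⟩
  | mul w w' _ _ h h' =>
    obtain ⟨f, θ, hf, hθ, e⟩ := h
    obtain ⟨f', θ', hf', hθ', e'⟩ := h'
    have hp : ContMDiffOn I.tangent I ∞ (fun p : TangentBundle I M => p.1)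
        (Bundle.TotalSpace.proj ⁻¹' V) :=
      (Bundle.contMDiff_proj (TangentSpace I (M := M))).contMDiffOn
    -- The linear part of a product is $f\theta'+f'\theta$: the other terms have no component in
    -- this degree.
    refine ⟨fun x => f x * f' x, fun x => f x • θ' x + f' x • θ x, hf.mul hf', ?_, fun x u => ?_⟩
    · exact ContMDiffOn.add (ContMDiffOn.mul (hf.comp hp fun _ hx => hx) hθ')
        (ContMDiffOn.mul (hf'.comp hp fun _ hx => hx) hθ)
    · have i : Fib.ev u 0 ((w * w') x) = Fib.ev u 0 (w x) * Fib.ev u 0 (w' x) := map_mul _ _ _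
      rw [i, Lam.mul_a, Lam.mul_b, (e x u).1, (e x u).2, (e' x u).1, (e' x u).2]
      exact ⟨rfl, congrArg (f x * θ' x u + ·) (mul_comm _ _)⟩

/-- Near each point the function is a polynomial in generators, whose part of degree zero is smooth.
This is how smoothness is recovered from membership in the algebra of functions. -/
lemma Fun.contMDiffOn_value {U : Opens M} (w : Fun I 𝔤 U) {f : M → ℝ}
    (hf : ∀ x : U, Fun.value w x = f x) : ContMDiffOn I 𝓘(ℝ, ℝ) ∞ f U := by
  intro x hx
  obtain ⟨V, hV, hxV, h⟩ := w.2 x hx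
  obtain ⟨g, _, hg, _, e⟩ := exists_components h
  have h₁ : ContMDiffAt I 𝓘(ℝ, ℝ) ∞ f x := by
    refine (hg.contMDiffAt (V.2.mem_nhds hxV)).congr_of_eventuallyEq ?_
    filter_upwards [V.2.mem_nhds hxV] with y hy
    have := (e ⟨y, hy⟩ 0).1
    rw [Fib.ev_a] at this
    exact (hf ⟨y, hV hy⟩).symm.trans this
  exact h₁.contMDiffWithinAt

/-- The form is read off by evaluation on one vector, and `exists_components` makes the result
smooth on the tangent bundle. -/
lemma Fun.smoothForm {U : Opens M} (w : Fun I 𝔤 U) {θ : ∀ x : M, Dual ℝ (TangentSpace I x)}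
    (hθ : ∀ x : U, w.1 x = Fib.gen₁ 𝔤 _ (0, θ x)) : SmoothForm I θ U := by
  intro p hp
  obtain ⟨V, hV, hxV, h⟩ := w.2 p.1 hp
  obtain ⟨_, ζ, _, hζ, e⟩ := exists_components h
  have hpV : (Bundle.TotalSpace.proj ⁻¹' (V : Set M) : Set (TangentBundle I M)) ∈ 𝓝 p :=
    (V.2.preimage (Bundle.contMDiff_proj (TangentSpace I (M := M)) (n := ∞)
      (IB := I)).continuous).mem_nhds hxV
  have h₁ : ContMDiffAt I.tangent 𝓘(ℝ, ℝ) ∞ (fun p : TangentBundle I M => θ p.1 p.2) p := by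
    refine (ContMDiffOn.contMDiffAt hζ hpV).congr_of_eventuallyEq ?_
    filter_upwards [hpV] with q hq
    have := (e ⟨q.1, hq⟩ q.2).2
    rw [show Raw.res hV w.1 ⟨q.1, hq⟩ = Fib.gen₁ 𝔤 _ (0, θ q.1) from hθ ⟨q.1, hV hq⟩,
      Fib.ev_gen₁] at this
    exact this
  exact h₁.contMDiffWithinAt

end Smooth

end Charts

/-! ### Fibrewise morphisms: smoothness and the dg condition on generators -/

section Pullback

set_option linter.unusedSectionVars false

variable {E H : Type*} [NormedAddCommGroup E] [NormedSpace ℝ E] [TopologicalSpace H]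
  {I : ModelWithCorners ℝ E H} {𝔤 : Type*} [AddCommGroup 𝔤] [Module ℝ 𝔤]
  {M : Type*} [TopologicalSpace M] [ChartedSpace H M] [IsManifold I ∞ M]
  {F K : Type*} [NormedAddCommGroup F] [NormedSpace ℝ F] [TopologicalSpace K]
  {J : ModelWithCorners ℝ F K} {𝔥 : Type*} [AddCommGroup 𝔥] [Module ℝ 𝔥]
  {N : Type*} [TopologicalSpace N] [ChartedSpace K N] [IsManifold J ∞ N]

/-- Fibrewise morphisms which are given by the pull-back on one-forms. -/
def IsPullback (h : M → N)
    (k : ∀ x : M, Fib 𝔥 (TangentSpace J (h x)) →ₐ[ℝ] Fib 𝔤 (TangentSpace I x)) : Prop :=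
  ∀ (x : M) (l : Dual ℝ (TangentSpace J (h x))), k x (Fib.gen₁ 𝔥 _ (0, l)) =
    Fib.gen₁ 𝔤 _ (0, l ∘ₗ (mfderiv I J h x).toLinearMap)

/-- A fibrewise morphism is smooth if the images of the generators are. -/
lemma IsPullback.mem {h : M → N} (hh : ContMDiff I J ∞ h)
    {k : ∀ x : M, Fib 𝔥 (TangentSpace J (h x)) →ₐ[ℝ] Fib 𝔤 (TangentSpace I x)}
    (hk : IsPullback h k)
    (hxi : ∀ μ, (fun x => k x.1 (Fib.gen₁ 𝔥 _ (μ, 0)) : Raw I 𝔤 ⊤) ∈ Fun I 𝔤 ⊤)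
    (hxibar : ∀ μ, (fun x => k x.1 (Fib.gen₂ 𝔥 _ μ) : Raw I 𝔤 ⊤) ∈ Fun I 𝔤 ⊤)
    (U : Opens N) (V : Opens M) (hV : ∀ x ∈ V, h x ∈ U) {w : Raw J 𝔥 U} (hw : w ∈ Fun J 𝔥 U) :
    (fun x => k x (w ⟨h x, hV x x.2⟩) : Raw I 𝔤 V) ∈ Fun I 𝔤 V := by
  have key : ∀ (U : Opens N) (V : Opens M) (hV : ∀ x ∈ V, h x ∈ U) {w : Raw J 𝔥 U}
      (_ : w ∈ Algebra.adjoin ℝ {w : Raw J 𝔥 U | IsGen U w}),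
      (fun x => k x (w ⟨h x, hV x x.2⟩) : Raw I 𝔤 V) ∈ Fun I 𝔤 V := by
    intro U V hV w hw
    induction hw using Algebra.adjoin_induction with
    | mem w hw =>
      cases hw with
      | fn f hf =>
        convert (IsGen.fn (I := I) (𝔤 := 𝔤) (V := V) (fun x => f (h x))
          (hf.comp hh.contMDiffOn hV)).mem using 1
        funext x
        exact AlgHom.commutes (k x) _
      | form φ hφ =>
        convert (IsGen.form (I := I) (𝔤 := 𝔤) (V := V)
          (fun x => φ (h x) ∘ₗ (mfderiv I J h x).toLinearMap)
          (hφ.comp (hh.contMDiff_tangentMap (m := ∞) le_rfl).contMDiffOn fun p hp => hV _ hp)).mem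
          using 1
        funext x
        exact hk x _
      | xi μ => exact Fun.res_mem (le_top : V ≤ ⊤) (hxi μ)
      | xibar μ => exact Fun.res_mem (le_top : V ≤ ⊤) (hxibar μ)
    | algebraMap r =>
      convert Subalgebra.algebraMap_mem (Fun I 𝔤 V) r using 1
      funext x
      exact AlgHom.commutes (k x) r
    | add w w' _ _ h₁ h₂ =>
      convert add_mem h₁ h₂ using 1
      funext x
      exact map_add (k x) _ _
    | mul w w' _ _ h₁ h₂ =>
      convert mul_mem h₁ h₂ using 1
      funext x
      exact map_mul (k x) _ _
  refine Fun.mem_of_local fun x hx => ?_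
  obtain ⟨U', hU', hxU', hw'⟩ := hw (h x) (hV x hx)
  exact ⟨V ⊓ U'.comap ⟨h, hh.continuous⟩, inf_le_left, ⟨hx, hxU'⟩,
    key U' (V ⊓ U'.comap ⟨h, hh.continuous⟩) (fun x hx => hx.2) hw'⟩

variable [Bracket 𝔤 𝔤] [FiniteDimensional ℝ 𝔤] [Bracket 𝔥 𝔥] [FiniteDimensional ℝ 𝔥]

/-- A fibrewise morphism which is compatible with the differentials of generators is compatible with
the differentials of all families. -/
lemma IsPullback.hasD {h : M → N} (hh : ContMDiff I J ∞ h)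
    {k : ∀ x : M, Fib 𝔥 (TangentSpace J (h x)) →ₐ[ℝ] Fib 𝔤 (TangentSpace I x)}
    (hk : IsPullback h k) (hinv : ∀ x y, k x (Fib.invol 𝔥 _ y) = Fib.invol 𝔤 _ (k x y))
    (hxi : ∀ μ x, ∃ V : Opens M, x ∈ V ∧
      HasD V (fun y => k y (Fib.gen₁ 𝔥 _ (μ, 0))) (fun y => k y (Fib.weil₁ 𝔥 _ μ)))
    (hxibar : ∀ μ x, ∃ V : Opens M, x ∈ V ∧
      HasD V (fun y => k y (Fib.gen₂ 𝔥 _ μ)) (fun y => k y (Fib.weil₂ 𝔥 _ μ)))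
    {U : Opens N} {w η : Raw J 𝔥 U} (hw : HasD U w η) (x : M) (hx : h x ∈ U) :
    ∃ (V : Opens M) (hV : ∀ y ∈ V, h y ∈ U), x ∈ V ∧
      HasD V (fun y => k y (w ⟨h y, hV y y.2⟩)) (fun y => k y (η ⟨h y, hV y y.2⟩)) := by
  have hchain : ∀ (f : N → ℝ), ContMDiffOn J 𝓘(ℝ, ℝ) ∞ f U → ∀ y, h y ∈ U →
      (mfderiv J 𝓘(ℝ, ℝ) f (h y)).toLinearMap ∘ₗ (mfderiv I J h y).toLinearMap =
        (mfderiv I 𝓘(ℝ, ℝ) (fun y => f (h y)) y).toLinearMap := by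
    intro f hf y hy
    have := mfderiv_comp y ((hf.contMDiffAt (U.2.mem_nhds hy)).mdifferentiableAt (by simp))
      (hh.mdifferentiableAt (by simp) (x := y))
    exact (congrArg ContinuousLinearMap.toLinearMap this).symm
  induction hw with
  | fn f hf =>
    refine ⟨U.comap ⟨h, hh.continuous⟩, fun _ hy => hy, hx, ?_⟩
    refine (HasD.fn (fun y => f (h y)) (hf.comp hh.contMDiffOn fun _ hy => hy)).congr ?_ ?_
    · exact funext fun y => AlgHom.commutes (k y) _
    · exact funext fun y => (hk y _).trans
        (congrArg (fun l => Fib.gen₁ 𝔤 _ (0, l)) (hchain f hf y y.2))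
  | dfn f hf =>
    refine ⟨U.comap ⟨h, hh.continuous⟩, fun _ hy => hy, hx, ?_⟩
    refine (HasD.dfn (fun y => f (h y)) (hf.comp hh.contMDiffOn fun _ hy => hy)).congr ?_ ?_
    · exact funext fun y => (hk y _).trans
        (congrArg (fun l => Fib.gen₁ 𝔤 _ (0, l)) (hchain f hf y y.2))
    · exact funext fun y => map_zero (k y)
  | xi μ =>
    obtain ⟨V, hxV, hV⟩ := hxi μ x
    exact ⟨V ⊓ U.comap ⟨h, hh.continuous⟩, fun _ hy => hy.2, ⟨hxV, hx⟩, hV.res inf_le_left⟩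
  | xibar μ =>
    obtain ⟨V, hxV, hV⟩ := hxibar μ x
    exact ⟨V ⊓ U.comap ⟨h, hh.continuous⟩, fun _ hy => hy.2, ⟨hxV, hx⟩, hV.res inf_le_left⟩
  | add _ _ ih ih' =>
    obtain ⟨V, hV, hxV, h₁⟩ := ih
    obtain ⟨V', hV', hxV', h₂⟩ := ih'
    refine ⟨V ⊓ V', fun _ hy => hV _ hy.1, ⟨hxV, hxV'⟩,
      ((h₁.res inf_le_left).add (h₂.res inf_le_right)).congr ?_ ?_⟩
    · exact funext fun y => map_add (k y) _ _
    · exact funext fun y => map_add (k y) _ _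
  | @mul w w' η η' _ _ ih ih' =>
    obtain ⟨V, hV, hxV, h₁⟩ := ih
    obtain ⟨V', hV', hxV', h₂⟩ := ih'
    refine ⟨V ⊓ V', fun _ hy => hV _ hy.1, ⟨hxV, hxV'⟩,
      ((h₁.res inf_le_left).mul (h₂.res inf_le_right)).congr ?_ ?_⟩
    · exact funext fun y => map_mul (k y) _ _
    · funext y
      refine (map_add (k y) _ _).trans (congrArg₂ _ (map_mul (k y) _ _) ?_)
      refine (map_mul (k y) _ _).trans ?_
      exact congrArg (· * k y (η' ⟨h y, _⟩)) (hinv y _)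

/-- The relation defining the differential is local and generated by the Leibniz rule. On functions
and their differentials compatibility is the chain rule, so only $\xi$ and $\bar\xi$ have to be
checked. -/
lemma GrMap.isDG_of_isPullback (φ : GrMap I 𝔤 M J 𝔥 N) (hh : ContMDiff I J ∞ φ.body)
    {k : ∀ x : M, Fib 𝔥 (TangentSpace J (φ.body x)) →ₐ[ℝ] Fib 𝔤 (TangentSpace I x)}
    (hφ : ∀ (U : Opens N) (w : Fun J 𝔥 U) (x : M) (hx : φ.body x ∈ U),
      (φ.pull U w).1 ⟨x, hx⟩ = k x (w.1 ⟨φ.body x, hx⟩))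
    (hk : IsPullback φ.body k) (hinv : ∀ x y, k x (Fib.invol 𝔥 _ y) = Fib.invol 𝔤 _ (k x y))
    (hxi : ∀ μ x, ∃ V : Opens M, x ∈ V ∧
      HasD V (fun y => k y (Fib.gen₁ 𝔥 _ (μ, 0))) (fun y => k y (Fib.weil₁ 𝔥 _ μ)))
    (hxibar : ∀ μ x, ∃ V : Opens M, x ∈ V ∧
      HasD V (fun y => k y (Fib.gen₂ 𝔥 _ μ)) (fun y => k y (Fib.weil₂ 𝔥 _ μ))) : φ.IsDG := by
  intro U w η hw x hx
  obtain ⟨V, hV, hxV, h⟩ := hw _ hx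
  obtain ⟨V', hV', hxV', h'⟩ := hk.hasD hh hinv hxi hxibar h x hxV
  refine ⟨V', fun y hy => hV (hV' y hy), hxV', h'.congr ?_ ?_⟩
  · exact funext fun y => hφ U w y _
  · exact funext fun y => hφ U η y _

end Pullback

/-! ### The algebra morphism sending degree-two generators to two-forms -/

section Curvature

variable {𝔥 V W : Type*} [AddCommGroup 𝔥] [Module ℝ 𝔥] [AddCommGroup V] [Module ℝ V]
  [AddCommGroup W] [Module ℝ W]

/-- The algebra morphism with `(μ, l) ↦ a μ + l ∘ L` on generators of degree one and `μ ↦ c μ` on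
generators of degree two, for two-forms `c μ`. -/
def Fib.curvHom (a : Dual ℝ 𝔥 →ₗ[ℝ] Dual ℝ V) (L : V →ₗ[ℝ] W) (c : Dual ℝ 𝔥 →ₗ[ℝ] Fib Unit V)
    (hc : ∀ μ, c μ ∈ Fib.forms Unit V * Fib.forms Unit V) : Fib 𝔥 W →ₐ[ℝ] Fib Unit V :=
  Algebra.TensorProduct.lift
    -- A symmetric algebra lifts only to a commutative algebra. Two-forms are central, so the centre
    -- can be taken as the target.
    ((Subalgebra.center ℝ (Fib Unit V)).val.comp (SymmetricAlgebra.lift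
      { toFun := fun μ => (⟨c μ, Subalgebra.mem_center_iff.2 fun y =>
          ((Fib.commute_of_mem_forms (hc μ) y).eq).symm⟩ : Subalgebra.center ℝ (Fib Unit V))
        map_add' := fun _ _ => Subtype.ext (map_add c _ _)
        map_smul' := fun _ _ => Subtype.ext (map_smul c _ _) }))
    (ExteriorAlgebra.lift ℝ ⟨Fib.gen₁ Unit V ∘ₗ LinearMap.inr ℝ _ _ ∘ₗ
      (a ∘ₗ LinearMap.fst ℝ _ _ + L.dualMap ∘ₗ LinearMap.snd ℝ _ _),
      fun _ => Fib.gen₁_mul_self _⟩)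
    (fun _ _ => (Subalgebra.mem_center_iff.1 (Subtype.prop _) _).symm)

variable (a : Dual ℝ 𝔥 →ₗ[ℝ] Dual ℝ V) (L : V →ₗ[ℝ] W) (c : Dual ℝ 𝔥 →ₗ[ℝ] Fib Unit V)
    (hc : ∀ μ, c μ ∈ Fib.forms Unit V * Fib.forms Unit V)

@[simp] lemma Fib.curvHom_gen₁ (u : Dual ℝ 𝔥 × Dual ℝ W) :
    Fib.curvHom a L c hc (Fib.gen₁ 𝔥 W u) = Fib.gen₁ Unit V (0, a u.1 + u.2 ∘ₗ L) := by
  refine (Algebra.TensorProduct.lift_tmul _ _ _ 1 (ExteriorAlgebra.ι ℝ u)).trans ?_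
  rw [map_one, one_mul]
  exact ExteriorAlgebra.lift_ι_apply _ _ _ _

@[simp] lemma Fib.curvHom_gen₂ (μ : Dual ℝ 𝔥) :
    Fib.curvHom a L c hc (Fib.gen₂ 𝔥 W μ) = c μ := by
  refine (Algebra.TensorProduct.lift_tmul _ _ _ (SymmetricAlgebra.ι ℝ _ μ) 1).trans ?_
  rw [map_one, mul_one, AlgHom.comp_apply, SymmetricAlgebra.lift_ι_apply]
  rfl

lemma Fib.curvHom_aug (x : Fib 𝔥 W) :
    Fib.aug Unit V (Fib.curvHom a L c hc x) = Fib.aug 𝔥 W x := by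
  have h : ∀ x ∈ Fib.forms Unit V * Fib.forms Unit V, Fib.aug Unit V x = 0 := by
    intro x hx
    induction hx using Submodule.mul_induction_on' with
    | mem_mul_mem m hm n hn =>
      obtain ⟨l, rfl⟩ := hm
      obtain ⟨k, rfl⟩ := hn
      rw [map_mul, LinearMap.comp_apply, Fib.aug_gen₁, zero_mul]
    | add x _ y _ hx hy => rw [map_add, hx, hy, add_zero]
  have : (Fib.aug Unit V).comp (Fib.curvHom a L c hc) = Fib.aug 𝔥 W := by
    apply Fib.algHom_ext <;> intro u
    · simp
    · rw [AlgHom.comp_apply, Fib.curvHom_gen₂, h _ (hc u), Fib.aug_gen₂]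
  exact DFunLike.congr_fun this x

lemma Fib.curvHom_invol (x : Fib 𝔥 W) :
    Fib.curvHom a L c hc (Fib.invol 𝔥 W x) = Fib.invol Unit V (Fib.curvHom a L c hc x) := by
  have : (Fib.curvHom a L c hc).comp (Fib.invol 𝔥 W) =
      (Fib.invol Unit V).comp (Fib.curvHom a L c hc) := by
    apply Fib.algHom_ext <;> intro u
    · rw [AlgHom.comp_apply, AlgHom.comp_apply, Fib.invol_gen₁, map_smul, Fib.curvHom_gen₁,
        Fib.invol_gen₁]
    · rw [AlgHom.comp_apply, AlgHom.comp_apply, Fib.invol_gen₂, Fib.curvHom_gen₂,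
        Fib.invol_of_mem_forms (hc u)]
  exact DFunLike.congr_fun this x

lemma pow_mul_pow_le {A : Type*} [Semiring A] [Algebra ℝ A] {P Q R : Submodule ℝ A}
    (hP : P ≤ R * R) (hQ : Q ≤ R) (p q : ℕ) : P ^ p * Q ^ q ≤ R ^ (2 * p + q) := by
  rw [pow_add, pow_mul, pow_two]
  exact mul_le_mul' (pow_le_pow_left' hP p) (pow_le_pow_left' hQ q)

/-- A generator of degree two goes to a product of two linear forms, so `p` of them and `q` linear
forms land in degree $2p+q$. -/
lemma Fib.curvHom_deg {n : ℕ} {x : Fib 𝔥 W} (hx : x ∈ Fib.deg 𝔥 W n) :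
    Fib.curvHom a L c hc x ∈ Fib.deg Unit V n := by
  suffices h : (Fib.deg 𝔥 W n).map (Fib.curvHom a L c hc).toLinearMap ≤ Fib.deg Unit V n from
    h (Submodule.mem_map_of_mem hx)
  rw [Fib.deg_unit]
  simp only [Fib.deg, Submodule.map_iSup]
  refine iSup_le fun p => iSup_le fun q => iSup_le fun hpq => ?_
  rw [Submodule.map_mul, Submodule.map_pow, Submodule.map_pow, ← hpq]
  apply pow_mul_pow_le
  · rintro _ ⟨_, ⟨μ, rfl⟩, rfl⟩
    refine Set.mem_of_eq_of_mem (Fib.curvHom_gen₂ a L c hc μ) (hc μ)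
  · rintro _ ⟨_, ⟨μ, rfl⟩, rfl⟩
    exact ⟨_, (Fib.curvHom_gen₁ a L c hc μ).symm⟩

end Curvature

/-! ### The Bianchi identity as algebra, and the laws of the bracket -/

section Bianchi

/-- The algebra behind the identity of Bianchi: `P b` are anticommuting, `D b` are central, and the
coefficients satisfy the identity of Jacobi. -/
lemma bianchi_sum {A ι : Type*} [Ring A] [Algebra ℝ A] [Fintype ι] (f : ι → ι → ℝ)
    (s : ι → ι → ι → ℝ) (P D : ι → A) (hf : ∀ b c, f b c = -f c b)
    (hP : ∀ b c, P b * P c = (-1 : ℝ) • (P c * P b)) (hD : ∀ b x, Commute (D b) x)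
    (hJ : ∀ b d e, ∑ c, f b c * s c d e + ∑ c, f d c * s c e b + ∑ c, f e c * s c b d = 0) :
    (1 / 2 : ℝ) • ∑ b, ∑ c, f b c • (D b * P c + ((-1 : ℝ) • P b) * D c) =
      (-1 : ℝ) • ∑ b, ∑ c, f b c •
        (P b * (D c + (1 / 2 : ℝ) • ∑ d, ∑ e, s c d e • (P d * P e))) := by
  -- Exchange of the summation indices: `f` changes sign, and `D` is central.
  have h₁ : ∑ b, ∑ c, f b c • (D b * P c) = -∑ b, ∑ c, f b c • (P b * D c) := by
    rw [Finset.sum_comm, ← Finset.sum_neg_distrib]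
    refine Finset.sum_congr rfl fun b _ => ?_
    rw [← Finset.sum_neg_distrib]
    refine Finset.sum_congr rfl fun c _ => ?_
    rw [hf, neg_smul, (hD c _).eq]
  -- A cyclic rotation of three anticommuting factors is an even permutation.
  have hcyc : ∀ b d e, P b * (P d * P e) = P d * (P e * P b) := by
    intro b d e
    rw [← mul_assoc, hP b d, smul_mul_assoc, mul_assoc, hP b e, mul_smul_comm, smul_smul]
    norm_num
  set g : ι → ι → ι → ℝ := fun b d e => ∑ c, f b c * s c d e with hg
  have hJ₁ : ∑ b, ∑ d, ∑ e, g b d e • (P b * (P d * P e)) =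
      ∑ b, ∑ d, ∑ e, g d e b • (P b * (P d * P e)) := by
    calc _ = ∑ b, ∑ e, ∑ d, g b d e • (P b * (P d * P e)) :=
          Finset.sum_congr rfl fun b _ => Finset.sum_comm
      _ = ∑ e, ∑ b, ∑ d, g b d e • (P b * (P d * P e)) := Finset.sum_comm
      _ = _ := Finset.sum_congr rfl fun e _ => Finset.sum_congr rfl fun b _ =>
          Finset.sum_congr rfl fun d _ => by rw [hcyc e b d]
  have hJ₂ : ∑ b, ∑ d, ∑ e, g d e b • (P b * (P d * P e)) =
      ∑ b, ∑ d, ∑ e, g e b d • (P b * (P d * P e)) := by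
    calc _ = ∑ b, ∑ e, ∑ d, g d e b • (P b * (P d * P e)) :=
          Finset.sum_congr rfl fun b _ => Finset.sum_comm
      _ = ∑ e, ∑ b, ∑ d, g d e b • (P b * (P d * P e)) := Finset.sum_comm
      _ = _ := Finset.sum_congr rfl fun e _ => Finset.sum_congr rfl fun b _ =>
          Finset.sum_congr rfl fun d _ => by rw [hcyc e b d]
  -- The cubic sum equals its two cyclic rotations. Three times it is thus the sum over the cyclic
  -- orbit, whose coefficients vanish by the Jacobi identity.
  have hJ₃ : ∑ b, ∑ d, ∑ e, g b d e • (P b * (P d * P e)) = 0 := by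
    have h : (3 : ℝ) • ∑ b, ∑ d, ∑ e, g b d e • (P b * (P d * P e)) = 0 := by
      have : (3 : ℝ) = 1 + 1 + 1 := by norm_num
      rw [this, add_smul, add_smul, one_smul]
      nth_rewrite 3 [hJ₁.trans hJ₂]
      nth_rewrite 2 [hJ₁]
      simp only [← Finset.sum_add_distrib, ← add_smul]
      refine Finset.sum_eq_zero fun b _ => Finset.sum_eq_zero fun d _ =>
        Finset.sum_eq_zero fun e _ => ?_
      rw [show g b d e + g d e b + g e b d = 0 from hJ b d e, zero_smul]
    exact (smul_eq_zero.1 h).resolve_left (by norm_num)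
  have h₂ : ∑ b, ∑ c, f b c • (P b * ((1 / 2 : ℝ) • ∑ d, ∑ e, s c d e • (P d * P e))) = 0 := by
    have : ∀ b, ∑ c, f b c • (P b * ((1 / 2 : ℝ) • ∑ d, ∑ e, s c d e • (P d * P e))) =
        (1 / 2 : ℝ) • ∑ d, ∑ e, g b d e • (P b * (P d * P e)) := by
      intro b
      simp only [hg, Finset.sum_smul, mul_smul_comm, Finset.mul_sum, Finset.smul_sum, smul_smul]
      rw [Finset.sum_comm]
      refine Finset.sum_congr rfl fun d _ => ?_
      rw [Finset.sum_comm]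
      refine Finset.sum_congr rfl fun e _ => Finset.sum_congr rfl fun c _ => ?_
      congr 1
      ring
    simp only [this]
    rw [← Finset.smul_sum, hJ₃, smul_zero]
  simp only [mul_add, smul_add, Finset.sum_add_distrib, h₂, add_zero, h₁, smul_mul_assoc]
  have h₃ : ∑ b, ∑ c, f b c • ((-1 : ℝ) • (P b * D c)) = -∑ b, ∑ c, f b c • (P b * D c) := by
    simp only [neg_smul, one_smul, smul_neg, Finset.sum_neg_distrib]
  -- The two mixed sums are equal, so the factor $\tfrac12$ on the left disappears.
  rw [h₃, ← smul_add, ← two_smul ℝ, smul_smul, ← neg_one_smul ℝ, smul_smul]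
  norm_num

/-- The laws of a Lie algebra, for a bracket. -/
class IsLieBracket (𝔥 : Type*) [AddCommGroup 𝔥] [Module ℝ 𝔥] [Bracket 𝔥 𝔥] : Prop where
  add_lie (x y z : 𝔥) : ⁅x + y, z⁆ = ⁅x, z⁆ + ⁅y, z⁆
  lie_smul (r : ℝ) (x y : 𝔥) : ⁅x, r • y⁆ = r • ⁅x, y⁆
  lie_skew (x y : 𝔥) : ⁅x, y⁆ = -⁅y, x⁆
  jacobi (x y z : 𝔥) : ⁅x, ⁅y, z⁆⁆ + ⁅y, ⁅z, x⁆⁆ + ⁅z, ⁅x, y⁆⁆ = 0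

namespace IsLieBracket

variable {𝔥 : Type*} [AddCommGroup 𝔥] [Module ℝ 𝔥] [Bracket 𝔥 𝔥] [IsLieBracket 𝔥]

/-- The bracket as a bilinear map. -/
def bilin (𝔥 : Type*) [AddCommGroup 𝔥] [Module ℝ 𝔥] [Bracket 𝔥 𝔥] [IsLieBracket 𝔥] :
    𝔥 →ₗ[ℝ] 𝔥 →ₗ[ℝ] 𝔥 :=
  LinearMap.mk₂ ℝ (fun x y => ⁅x, y⁆) add_lie
    (fun r x y => by rw [lie_skew, lie_smul, lie_skew y x, smul_neg, neg_neg])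
    (fun x y z => by rw [lie_skew, add_lie, neg_add, ← lie_skew, ← lie_skew]) lie_smul

@[simp] lemma bilin_apply (x y : 𝔥) : bilin 𝔥 x y = ⁅x, y⁆ := rfl

end IsLieBracket

/-- Expansion of the second argument in the basis. It turns contractions of structure constants into
nested brackets, the form in which Jacobi applies. -/
lemma sum_dual_bracket {𝔥 : Type*} [AddCommGroup 𝔥] [Module ℝ 𝔥] [Bracket 𝔥 𝔥] [IsLieBracket 𝔥]
    [FiniteDimensional ℝ 𝔥] (μ : Dual ℝ 𝔥) (x y : 𝔥) :
    ∑ c, μ ⁅x, finBasis ℝ 𝔥 c⁆ * (finBasis ℝ 𝔥).coord c y = μ ⁅x, y⁆ := by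
  have h := congrArg (fun y => μ (IsLieBracket.bilin 𝔥 x y)) ((finBasis ℝ 𝔥).sum_repr y)
  simp only [map_sum, map_smul, IsLieBracket.bilin_apply, smul_eq_mul] at h
  rw [← h]
  exact Finset.sum_congr rfl fun c _ => mul_comm _ _

end Bianchi

/-! ### The Weil differential through the quadratic bracket expression -/

section WeilForms

variable {𝔤 V : Type*} [AddCommGroup 𝔤] [Module ℝ 𝔤] [AddCommGroup V] [Module ℝ V]
  [Bracket 𝔤 𝔤] [FiniteDimensional ℝ 𝔤]

/-- The quadratic expression `fᵃ_{bc} P(ξᵇ) Q(ξᶜ)`. -/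
def bracketSum {A : Type*} [Semiring A] [Algebra ℝ A] (μ : Dual ℝ 𝔤) (P Q : Dual ℝ 𝔤 → A) : A :=
  ∑ b, ∑ c, μ ⁅finBasis ℝ 𝔤 b, finBasis ℝ 𝔤 c⁆ •
    (P ((finBasis ℝ 𝔤).coord b) * Q ((finBasis ℝ 𝔤).coord c))

lemma map_bracketSum {A B : Type*} [Semiring A] [Algebra ℝ A] [Semiring B] [Algebra ℝ B]
    (φ : A →ₐ[ℝ] B) (μ : Dual ℝ 𝔤) (P Q : Dual ℝ 𝔤 → A) :
    φ (bracketSum μ P Q) = bracketSum μ (fun ν => φ (P ν)) (fun ν => φ (Q ν)) := by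
  simp only [bracketSum, map_sum, map_smul, map_mul]

lemma Fib.weil₁_eq (μ : Dual ℝ 𝔤) : Fib.weil₁ 𝔤 V μ = Fib.gen₂ 𝔤 V μ +
    (-1 / 2 : ℝ) • bracketSum μ (fun ν => Fib.gen₁ 𝔤 V (ν, 0)) (fun ν => Fib.gen₁ 𝔤 V (ν, 0)) := by
  refine (sub_eq_add_neg _ _).trans (congrArg (Fib.gen₂ 𝔤 V μ + ·) ?_)
  refine (neg_smul (1 / 2 : ℝ) _).symm.trans ?_
  rw [neg_div]
  rfl

lemma Fib.weil₂_eq (μ : Dual ℝ 𝔤) : Fib.weil₂ 𝔤 V μ =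
    (-1 : ℝ) • bracketSum μ (fun ν => Fib.gen₁ 𝔤 V (ν, 0)) (fun ν => Fib.gen₂ 𝔤 V ν) :=
  (neg_one_smul ℝ _).symm

end WeilForms

/-! ### Connection forms, their curvature, and the morphisms they define -/

section Connection

set_option linter.unusedSectionVars false

variable {E H : Type*} [NormedAddCommGroup E] [NormedSpace ℝ E] [FiniteDimensional ℝ E]
  [TopologicalSpace H] {I : ModelWithCorners ℝ E H} [I.Boundaryless]
  {M : Type*} [TopologicalSpace M] [ChartedSpace H M] [IsManifold I ∞ M]
  {F K : Type*} [NormedAddCommGroup F] [NormedSpace ℝ F] [TopologicalSpace K]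
  {J : ModelWithCorners ℝ F K} {𝔥 : Type*} [AddCommGroup 𝔥] [Module ℝ 𝔥]
  {N : Type*} [TopologicalSpace N] [ChartedSpace K N] [IsManifold J ∞ N]
  [Bracket 𝔥 𝔥] [FiniteDimensional ℝ 𝔥]

variable (I M 𝔥) in
/-- Smooth one-forms with values in a vector space. -/
@[ext]
structure Conn where
  form (x : M) : TangentSpace I x →ₗ[ℝ] 𝔥
  smooth (μ : Dual ℝ 𝔥) : SmoothForm I (fun x => μ ∘ₗ form x) Set.univ

/-- The component of a connection form along a linear form on the Lie algebra. -/
def Conn.comp (A : Conn I M 𝔥) (x : M) (μ : Dual ℝ 𝔥) : Fib Unit (TangentSpace I x) :=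
  Fib.gen₁ Unit _ (0, μ ∘ₗ A.form x)

/-- The curvature of a connection form. -/
def Conn.curv (A : Conn I M 𝔥) (x : M) : Dual ℝ 𝔥 →ₗ[ℝ] Fib Unit (TangentSpace I x) where
  toFun μ := extDer Unit (fun y => μ ∘ₗ A.form y) x +
    (1 / 2 : ℝ) • bracketSum μ (A.comp x) (A.comp x)
  map_add' μ ν := by
    have h : extDer Unit (fun y => (μ + ν) ∘ₗ A.form y) x =
        extDer Unit (fun y => μ ∘ₗ A.form y) x + extDer Unit (fun y => ν ∘ₗ A.form y) x :=
      extDer_add (A.smooth μ) (A.smooth ν) x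
    rw [h]
    simp only [bracketSum, LinearMap.add_apply, add_smul, Finset.sum_add_distrib, smul_add]
    exact add_add_add_comm _ _ _ _
  map_smul' r μ := by
    have h : extDer Unit (fun y => (r • μ) ∘ₗ A.form y) x =
        r • extDer Unit (fun y => μ ∘ₗ A.form y) x := extDer_smul (A.smooth μ) r x
    rw [h]
    simp only [bracketSum, LinearMap.smul_apply, smul_eq_mul, mul_smul, smul_add, ← Finset.smul_sum,
      RingHom.id_apply]
    rw [smul_comm r]

lemma bracketSum_mem_forms (A : Conn I M 𝔥) (x : M) (μ : Dual ℝ 𝔥) :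
    bracketSum μ (A.comp x) (A.comp x) ∈
      Fib.forms Unit (TangentSpace I x) * Fib.forms Unit (TangentSpace I x) :=
  Submodule.sum_mem _ fun _ _ => Submodule.sum_mem _ fun _ _ =>
    Submodule.smul_mem _ _ (Fib.mul_mem_forms _ _)

lemma Conn.exists_hasD (A : Conn I M 𝔥) (μ : Dual ℝ 𝔥) (x : M) : ∃ (V : Opens M) (_ : x ∈ V),
    HasD V (fun y => A.comp y μ) (fun y => extDer Unit (fun y => μ ∘ₗ A.form y) y) ∧
    HasD V (fun y => extDer Unit (fun y => μ ∘ₗ A.form y) y) 0 ∧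
    (fun y => extDer Unit (fun y => μ ∘ₗ A.form y) y : Raw I Unit V) ∈ Fun I Unit V ∧
    ∀ y ∈ V, extDer Unit (fun y => μ ∘ₗ A.form y) y ∈
      Fib.forms Unit (TangentSpace I y) * Fib.forms Unit (TangentSpace I y) := by
  obtain ⟨V, _, hx, h⟩ := SmoothForm.exists_hasD_extDer (𝔤 := Unit) (V := ⊤) (A.smooth μ)
    (x := x) trivial
  exact ⟨V, hx, h⟩

lemma Conn.extDer_mem (A : Conn I M 𝔥) (x : M) (μ : Dual ℝ 𝔥) :
    extDer Unit (fun y => μ ∘ₗ A.form y) x ∈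
      Fib.forms Unit (TangentSpace I x) * Fib.forms Unit (TangentSpace I x) := by
  obtain ⟨V, hx, -, -, -, h⟩ := A.exists_hasD μ x
  exact h x hx

lemma Conn.curv_mem (A : Conn I M 𝔥) (x : M) (μ : Dual ℝ 𝔥) :
    A.curv x μ ∈ Fib.forms Unit (TangentSpace I x) * Fib.forms Unit (TangentSpace I x) :=
  add_mem (A.extDer_mem x μ) (Submodule.smul_mem _ _ (bracketSum_mem_forms A x μ))

lemma Conn.comp_mem (A : Conn I M 𝔥) (V : Opens M) (μ : Dual ℝ 𝔥) :
    (fun y => A.comp y μ : Raw I Unit V) ∈ Fun I Unit V :=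
  (IsGen.form (𝔤 := Unit) (V := V) (fun y => μ ∘ₗ A.form y)
    ((A.smooth μ).mono (Set.subset_univ _))).mem

/-- The fibrewise morphism given by a map and a connection form. -/
def Conn.hom (A : Conn I M 𝔥) (h : M → N) (x : M) :
    Fib 𝔥 (TangentSpace J (h x)) →ₐ[ℝ] Fib Unit (TangentSpace I x) :=
  Fib.curvHom (A.form x).dualMap (mfderiv I J h x).toLinearMap (A.curv x) (A.curv_mem x)

lemma Conn.hom_gen₁ (A : Conn I M 𝔥) (h : M → N) (x : M) (μ : Dual ℝ 𝔥) :
    A.hom (J := J) h x (Fib.gen₁ 𝔥 _ (μ, 0)) = A.comp x μ :=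
  (Fib.curvHom_gen₁ _ _ _ _ _).trans (congrArg (fun l => Fib.gen₁ Unit _ (0, l)) (add_zero _))

lemma Conn.hom_form (A : Conn I M 𝔥) (h : M → N) : IsPullback h (A.hom (J := J) h) := by
  intro x l
  refine (Fib.curvHom_gen₁ _ _ _ _ _).trans (congrArg (fun l => Fib.gen₁ Unit _ (0, l)) ?_)
  refine (congrArg (· + _) (map_zero (A.form x).dualMap)).trans (zero_add _)

lemma Conn.hom_gen₂ (A : Conn I M 𝔥) (h : M → N) (x : M) (μ : Dual ℝ 𝔥) :
    A.hom (J := J) h x (Fib.gen₂ 𝔥 _ μ) = A.curv x μ :=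
  Fib.curvHom_gen₂ _ _ _ _ _

/-- Smoothness may be checked locally, where `extDer` agrees with the differential of a smooth form
and the quadratic term is a polynomial in the components. -/
lemma Conn.curv_mem_fun (A : Conn I M 𝔥) (μ : Dual ℝ 𝔥) :
    (fun x => A.curv x.1 μ : Raw I Unit ⊤) ∈ Fun I Unit ⊤ := by
  refine Fun.mem_of_local fun x _ => ?_
  obtain ⟨V, hx, -, -, h, -⟩ := A.exists_hasD μ x
  refine ⟨V, le_top, hx, ?_⟩
  refine add_mem h (Subalgebra.smul_mem _ ?_ (1 / 2 : ℝ))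
  have : ∑ b, ∑ c, μ ⁅finBasis ℝ 𝔥 b, finBasis ℝ 𝔥 c⁆ •
    ((fun y => A.comp y ((finBasis ℝ 𝔥).coord b) : Raw I Unit V) *
      (fun y => A.comp y ((finBasis ℝ 𝔥).coord c) : Raw I Unit V)) ∈ Fun I Unit V :=
    sum_mem fun _ _ => sum_mem fun _ _ =>
      Subalgebra.smul_mem _ (mul_mem (A.comp_mem V _) (A.comp_mem V _)) _
  convert this using 1
  funext y
  simp only [Finset.sum_apply, Pi.smul_apply, Pi.mul_apply]
  rfl

/-- The morphism `T[1]M → T[1]𝔥[1] × T[1]N` given by a map and a connection form. -/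
def GrMap.ofConn (h : M → N) (hh : ContMDiff I J ∞ h) (A : Conn I M 𝔥) :
    GrMap I Unit M J 𝔥 N where
  body := ⟨h, hh.continuous⟩
  pull U :=
    { toFun := fun w => ⟨fun x => A.hom h x.1 (w.1 ⟨h x.1, x.2⟩),
        (A.hom_form h).mem hh (fun μ => by
          simp only [Conn.hom_gen₁]
          exact A.comp_mem ⊤ μ) (fun μ => by
          simp only [Conn.hom_gen₂]
          exact A.curv_mem_fun μ) U (U.comap ⟨h, hh.continuous⟩) (fun _ hx => hx) w.2⟩
      map_one' := Subtype.ext (funext fun _ => map_one _)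
      map_mul' := fun _ _ => Subtype.ext (funext fun _ => map_mul _ _ _)
      map_zero' := Subtype.ext (funext fun _ => map_zero _)
      map_add' := fun _ _ => Subtype.ext (funext fun _ => map_add _ _ _)
      commutes' := fun _ => Subtype.ext (funext fun _ => AlgHom.commutes _ _) }
  pull_res _ _ := rfl
  pull_homogeneous hw x := Fib.curvHom_deg _ _ _ _ (hw ⟨h x, x.2⟩)
  pull_local _ _ _ hw := (Fib.curvHom_aug _ _ _ _ _).trans hw

/-- The quadratic term of the curvature cancels the $-\tfrac12[\xi,\xi]$ of the Weil differential,
leaving $dA$. This is the reason for sending $\bar\xi$ to the curvature. -/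
lemma Conn.hom_weil₁ (A : Conn I M 𝔥) (h : M → N) (x : M) (μ : Dual ℝ 𝔥) :
    A.hom (J := J) h x (Fib.weil₁ 𝔥 _ μ) = extDer Unit (fun y => μ ∘ₗ A.form y) x := by
  rw [Fib.weil₁_eq, map_add, map_smul, map_bracketSum, A.hom_gen₂]
  simp only [A.hom_gen₁]
  refine (add_assoc _ _ _).trans ?_
  refine (congrArg (extDer Unit (fun y => μ ∘ₗ A.form y) x + ·) ?_).trans (add_zero _)
  refine (add_smul _ _ _).symm.trans ?_
  norm_num

lemma Conn.hom_weil₂ (A : Conn I M 𝔥) (h : M → N) (x : M) (μ : Dual ℝ 𝔥) :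
    A.hom (J := J) h x (Fib.weil₂ 𝔥 _ μ) =
      (-1 : ℝ) • bracketSum μ (A.comp x) (fun ν => A.curv x ν) := by
  rw [Fib.weil₂_eq, map_smul, map_bracketSum]
  simp only [A.hom_gen₁, A.hom_gen₂]

lemma Conn.exists_hasD_bracketSum (A : Conn I M 𝔥) (μ : Dual ℝ 𝔥) (x : M) :
    ∃ W : Opens M, x ∈ W ∧ HasD (I := I) (𝔤 := Unit) W
      (fun y => bracketSum μ (A.comp y) (A.comp y))
      (fun y => ∑ b, ∑ c, μ ⁅finBasis ℝ 𝔥 b, finBasis ℝ 𝔥 c⁆ •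
        (extDer Unit (fun y => (finBasis ℝ 𝔥).coord b ∘ₗ A.form y) y.1 *
          A.comp y.1 ((finBasis ℝ 𝔥).coord c) + ((-1 : ℝ) • A.comp y.1 ((finBasis ℝ 𝔥).coord b)) *
          extDer Unit (fun y => (finBasis ℝ 𝔥).coord c ∘ₗ A.form y) y.1)) := by
  -- Each component has its own neighbourhood; the finite intersection over a basis serves all of
  -- them at once.
  choose W hxW hW using fun b => A.exists_hasD ((finBasis ℝ 𝔥).coord b) x
  have hxW' : x ∈ Finset.univ.inf W := by
    rw [← SetLike.mem_coe, Opens.coe_finset_inf]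
    simpa using hxW
  have hW' := fun b => (hW b).1.res (Finset.inf_le (Finset.mem_univ b))
  have h := HasD.sum Finset.univ fun b => HasD.sum Finset.univ fun c =>
    ((hW' b).mul (hW' c)).smul (μ ⁅finBasis ℝ 𝔥 b, finBasis ℝ 𝔥 c⁆)
  refine ⟨Finset.univ.inf W, hxW', h.congr (funext fun y => ?_) (funext fun y => ?_)⟩
  · simp only [Finset.sum_apply]
    rfl
  · simp only [Finset.sum_apply]
    refine Finset.sum_congr rfl fun b _ => Finset.sum_congr rfl fun c _ => ?_
    exact congrArg (fun z => μ ⁅finBasis ℝ 𝔥 b, finBasis ℝ 𝔥 c⁆ •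
      (extDer Unit (fun y => (finBasis ℝ 𝔥).coord b ∘ₗ A.form y) y.1 *
        A.comp y.1 ((finBasis ℝ 𝔥).coord c) +
        z * extDer Unit (fun y => (finBasis ℝ 𝔥).coord c ∘ₗ A.form y) y.1))
      (Fib.invol_gen₁ _).symm

/-- On $\xi$ the condition is `Conn.hom_weil₁`. On $\bar\xi$ it is the Bianchi identity $dF=-[A,F]$:
since $d\,dA=0$, only the differential of the quadratic term contributes, and `bianchi_sum`
identifies it. -/
lemma GrMap.ofConn_isDG [IsLieBracket 𝔥] (h : M → N) (hh : ContMDiff I J ∞ h) (A : Conn I M 𝔥) :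
    (GrMap.ofConn h hh A).IsDG := by
  refine GrMap.isDG_of_isPullback _ hh (k := A.hom h) (fun _ _ _ _ => rfl) (A.hom_form h)
    (fun x y => Fib.curvHom_invol _ _ _ _ _) (fun μ x => ?_) (fun μ x => ?_)
  · obtain ⟨V, hx, h₁, -⟩ := A.exists_hasD μ x
    exact ⟨V, hx, h₁.congr (funext fun y => A.hom_gen₁ h y μ) (funext fun y => A.hom_weil₁ h y μ)⟩
  · obtain ⟨V, hx, -, h₂, -⟩ := A.exists_hasD μ x
    obtain ⟨W, hxW, h₃⟩ := A.exists_hasD_bracketSum μ x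
    have h₄ := (h₂.res (V := V ⊓ W) inf_le_left).add
      ((h₃.res (V := V ⊓ W) inf_le_right).smul (1 / 2 : ℝ))
    refine ⟨V ⊓ W, ⟨hx, hxW⟩, h₄.congr (funext fun y => A.hom_gen₂ h y μ) (funext fun y => ?_)⟩
    refine (A.hom_weil₂ h y μ).trans ?_
    refine Eq.trans ?_ (zero_add _).symm
    refine (bianchi_sum (fun b c => μ ⁅finBasis ℝ 𝔥 b, finBasis ℝ 𝔥 c⁆)
      (fun c d e => (finBasis ℝ 𝔥).coord c ⁅finBasis ℝ 𝔥 d, finBasis ℝ 𝔥 e⁆)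
      (fun b => A.comp y.1 ((finBasis ℝ 𝔥).coord b))
      (fun b => extDer Unit (fun y => (finBasis ℝ 𝔥).coord b ∘ₗ A.form y) y.1)
      (fun b c => ?_) (fun b c => Fib.gen₁_mul_gen₁ _ _)
      (fun b z => Fib.commute_of_mem_forms (A.extDer_mem _ _) z) fun b d e => ?_).symm
    · rw [IsLieBracket.lie_skew, map_neg]
    · rw [sum_dual_bracket, sum_dual_bracket, sum_dual_bracket, ← map_add, ← map_add,
        IsLieBracket.jacobi, map_zero]

end Connection

/-! ### Every dg morphism from $T[1]M$ comes from a map and a form -/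

section Classification

set_option linter.unusedSectionVars false

variable {E H : Type*} [NormedAddCommGroup E] [NormedSpace ℝ E] [FiniteDimensional ℝ E]
  [TopologicalSpace H] {I : ModelWithCorners ℝ E H} [I.Boundaryless]
  {M : Type*} [TopologicalSpace M] [ChartedSpace H M] [IsManifold I ∞ M]
  {F K : Type*} [NormedAddCommGroup F] [NormedSpace ℝ F] [FiniteDimensional ℝ F]
  [TopologicalSpace K] {J : ModelWithCorners ℝ F K} [J.Boundaryless]
  {𝔥 : Type*} [AddCommGroup 𝔥] [Module ℝ 𝔥]
  {N : Type*} [TopologicalSpace N] [ChartedSpace K N] [IsManifold J ∞ N]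

section Degrees

variable {V : Type*} [AddCommGroup V] [Module ℝ V]

lemma Fib.mem_deg_of_mem {x : Fib 𝔥 V} (p q : ℕ)
    (hx : x ∈ LinearMap.range (Fib.gen₂ 𝔥 V) ^ p * LinearMap.range (Fib.gen₁ 𝔥 V) ^ q) :
    x ∈ Fib.deg 𝔥 V (2 * p + q) :=
  Submodule.mem_iSup_of_mem p (Submodule.mem_iSup_of_mem q
    (Submodule.mem_iSup_of_mem (p := fun _ : 2 * p + q = 2 * p + q =>
      LinearMap.range (Fib.gen₂ 𝔥 V) ^ p * LinearMap.range (Fib.gen₁ 𝔥 V) ^ q) rfl hx))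

lemma pow_zero_mul_pow_one {A : Type*} [Semiring A] [Algebra ℝ A] (P Q : Submodule ℝ A) :
    P ^ 0 * Q ^ 1 = Q := by
  rw [pow_zero, pow_one, one_mul]

lemma pow_zero_mul_pow_two {A : Type*} [Semiring A] [Algebra ℝ A] (P Q : Submodule ℝ A) :
    P ^ 0 * Q ^ 2 = Q * Q := by
  rw [pow_zero, pow_two, one_mul]

lemma pow_one_mul_pow_zero {A : Type*} [Semiring A] [Algebra ℝ A] (P Q : Submodule ℝ A) :
    P ^ 1 * Q ^ 0 = P := by
  rw [pow_zero, pow_one, mul_one]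

lemma algebraMap_mem_pow_zero {A : Type*} [Semiring A] [Algebra ℝ A] (P Q : Submodule ℝ A) (r : ℝ) :
    algebraMap ℝ A r ∈ P ^ 0 * Q ^ 0 := by
  rw [pow_zero, pow_zero, one_mul]
  exact Submodule.algebraMap_mem r

lemma Fib.algebraMap_mem_deg (r : ℝ) : algebraMap ℝ (Fib 𝔥 V) r ∈ Fib.deg 𝔥 V 0 :=
  Fib.mem_deg_of_mem 0 0 (algebraMap_mem_pow_zero _ _ r)

lemma Fib.gen₁_mem_deg (l : Dual ℝ 𝔥 × Dual ℝ V) : Fib.gen₁ 𝔥 V l ∈ Fib.deg 𝔥 V 1 :=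
  Fib.mem_deg_of_mem 0 1 ((pow_zero_mul_pow_one _ _).ge ⟨l, rfl⟩)

lemma Fib.gen₂_mem_deg (μ : Dual ℝ 𝔥) : Fib.gen₂ 𝔥 V μ ∈ Fib.deg 𝔥 V 2 :=
  Fib.mem_deg_of_mem 1 0 ((pow_one_mul_pow_zero _ _).ge ⟨μ, rfl⟩)

lemma Fib.gen₁_mul_gen₁_mem_deg (l m : Dual ℝ 𝔥 × Dual ℝ V) :
    Fib.gen₁ 𝔥 V l * Fib.gen₁ 𝔥 V m ∈ Fib.deg 𝔥 V 2 :=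
  Fib.mem_deg_of_mem 0 2 ((pow_zero_mul_pow_two _ _).ge (Submodule.mul_mem_mul ⟨l, rfl⟩ ⟨m, rfl⟩))

lemma Fib.deg_unit_one : Fib.deg Unit V 1 = Fib.forms Unit V :=
  (Fib.deg_unit 1).trans (pow_one (Fib.forms Unit V))

lemma Fib.deg_unit_two : Fib.deg Unit V 2 = Fib.forms Unit V * Fib.forms Unit V :=
  (Fib.deg_unit 2).trans (pow_two (Fib.forms Unit V))

lemma Fib.gen₁_sum_smul {ι : Type*} [Fintype ι] (r : ι → ℝ) (l : ι → Dual ℝ V) :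
    Fib.gen₁ 𝔥 V (0, ∑ i, r i • l i) = ∑ i, r i • Fib.gen₁ 𝔥 V (0, l i) := by
  have h := map_sum (Fib.gen₁ 𝔥 V ∘ₗ LinearMap.inr ℝ _ _) (fun i => r i • l i) Finset.univ
  simp only [map_smul] at h
  exact h

end Degrees

lemma sum_smul_comp {V W ι : Type*} [AddCommGroup V] [Module ℝ V] [AddCommGroup W] [Module ℝ W]
    [Fintype ι] (r : ι → ℝ) (l : ι → Dual ℝ W) (L : V →ₗ[ℝ] W) :
    (∑ i, r i • l i) ∘ₗ L = ∑ i, r i • (l i ∘ₗ L) := by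
  ext v
  simp

lemma map_eq_sum_coord [FiniteDimensional ℝ 𝔥] {A B : Type*} [Semiring A] [Algebra ℝ A] [Semiring B]
    [Algebra ℝ B] (f : A →ₐ[ℝ] B) (ξ : Dual ℝ 𝔥 →ₗ[ℝ] A) (μ : Dual ℝ 𝔥) :
    f (ξ μ) = ∑ b, μ (finBasis ℝ 𝔥 b) • f (ξ ((finBasis ℝ 𝔥).coord b)) := by
  conv_lhs => rw [← (finBasis ℝ 𝔥).sum_dual_apply_smul_coord μ]
  simp only [map_sum, map_smul]

lemma map_add_smul_bracketSum [Bracket 𝔥 𝔥] [FiniteDimensional ℝ 𝔥] {A B : Type*} [Semiring A]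
    [Algebra ℝ A] [Semiring B] [Algebra ℝ B] (f : A →ₐ[ℝ] B) (a : A) (r : ℝ) (μ : Dual ℝ 𝔥)
    (P Q : Dual ℝ 𝔥 → A) : f (a + r • bracketSum μ P Q) =
      f a + r • bracketSum μ (fun ν => f (P ν)) (fun ν => f (Q ν)) := by
  rw [map_add, map_smul, map_bracketSum]

variable (𝔥) in
/-- A smooth function, as a function of degree zero. -/
def Fun.fn {U : Opens N} {f : N → ℝ} (hf : ContMDiffOn J 𝓘(ℝ, ℝ) ∞ f U) : Fun J 𝔥 U :=
  ⟨_, (IsGen.fn f hf).mem⟩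

variable (𝔥) in
/-- A smooth form, as a function of degree one. -/
def Fun.form {U : Opens N} {θ : ∀ x : N, Dual ℝ (TangentSpace J x)} (hθ : SmoothForm J θ U) :
    Fun J 𝔥 U :=
  ⟨_, (IsGen.form θ hθ).mem⟩

variable (J) in
/-- The coordinate functions of degree one. -/
def Fun.xi (U : Opens N) : Dual ℝ 𝔥 →ₗ[ℝ] Fun J 𝔥 U where
  toFun μ := ⟨_, (IsGen.xi μ).mem⟩
  map_add' μ ν := Subtype.ext (funext fun _ =>
    map_add (Fib.gen₁ 𝔥 (TangentSpace J _) ∘ₗ LinearMap.inl ℝ _ _) μ ν)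
  map_smul' r μ := Subtype.ext (funext fun _ =>
    map_smul (Fib.gen₁ 𝔥 (TangentSpace J _) ∘ₗ LinearMap.inl ℝ _ _) r μ)

variable (J) in
/-- The coordinate functions of degree two. -/
def Fun.xibar (U : Opens N) (μ : Dual ℝ 𝔥) : Fun J 𝔥 U :=
  ⟨_, (IsGen.xibar μ).mem⟩

/-- The image has degree zero, hence is a scalar at each point. To find it, subtract the constant
$f(\varphi(x))$: the difference vanishes at $\varphi(x)$, so by locality its image vanishes at $x$.
-/
lemma GrMap.pull_fn (φ : GrMap I Unit M J 𝔥 N) {U : Opens N} {f : N → ℝ}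
    (hf : ContMDiffOn J 𝓘(ℝ, ℝ) ∞ f U) (x : M) (hx : φ.body x ∈ U) :
    (φ.pull U (Fun.fn 𝔥 hf)).1 ⟨x, hx⟩ = algebraMap ℝ _ (f (φ.body x)) := by
  have h₀ : Fun.IsHomogeneous 0 (Fun.fn 𝔥 hf) := fun y => Fib.algebraMap_mem_deg _
  have h₁ := Fib.mem_deg_zero (φ.pull_homogeneous h₀ ⟨x, hx⟩)
  refine h₁.trans (congrArg _ ?_)
  have h₂ := φ.pull_local (Fun.fn 𝔥 hf + algebraMap ℝ _ (-f (φ.body x))) x hx (by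
    refine (map_add (Fib.aug 𝔥 _) _ _).trans ?_
    refine (congrArg₂ (· + ·) (AlgHom.commutes (Fib.aug 𝔥 _) _)
      (AlgHom.commutes (Fib.aug 𝔥 _) _)).trans ?_
    exact add_neg_cancel _)
  rw [map_add, AlgHom.commutes] at h₂
  have h₃ := (map_add (Fib.aug Unit _) _ _).symm.trans h₂
  have h₄ := (congrArg (_ + ·) (AlgHom.commutes (Fib.aug Unit (TangentSpace I x)) _).symm).trans h₃
  exact eq_of_sub_eq_zero h₄

/-- Coordinate functions of a chart of $N$ are pulled back to smooth functions, and by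
`GrMap.pull_fn` these are the coordinates of the body. -/
lemma GrMap.contMDiff_body (φ : GrMap I Unit M J 𝔥 N) : ContMDiff I J ∞ φ.body := by
  intro x
  refine contMDiffAt_iff_target.2 ⟨φ.body.continuous.continuousAt, ?_⟩
  let B := finBasis ℝ F
  let U : Opens N := ⟨(extChartAt J (φ.body x)).source, isOpen_extChartAt_source _⟩
  have hx : φ.body x ∈ U := mem_extChartAt_source _
  have h₁ : ∀ i, ContMDiffAt I 𝓘(ℝ, ℝ) ∞ (fun y => B.coord i (extChartAt J (φ.body x) (φ.body y)))
      x := by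
    intro i
    have h₂ : ContMDiffOn J 𝓘(ℝ, ℝ) ∞ (fun z => B.coord i (extChartAt J (φ.body x) z)) U := by
      refine (LinearMap.toContinuousLinearMap (B.coord i)).contMDiff.comp_contMDiffOn
        (contMDiffOn_extChartAt.mono ?_)
      exact (extChartAt_source J (φ.body x)).le
    have h₃ := Fun.contMDiffOn_value (φ.pull U (Fun.fn 𝔥 h₂))
      (f := fun y => B.coord i (extChartAt J (φ.body x) (φ.body y))) (fun y => by
        refine (congrArg (Fib.aug Unit _) (φ.pull_fn h₂ y.1 y.2)).trans ?_
        exact AlgHom.commutes _ _)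
    exact h₃.contMDiffAt ((U.comap φ.body).2.mem_nhds hx)
  have h₄ : ContMDiffAt I 𝓘(ℝ, Fin (finrank ℝ F) → ℝ) ∞
      (fun y i => B.coord i (extChartAt J (φ.body x) (φ.body y))) x := contMDiffAt_pi_space.2 h₁
  have h₅ := (B.equivFunL.symm : (Fin (finrank ℝ F) → ℝ) →L[ℝ] F).contMDiff.contMDiffAt.comp x h₄
  refine h₅.congr_of_eventuallyEq (Filter.Eventually.of_forall fun y => ?_)
  exact (B.equivFun.symm_apply_apply _).symm

lemma GrMap.pull_res_apply (φ : GrMap I Unit M J 𝔥 N) {U V : Opens N} (h : V ≤ U) (w : Fun J 𝔥 U)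
    (x : M) (hx : φ.body x ∈ V) :
    (φ.pull V (Fun.res h w)).1 ⟨x, hx⟩ = (φ.pull U w).1 ⟨x, h hx⟩ := by
  rw [φ.pull_res h w]
  rfl

section DG

variable [Bracket 𝔥 𝔥] [FiniteDimensional ℝ 𝔥]

/-- The image of $df$ is a differential of the image $f\circ\varphi$ of $f$, and so is
$d(f\circ\varphi)$. Both are one-forms for reasons of degree, so uniqueness applies. -/
lemma GrMap.IsDG.pull_mfderiv {φ : GrMap I Unit M J 𝔥 N} (hφ : φ.IsDG) {U : Opens N} {f : N → ℝ}
    (hf : ContMDiffOn J 𝓘(ℝ, ℝ) ∞ f U) (x : M) (hx : φ.body x ∈ U) :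
    (φ.pull U (Fun.form 𝔥 (smoothForm_mfderiv hf))).1 ⟨x, hx⟩ = Fib.gen₁ Unit _
      (0, (mfderiv J 𝓘(ℝ, ℝ) f (φ.body x)).toLinearMap ∘ₗ
        (mfderiv I J φ.body x).toLinearMap) := by
  obtain ⟨V, hV, hxV, h⟩ := hφ U (Fun.fn 𝔥 hf) (Fun.form 𝔥 (smoothForm_mfderiv hf))
    (fun y hy => ⟨U, le_rfl, hy, HasD.fn f hf⟩) x hx
  have h' := HasD.fn (𝔤 := Unit) (V := V) (fun y => f (φ.body y))
    (hf.comp φ.contMDiff_body.contMDiffOn fun y hy => hV hy)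
  have h₁ : Fun.IsHomogeneous 1 (Fun.form 𝔥 (smoothForm_mfderiv hf)) := fun y => Fib.gen₁_mem_deg _
  have h₂ := φ.pull_homogeneous h₁ ⟨x, hx⟩
  have h₃ := h.unique_one h' hxV hxV (fun y hy _ => φ.pull_fn hf y (hV hy))
    (Fib.deg_unit_one.le h₂) (Fib.gen₁_mem_forms _)
  refine h₃.trans (congrArg (fun l => Fib.gen₁ Unit _ (0, l)) ?_)
  have := mfderiv_comp x ((hf.contMDiffAt (U.2.mem_nhds hx)).mdifferentiableAt (by simp))
    (φ.contMDiff_body.mdifferentiableAt (by simp) (x := x))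
  exact congrArg ContinuousLinearMap.toLinearMap this

/-- Locally a form is $\sum f_i\,dg_i$, and the images of $f_i$ and $dg_i$ are known. The dg
condition is essential: a mere graded morphism could act on one-forms in other ways. -/
lemma GrMap.IsDG.pull_form {φ : GrMap I Unit M J 𝔥 N} (hφ : φ.IsDG) {U : Opens N}
    {θ : ∀ x : N, Dual ℝ (TangentSpace J x)} (hθ : SmoothForm J θ U) (x : M) (hx : φ.body x ∈ U) :
    (φ.pull U (Fun.form 𝔥 hθ)).1 ⟨x, hx⟩ =
      Fib.gen₁ Unit _ (0, θ (φ.body x) ∘ₗ (mfderiv I J φ.body x).toLinearMap) := by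
  obtain ⟨V, hV, hxV, f, g, hf, hg, e⟩ := hθ.exists_sum hx
  refine (φ.pull_res_apply hV _ x hxV).symm.trans ?_
  have h₁ : Fun.res hV (Fun.form 𝔥 hθ) =
      ∑ i, Fun.fn 𝔥 (hf i) * Fun.form 𝔥 (smoothForm_mfderiv (hg i)) := by
    refine Subtype.ext ?_
    rw [AddSubmonoidClass.coe_finsetSum]
    funext y
    rw [Finset.sum_apply]
    refine (congrArg (fun l => Fib.gen₁ 𝔥 _ (0, l)) (e y y.2)).trans ?_
    refine (Fib.gen₁_sum_smul (fun i => f i y.1) _).trans (Finset.sum_congr rfl fun i _ => ?_)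
    exact Algebra.smul_def (A := Fib 𝔥 (TangentSpace J y.1)) _ _
  rw [h₁, map_sum, AddSubmonoidClass.coe_finsetSum, Finset.sum_apply]
  have h₂ : θ (φ.body x) ∘ₗ (mfderiv I J φ.body x).toLinearMap = ∑ i, f i (φ.body x) •
      ((mfderiv J 𝓘(ℝ, ℝ) (g i) (φ.body x)).toLinearMap ∘ₗ (mfderiv I J φ.body x).toLinearMap) := by
    rw [e _ hxV]
    exact sum_smul_comp _ _ _
  refine Eq.symm ((congrArg (fun l => Fib.gen₁ Unit _ (0, l)) h₂).trans
    ((Fib.gen₁_sum_smul (fun i => f i (φ.body x)) _).trans (Finset.sum_congr rfl fun i _ => ?_)))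
  refine (Algebra.smul_def (A := Fib Unit (TangentSpace I x)) _ _).trans ?_
  rw [map_mul]
  exact congrArg₂ (· * ·) (φ.pull_fn (hf i) x hxV).symm (hφ.pull_mfderiv (hg i) x hxV).symm

lemma GrMap.exists_pull_xi (φ : GrMap I Unit M J 𝔥 N) (μ : Dual ℝ 𝔥) (x : M) :
    ∃ l : Dual ℝ (TangentSpace I x),
      Fib.gen₁ Unit _ (0, l) = (φ.pull ⊤ (Fun.xi J ⊤ μ)).1 ⟨x, trivial⟩ := by
  have h₁ : Fun.IsHomogeneous 1 (Fun.xi J (⊤ : Opens N) μ) := fun y => Fib.gen₁_mem_deg _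
  exact Fib.deg_unit_one.le (φ.pull_homogeneous h₁ ⟨x, trivial⟩)

/-- The form with values in `𝔥` given by the images of the coordinates of degree one. -/
def GrMap.connForm (φ : GrMap I Unit M J 𝔥 N) (x : M) : TangentSpace I x →ₗ[ℝ] 𝔥 :=
  ∑ b, (φ.exists_pull_xi ((finBasis ℝ 𝔥).coord b) x).choose.smulRight (finBasis ℝ 𝔥 b)

/-- `connForm` is assembled from the images of the dual basis; linearity in `μ` extends the
description to all linear forms. -/
lemma GrMap.pull_xi (φ : GrMap I Unit M J 𝔥 N) (μ : Dual ℝ 𝔥) (x : M) :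
    (φ.pull ⊤ (Fun.xi J ⊤ μ)).1 ⟨x, trivial⟩ = Fib.gen₁ Unit _ (0, μ ∘ₗ φ.connForm x) := by
  have h₁ : μ ∘ₗ φ.connForm x = ∑ b, μ (finBasis ℝ 𝔥 b) •
      (φ.exists_pull_xi ((finBasis ℝ 𝔥).coord b) x).choose := by
    ext v
    simp [GrMap.connForm, LinearMap.sum_apply, mul_comm]
  have h₂ := map_eq_sum_coord (φ.pull ⊤) (Fun.xi J ⊤) μ
  refine (congrArg (fun z => z.1 ⟨x, trivial⟩) h₂).trans ?_
  refine Eq.trans ?_ ((Fib.gen₁_sum_smul (fun b => μ (finBasis ℝ 𝔥 b)) _).symm.trans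
    (congrArg (fun l => Fib.gen₁ Unit _ (0, l)) h₁.symm))
  rw [AddSubmonoidClass.coe_finsetSum, Finset.sum_apply]
  refine Finset.sum_congr rfl fun b _ => ?_
  exact congrArg (μ (finBasis ℝ 𝔥 b) • ·)
    (φ.exists_pull_xi ((finBasis ℝ 𝔥).coord b) x).choose_spec.symm

/-- The form of a morphism to `T[1]𝔥[1] × T[1]N`. -/
def GrMap.conn (φ : GrMap I Unit M J 𝔥 N) : Conn I M 𝔥 where
  form := φ.connForm
  smooth μ := Fun.smoothForm (φ.pull ⊤ (Fun.xi J ⊤ μ)) fun x => φ.pull_xi μ x.1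

variable (J) in
/-- The differentials of the coordinate functions of degree one. -/
def Fun.weil₁ (U : Opens N) (μ : Dual ℝ 𝔥) : Fun J 𝔥 U :=
  Fun.xibar J U μ + (-1 / 2 : ℝ) • bracketSum μ (Fun.xi J U) (Fun.xi J U)

lemma Fun.bracketSum_apply {U : Opens N} (μ : Dual ℝ 𝔥) (P Q : Dual ℝ 𝔥 → Fun J 𝔥 U) (y : U) :
    (bracketSum μ P Q).1 y = bracketSum μ (fun ν => (P ν).1 y) (fun ν => (Q ν).1 y) := by
  simp only [bracketSum, AddSubmonoidClass.coe_finsetSum, Finset.sum_apply]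
  rfl

lemma Fun.weil₁_apply (U : Opens N) (μ : Dual ℝ 𝔥) (y : U) :
    (Fun.weil₁ J U μ).1 y = Fib.weil₁ 𝔥 _ μ := by
  rw [Fib.weil₁_eq]
  refine congrArg (fun z => Fib.gen₂ 𝔥 (TangentSpace J y.1) μ + (-1 / 2 : ℝ) • z) ?_
  exact Fun.bracketSum_apply μ (Fun.xi J U) (Fun.xi J U) y

lemma Fun.isD_xi (U : Opens N) (μ : Dual ℝ 𝔥) : Fun.IsD (Fun.xi J U μ) (Fun.weil₁ J U μ) :=
  fun _ hy => ⟨U, le_rfl, hy, (HasD.xi μ).congr rfl (funext fun z => Fun.weil₁_apply U μ z)⟩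

/-- The image of $d\xi$ is a differential of the image of $\xi$ and has degree two, so it is the
exterior derivative by `extDer_eq`. -/
lemma GrMap.IsDG.pull_weil₁ {φ : GrMap I Unit M J 𝔥 N} (hφ : φ.IsDG) (μ : Dual ℝ 𝔥) (x : M) :
    (φ.pull ⊤ (Fun.weil₁ J ⊤ μ)).1 ⟨x, trivial⟩ =
      extDer Unit (fun y => μ ∘ₗ φ.connForm y) x := by
  obtain ⟨V, hV, hxV, h⟩ := hφ ⊤ _ _ (Fun.isD_xi ⊤ μ) x trivial
  have h₁ : Fun.IsHomogeneous 2 (Fun.weil₁ J (⊤ : Opens N) μ) := fun y => by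
    rw [Fun.weil₁_apply, Fib.weil₁_eq]
    exact add_mem (Fib.gen₂_mem_deg μ) (Submodule.smul_mem _ _ (Submodule.sum_mem _ fun _ _ =>
      Submodule.sum_mem _ fun _ _ => Submodule.smul_mem _ _ (Fib.gen₁_mul_gen₁_mem_deg _ _)))
  refine (extDer_eq (h.congr (funext fun y => ?_) rfl) hxV
    (Fib.deg_unit_two.le (φ.pull_homogeneous h₁ ⟨x, trivial⟩))).symm
  exact (φ.pull_xi μ y.1).symm

/-- Since $\bar\xi=d\xi+\tfrac12[\xi,\xi]$, its image is determined by those of $\xi$ and $d\xi$: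
the coordinates of degree two carry no further data. -/
lemma GrMap.IsDG.pull_xibar {φ : GrMap I Unit M J 𝔥 N} (hφ : φ.IsDG) (μ : Dual ℝ 𝔥) (x : M) :
    (φ.pull ⊤ (Fun.xibar J ⊤ μ)).1 ⟨x, trivial⟩ = φ.conn.curv x μ := by
  have h₁ : Fun.xibar J (⊤ : Opens N) μ = Fun.weil₁ J ⊤ μ +
      (1 / 2 : ℝ) • bracketSum μ (Fun.xi J ⊤) (Fun.xi J ⊤) := by
    rw [Fun.weil₁, add_assoc, ← add_smul]
    norm_num
  have h₂ : φ.pull ⊤ (Fun.xibar J ⊤ μ) = φ.pull ⊤ (Fun.weil₁ J ⊤ μ) + (1 / 2 : ℝ) •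
      bracketSum μ (fun ν => φ.pull ⊤ (Fun.xi J ⊤ ν)) (fun ν => φ.pull ⊤ (Fun.xi J ⊤ ν)) := by
    exact (congrArg (φ.pull ⊤) h₁).trans (map_add_smul_bracketSum (φ.pull ⊤) _ _ _ _ _)
  refine (congrArg (fun z => z.1 ⟨x, trivial⟩) h₂).trans ?_
  refine congrArg₂ (fun a b => a + (1 / 2 : ℝ) • b) (hφ.pull_weil₁ μ x) ?_
  refine Eq.trans ?_ (congrArg (fun P => bracketSum μ P P)
    (funext fun ν => φ.pull_xi ν x : (fun ν => (φ.pull ⊤ (Fun.xi J ⊤ ν)).1 ⟨x, trivial⟩) = _))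
  simp only [bracketSum, AddSubmonoidClass.coe_finsetSum, Finset.sum_apply]
  rfl

lemma GrMap.IsDG.pull_apply {φ : GrMap I Unit M J 𝔥 N} (hφ : φ.IsDG) {U : Opens N} (w : Fun J 𝔥 U)
    (x : M) (hx : φ.body x ∈ U) :
    (φ.pull U w).1 ⟨x, hx⟩ = φ.conn.hom φ.body x (w.1 ⟨φ.body x, hx⟩) := by
  obtain ⟨V, hV, hxV, hw⟩ := w.2 _ hx
  -- After restriction to a smaller set the function is a polynomial in generators. The membership
  -- proof is part of the induction because `pull` accepts only elements of the algebra of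
  -- functions.
  suffices key : ∀ (w : Raw J 𝔥 V) (_ : w ∈ Algebra.adjoin ℝ {w | IsGen V w}),
      ∃ hw : w ∈ Fun J 𝔥 V,
        (φ.pull V ⟨w, hw⟩).1 ⟨x, hxV⟩ = φ.conn.hom φ.body x (w ⟨φ.body x, hxV⟩) by
    obtain ⟨hw', h⟩ := key _ hw
    exact (φ.pull_res_apply hV w x hxV).symm.trans h
  intro w hw
  induction hw using Algebra.adjoin_induction with
  | mem w hw =>
    refine ⟨hw.mem, ?_⟩
    cases hw with
    | fn f hf => exact (φ.pull_fn hf x hxV).trans (AlgHom.commutes (φ.conn.hom φ.body x) _).symm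
    | form θ hθ => exact (hφ.pull_form hθ x hxV).trans (φ.conn.hom_form φ.body x _).symm
    | xi μ =>
      refine (φ.pull_res_apply (le_top : V ≤ ⊤) (Fun.xi J ⊤ μ) x hxV).trans ?_
      exact (φ.pull_xi μ x).trans (φ.conn.hom_gen₁ φ.body x μ).symm
    | xibar μ =>
      refine (φ.pull_res_apply (le_top : V ≤ ⊤) (Fun.xibar J ⊤ μ) x hxV).trans ?_
      exact (hφ.pull_xibar μ x).trans (φ.conn.hom_gen₂ φ.body x μ).symm
  | algebraMap r =>
    refine ⟨Subalgebra.algebraMap_mem _ r, ?_⟩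
    refine Eq.trans ?_ (AlgHom.commutes (φ.conn.hom φ.body x) r).symm
    exact congrArg (fun z => z.1 ⟨x, hxV⟩) (AlgHom.commutes (φ.pull V) r)
  | add w w' _ _ h h' =>
    obtain ⟨hw, e⟩ := h
    obtain ⟨hw', e'⟩ := h'
    refine ⟨add_mem hw hw', ?_⟩
    refine (congrArg (fun z => z.1 ⟨x, hxV⟩) (map_add (φ.pull V) ⟨w, hw⟩ ⟨w', hw'⟩)).trans ?_
    exact (congrArg₂ (· + ·) e e').trans (map_add (φ.conn.hom φ.body x) _ _).symm
  | mul w w' _ _ h h' =>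
    obtain ⟨hw, e⟩ := h
    obtain ⟨hw', e'⟩ := h'
    refine ⟨mul_mem hw hw', ?_⟩
    refine (congrArg (fun z => z.1 ⟨x, hxV⟩) (map_mul (φ.pull V) ⟨w, hw⟩ ⟨w', hw'⟩)).trans ?_
    exact (congrArg₂ (· * ·) e e').trans (map_mul (φ.conn.hom φ.body x) _ _).symm

/-- Morphisms of dg-manifolds from `T[1]M` are given by a map and a form. -/
theorem GrMap.IsDG.eq_ofConn {φ : GrMap I Unit M J 𝔥 N} (hφ : φ.IsDG) :
    φ = GrMap.ofConn φ.body φ.contMDiff_body φ.conn :=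
  GrMap.ext rfl (heq_of_eq (funext fun _ => AlgHom.ext fun w => Subtype.ext (funext fun x =>
    hφ.pull_apply w x.1 x.2)))

end DG

end Classification

/-! ### Exterior derivatives evaluated on vectors -/

section Cartan

set_option linter.unusedSectionVars false

open Filter Topology

variable {E H : Type*} [NormedAddCommGroup E] [NormedSpace ℝ E] [FiniteDimensional ℝ E]
  [TopologicalSpace H] {I : ModelWithCorners ℝ E H} [I.Boundaryless]
  {M : Type*} [TopologicalSpace M] [ChartedSpace H M] [IsManifold I ∞ M]
  {E' H' : Type*} [NormedAddCommGroup E'] [NormedSpace ℝ E'] [FiniteDimensional ℝ E']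
  [TopologicalSpace H'] {I' : ModelWithCorners ℝ E' H'} [I'.Boundaryless]
  {N : Type*} [TopologicalSpace N] [ChartedSpace H' N] [IsManifold I' ∞ N]
  {F : Type*} [NormedAddCommGroup F] [NormedSpace ℝ F]

/-- The value of the exterior derivative of a one-form on two vectors. -/
def dForm (θ : ∀ x : M, Dual ℝ (TangentSpace I x)) (x : M) (u v : TangentSpace I x) : ℝ :=
  (Fib.ev u v (extDer Unit θ x)).d

lemma isComponents_gen₁ (θ : ∀ x : M, Dual ℝ (TangentSpace I x)) (V : Opens M) (ψ : F → M) (u v : F)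
    (z : F) : IsComponents (V := V) ψ u v z (fun y => Fib.gen₁ Unit _ (0, θ y)) (fun _ => 0)
      (fun y => θ (ψ y) (mfderiv 𝓘(ℝ, F) I ψ y u)) (fun y => θ (ψ y) (mfderiv 𝓘(ℝ, F) I ψ y v)) :=
  Eventually.of_forall fun y hy => by
    rw [evAlong, Fib.ev_gen₁]
    exact ⟨rfl, rfl, rfl⟩

/-- The exterior derivative of a one-form in coordinates. -/
lemma dForm_eq {θ : ∀ x : M, Dual ℝ (TangentSpace I x)} (hθ : SmoothForm I θ Set.univ) {ψ : F → M}
    {z : F} (hψ : ContMDiffAt 𝓘(ℝ, F) I ∞ ψ z) (u v : F) :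
    dForm θ (ψ z) (mfderiv 𝓘(ℝ, F) I ψ z u) (mfderiv 𝓘(ℝ, F) I ψ z v) =
      fderiv ℝ (fun y => θ (ψ y) (mfderiv 𝓘(ℝ, F) I ψ y v)) z u -
        fderiv ℝ (fun y => θ (ψ y) (mfderiv 𝓘(ℝ, F) I ψ y u)) z v := by
  obtain ⟨V, _, hx, h, -⟩ := SmoothForm.exists_hasD_extDer (𝔤 := Unit) (V := ⊤) hθ
    (x := ψ z) trivial
  exact (h.ev_eq hψ u v hx (isComponents_gen₁ θ V ψ u v z)).2

/-- `HasD.components` supplies a component function which is differentiable at the point and agrees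
with this one nearby. -/
lemma differentiableAt_form {θ : ∀ x : M, Dual ℝ (TangentSpace I x)}
    (hθ : SmoothForm I θ Set.univ) {ψ : F → M} {z : F} (hψ : ContMDiffAt 𝓘(ℝ, F) I ∞ ψ z) (u : F) :
    DifferentiableAt ℝ (fun y => θ (ψ y) (mfderiv 𝓘(ℝ, F) I ψ y u)) z := by
  obtain ⟨V, _, hx, h, -⟩ := SmoothForm.exists_hasD_extDer (𝔤 := Unit) (V := ⊤) hθ
    (x := ψ z) trivial
  obtain ⟨a, b, c, -, hb, -, hw, -⟩ := h.components hψ u u hx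
  refine hb.congr_of_eventuallyEq ?_
  filter_upwards [hw, isComponents_gen₁ θ V ψ u u z,
    hψ.continuousAt.eventually (V.2.mem_nhds hx)] with y h₁ h₂ hy
  exact (h₂ hy).2.1.symm.trans (h₁ hy).2.1

lemma eventually_mdifferentiableAt {ψ : F → M} {z : F} (hψ : ContMDiffAt 𝓘(ℝ, F) I ∞ ψ z) :
    ∀ᶠ y in 𝓝 z, MDifferentiableAt 𝓘(ℝ, F) I ψ y := by
  have h₁ : ContMDiffAt 𝓘(ℝ, F) I 1 ψ z := hψ.of_le (by norm_cast)
  filter_upwards [(contMDiffAt_iff_contMDiffAt_nhds (by simp)).1 h₁] with y hy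
  exact ContMDiffAt.mdifferentiableAt hy (by simp)

lemma SmoothForm.pullback {θ : ∀ x : N, Dual ℝ (TangentSpace I' x)}
    (hθ : SmoothForm I' θ Set.univ) {h : M → N} (hh : ContMDiff I I' ∞ h) :
    SmoothForm I (fun x => θ (h x) ∘ₗ (mfderiv I I' h x).toLinearMap) Set.univ :=
  ContMDiffOn.comp hθ (hh.contMDiff_tangentMap (m := ∞) le_rfl).contMDiffOn fun _ _ => trivial

/-- The exterior derivative is compatible with pull-backs. -/
lemma dForm_pullback {θ : ∀ x : N, Dual ℝ (TangentSpace I' x)} (hθ : SmoothForm I' θ Set.univ)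
    {h : M → N} (hh : ContMDiff I I' ∞ h) (x : M) (u v : TangentSpace I x) :
    dForm (fun x => θ (h x) ∘ₗ (mfderiv I I' h x).toLinearMap) x u v =
      dForm θ (h x) (mfderiv I I' h x u) (mfderiv I I' h x v) := by
  obtain ⟨ψ, z, rfl, hψ, hs⟩ := exists_parametrization (I := I) x
  obtain ⟨u, rfl⟩ := hs u
  obtain ⟨v, rfl⟩ := hs v
  -- A parametrisation of $M$ followed by $h$ need not be a parametrisation of $N$. `dForm_eq` holds
  -- along any smooth map from a vector space, so both sides become the same difference of
  -- derivatives.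
  have h₁ : ∀ᶠ y in 𝓝 z, ∀ w : E, (mfderiv 𝓘(ℝ, E) I' (fun y => h (ψ y)) y w : E') =
      mfderiv I I' h (ψ y) (mfderiv 𝓘(ℝ, E) I ψ y w) := by
    filter_upwards [eventually_mdifferentiableAt hψ] with y hy w
    exact DFunLike.congr_fun (mfderiv_comp y (hh.mdifferentiableAt (by simp)) hy) w
  have h₂ := dForm_eq hθ (hh.contMDiffAt.comp z hψ) u v
  have h₃ : ∀ w : E, (fun y => θ (h (ψ y)) (mfderiv 𝓘(ℝ, E) I' (fun y => h (ψ y)) y w)) =ᶠ[𝓝 z]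
      fun y => θ (h (ψ y)) (mfderiv I I' h (ψ y) (mfderiv 𝓘(ℝ, E) I ψ y w)) := by
    intro w
    filter_upwards [h₁] with y hy
    exact congrArg (θ (h (ψ y))) (hy w)
  refine (dForm_eq (hθ.pullback hh) hψ u v).trans ?_
  refine (congrArg₂ (fun a b : E →L[ℝ] ℝ => a u - b v) (h₃ v).fderiv_eq (h₃ u).fderiv_eq).symm.trans ?_
  refine h₂.symm.trans ?_
  exact congrArg₂ (dForm θ (h (ψ z))) (h₁.self_of_nhds u) (h₁.self_of_nhds v)

variable (I) in
/-- The differential of a function, as a one-form. -/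
def diff (f : M → ℝ) (x : M) : Dual ℝ (TangentSpace I x) :=
  (mfderiv I 𝓘(ℝ, ℝ) f x).toLinearMap

lemma diff_comp {ψ : F → M} {f : M → ℝ} {z : F} (hf : MDifferentiableAt I 𝓘(ℝ, ℝ) f (ψ z))
    (hψ : MDifferentiableAt 𝓘(ℝ, F) I ψ z) (u : F) :
    diff I f (ψ z) (mfderiv 𝓘(ℝ, F) I ψ z u) = fderiv ℝ (fun z => f (ψ z)) z u :=
  mfderiv_comp_eq_fderiv hf hψ u

/-- The Leibniz rule for combinations of one-forms. -/
lemma dForm_sum_smul {ι : Type*} [Fintype ι] {f : ι → M → ℝ}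
    {θ : ι → ∀ x : M, Dual ℝ (TangentSpace I x)} (hf : ∀ i, ContMDiff I 𝓘(ℝ, ℝ) ∞ (f i))
    (hθ : ∀ i, SmoothForm I (θ i) Set.univ)
    (hs : SmoothForm I (fun x => ∑ i, f i x • θ i x) Set.univ) (x : M) (u v : TangentSpace I x) :
    dForm (fun x => ∑ i, f i x • θ i x) x u v = ∑ i, (f i x * dForm (θ i) x u v +
      (diff I (f i) x u * θ i x v -
        diff I (f i) x v * θ i x u)) := by
  obtain ⟨ψ, z, rfl, hψ, h⟩ := exists_parametrization (I := I) x
  obtain ⟨u, rfl⟩ := h u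
  obtain ⟨v, rfl⟩ := h v
  have h₁ : ∀ w w' : E, fderiv ℝ (fun y => (∑ i, f i (ψ y) • θ i (ψ y))
      (mfderiv 𝓘(ℝ, E) I ψ y w)) z w' = ∑ i, (f i (ψ z) *
        fderiv ℝ (fun y => θ i (ψ y) (mfderiv 𝓘(ℝ, E) I ψ y w)) z w' +
        diff I (f i) (ψ z) (mfderiv 𝓘(ℝ, E) I ψ z w') *
          θ i (ψ z) (mfderiv 𝓘(ℝ, E) I ψ z w)) := by
    intro w w'
    have h₂ : (fun y => (∑ i, f i (ψ y) • θ i (ψ y)) (mfderiv 𝓘(ℝ, E) I ψ y w)) =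
        fun y => ∑ i, f i (ψ y) * θ i (ψ y) (mfderiv 𝓘(ℝ, E) I ψ y w) := by
      funext y
      exact LinearMap.sum_apply _ _ _
    have h₃ : ∀ i, DifferentiableAt ℝ (fun y => f i (ψ y)) z := fun i =>
      (((hf i).contMDiffAt.comp z hψ).contDiffAt).differentiableAt (by simp)
    rw [h₂, fderiv_fun_sum fun i _ => (h₃ i).fun_mul (differentiableAt_form (hθ i) hψ w),
      _root_.sum_apply]
    refine Finset.sum_congr rfl fun i _ => ?_
    rw [fderiv_fun_mul (h₃ i) (differentiableAt_form (hθ i) hψ w), diff_comp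
      ((hf i).mdifferentiableAt (by simp)) (hψ.mdifferentiableAt (by simp))]
    simp only [_root_.add_apply, _root_.smul_apply, smul_eq_mul]
    rw [mul_comm (fderiv ℝ _ z w')]
  refine (dForm_eq hs hψ u v).trans ?_
  refine (congrArg₂ (· - ·) (h₁ v u) (h₁ u v)).trans ?_
  rw [← Finset.sum_sub_distrib]
  refine Finset.sum_congr rfl fun i _ => ?_
  have h₄ : ∀ p a b c d : ℝ, p * a + c - (p * b + d) = p * (a - b) + (c - d) := by
    intro p a b c d
    ring
  exact (h₄ _ _ _ _ _).trans (congrArg (f i (ψ z) * · + _) (dForm_eq (hθ i) hψ u v).symm)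

lemma dForm_add {θ ζ : ∀ x : M, Dual ℝ (TangentSpace I x)} (hθ : SmoothForm I θ Set.univ)
    (hζ : SmoothForm I ζ Set.univ) (x : M) (u v : TangentSpace I x) :
    dForm (fun x => θ x + ζ x) x u v = dForm θ x u v + dForm ζ x u v := by
  have h : extDer Unit (fun y => θ y + ζ y) x = extDer Unit θ x + extDer Unit ζ x :=
    extDer_add hθ hζ x
  rw [dForm, h, map_add]
  rfl

/-- A product rule. The family `k` is only assumed differentiable on each fixed vector, so the
vector field is expanded in a basis first. -/
lemma fderiv_pairing {k : E → E →ₗ[ℝ] ℝ} {z : E}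
    (hk : ∀ e, DifferentiableAt ℝ (fun y => k y e) z) {X : E → E} (hX : DifferentiableAt ℝ X z)
    (a : E) : fderiv ℝ (fun y => k y (X y)) z a =
      k z (fderiv ℝ X z a) + fderiv ℝ (fun y => k y (X z)) z a := by
  let B := finBasis ℝ E
  let B' := fun i => LinearMap.toContinuousLinearMap (B.coord i)
  have h₁ : ∀ (y : E) (e : E), k y e = ∑ i, B' i e * k y (B i) := by
    intro y e
    conv_lhs => rw [← B.sum_repr e]
    simp only [map_sum, map_smul, smul_eq_mul]
    rfl
  have h₂ : ∀ i, DifferentiableAt ℝ (fun y => B' i (X y)) z := fun i =>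
    (B' i).differentiableAt.comp z hX
  have h₃ : ∀ i, fderiv ℝ (fun y => B' i (X y)) z a = B' i (fderiv ℝ X z a) := fun i => by
    have := fderiv_comp z (B' i).differentiableAt hX
    rw [ContinuousLinearMap.fderiv] at this
    exact DFunLike.congr_fun this a
  have h₄ : fderiv ℝ (fun y => k y (X y)) z a = ∑ i, (B' i (X z) * fderiv ℝ (fun y => k y (B i)) z a +
      k z (B i) * B' i (fderiv ℝ X z a)) := by
    rw [show (fun y => k y (X y)) = fun y => ∑ i, B' i (X y) * k y (B i) from
      funext fun y => h₁ y (X y), fderiv_fun_sum fun i _ => (h₂ i).fun_mul (hk _),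
      _root_.sum_apply]
    refine Finset.sum_congr rfl fun i _ => ?_
    rw [fderiv_fun_mul (h₂ i) (hk _), _root_.add_apply, _root_.smul_apply, _root_.smul_apply, h₃]
    rfl
  have h₅ : fderiv ℝ (fun y => k y (X z)) z a =
      ∑ i, B' i (X z) * fderiv ℝ (fun y => k y (B i)) z a := by
    rw [show (fun y => k y (X z)) = fun y => ∑ i, B' i (X z) * k y (B i) from
      funext fun y => h₁ y (X z), fderiv_fun_sum fun i _ => (hk _).const_mul _,
      _root_.sum_apply]
    refine Finset.sum_congr rfl fun i _ => ?_
    rw [fderiv_const_mul (hk _)]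
    rfl
  rw [h₄, h₅, h₁ z (fderiv ℝ X z a), ← Finset.sum_add_distrib]
  refine Finset.sum_congr rfl fun i _ => ?_
  ring

end Cartan

/-! ### The Maurer–Cartan equation at the unit -/

section MaurerCartan

set_option linter.unusedSectionVars false

open Filter Topology

variable {E H : Type*} [NormedAddCommGroup E] [NormedSpace ℝ E] [FiniteDimensional ℝ E]
  [TopologicalSpace H] {I : ModelWithCorners ℝ E H} [I.Boundaryless]
  {M : Type*} [TopologicalSpace M] [ChartedSpace H M] [IsManifold I ∞ M]
  {E' H' : Type*} [NormedAddCommGroup E'] [NormedSpace ℝ E'] [FiniteDimensional ℝ E']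
  [TopologicalSpace H'] {I' : ModelWithCorners ℝ E' H'} [I'.Boundaryless]
  {N : Type*} [TopologicalSpace N] [ChartedSpace H' N] [IsManifold I' ∞ N]
  {EG HG : Type*} [NormedAddCommGroup EG] [NormedSpace ℝ EG] [FiniteDimensional ℝ EG]
  [TopologicalSpace HG] {IG : ModelWithCorners ℝ EG HG} [IG.Boundaryless]
  {G : Type*} [Group G] [TopologicalSpace G] [ChartedSpace HG G] [LieGroup IG ∞ G]

/-- Left invariance: the constant cancels in $(gu(x))^{-1}gu(y)$. -/
lemma mc_mul_left (g : G) (u : M → G) : mc IG I (fun y => g * u y) = mc IG I u := by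
  funext x
  unfold mc
  have : (fun y => (g * u x)⁻¹ * (g * u y)) = fun y => (u x)⁻¹ * u y := by
    funext y
    group
  rw [this]

lemma mdifferentiableAt_mul_left (g x : G) : MDifferentiableAt IG IG (fun y => g * y) x :=
  (contMDiff_mul_left (I := IG) (n := ∞) (a := g)).mdifferentiableAt (by simp)

lemma mc_comp {u : N → G} (hu : ContMDiff I' IG ∞ u) {h : M → N} (hh : ContMDiff I I' ∞ h) (x : M) :
    mc IG I (fun y => u (h y)) x = mc IG I' u (h x) ∘ₗ (mfderiv I I' h x).toLinearMap := by
  have h₁ : MDifferentiableAt I' IG (fun y => (u (h x))⁻¹ * u y) (h x) :=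
    (contMDiff_mul_left.comp hu).mdifferentiableAt (by simp)
  have h₂ := mfderiv_comp x h₁ (hh.mdifferentiableAt (by simp))
  exact congrArg ContinuousLinearMap.toLinearMap h₂

lemma mc_id_one (v : EG) : (mc IG IG (fun g : G => g) 1 v : EG) = v := by
  have : (fun y : G => (1 : G)⁻¹ * y) = id := by
    funext y
    simp
  have h : mfderiv IG IG (fun y : G => (1 : G)⁻¹ * y) 1 = mfderiv IG IG id (1 : G) := by rw [this]
  exact (DFunLike.congr_fun h v).trans (DFunLike.congr_fun (mfderiv_id (I := IG) (x := (1 : G))) v)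

lemma mc_id_mulInvariantVectorField (v : GroupLieAlgebra IG G) (g : G) :
    mc IG IG (fun g : G => g) g (mulInvariantVectorField v g) = v := by
  have h₁ := mfderiv_comp_of_eq (x := (1 : G)) (mdifferentiableAt_mul_left (IG := IG) g⁻¹ g)
    (mdifferentiableAt_mul_left g 1) (mul_one g)
  have h₂ : (fun y : G => g⁻¹ * y) ∘ (fun y => g * y) = id := by
    funext y
    simp
  rw [h₂] at h₁
  have h₃ : ∀ g' : G, g' = g → ∀ w : EG, (mfderiv IG IG (fun y => g⁻¹ * y) g' w : EG) =
      mfderiv IG IG (fun y => g⁻¹ * y) g w := by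
    rintro _ rfl _
    rfl
  exact (h₃ _ (mul_one g) _).symm.trans <| (DFunLike.congr_fun h₁ v).symm.trans
    (DFunLike.congr_fun (mfderiv_id (I := IG) (x := (1 : G))) v)

lemma mulInvariantVectorField_one (v : EG) :
    (mulInvariantVectorField (I := IG) (G := G) v 1 : EG) = v := by
  have : (fun y : G => (1 : G) * y) = id := by
    funext y
    simp
  have h : mfderiv IG IG (fun y : G => (1 : G) * y) 1 = mfderiv IG IG id (1 : G) := by rw [this]
  exact (DFunLike.congr_fun h v).trans (DFunLike.congr_fun (mfderiv_id (I := IG) (x := (1 : G))) v)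

variable (IG G) in
lemma lieGroup_minSmoothness : LieGroup IG (minSmoothness ℝ 3) G :=
  LieGroup.of_le (n := ∞) (by simp; norm_cast)

instance : IsLieBracket (GroupLieAlgebra IG G) := by
  have := lieGroup_minSmoothness IG G
  have : CompleteSpace EG := FiniteDimensional.complete ℝ EG
  exact
    { add_lie := fun x y z => add_lie x y z
      lie_smul := fun r x y => LieAlgebra.lie_smul r x y
      lie_skew := fun x y => (lie_skew x y).symm
      jacobi := fun x y z => lie_jacobi x y z }

lemma smoothForm_mc' {u : M → G} (hu : ContMDiff I IG ∞ u) (μ : Dual ℝ (GroupLieAlgebra IG G)) :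
    SmoothForm I (fun x => μ ∘ₗ mc IG I u x) Set.univ :=
  (smoothForm_mc hu μ).contMDiffOn

/-- The equation of Maurer and Cartan, at the unit. -/
lemma dForm_mc_id (μ : Dual ℝ (GroupLieAlgebra IG G)) (v w : GroupLieAlgebra IG G) :
    dForm (fun g => μ ∘ₗ mc IG IG (fun g : G => g) g) (1 : G) v w = -μ ⁅v, w⁆ := by
  have := lieGroup_minSmoothness IG G
  have : CompleteSpace EG := FiniteDimensional.complete ℝ EG
  have : IsManifold IG 2 G := IsManifold.of_le (n := ∞) (by norm_cast)
  set z : EG := extChartAt IG (1 : G) 1 with hz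
  set ψ : EG → G := ⇑(extChartAt IG (1 : G)).symm with hψdef
  have hz1 : ψ z = 1 := extChartAt_to_inv (I := IG) (1 : G)
  have hψ : ContMDiffAt 𝓘(ℝ, EG) IG ∞ ψ z := contMDiffAt_chart_symm (mem_extChartAt_target _)
  -- The left-invariant vector fields read in the chart at the unit; the bracket of the Lie algebra
  -- is defined through them.
  let X : GroupLieAlgebra IG G → EG → EG := fun v =>
    VectorField.mpullbackWithin 𝓘(ℝ, EG) IG ψ (mulInvariantVectorField v) (Set.range IG)
  have hX : ∀ v, DifferentiableAt ℝ (X v) z := by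
    intro v
    have h : DifferentiableWithinAt ℝ (X v) ((extChartAt IG (1 : G)).symm ⁻¹' Set.univ ∩ Set.range IG)
        z := MDifferentiableWithinAt.differentiableWithinAt_mpullbackWithin_vectorField
      (mdifferentiableAt_mulInvariantVectorField (I := IG) (G := G) v
        (g := 1)).mdifferentiableWithinAt
    rwa [IG.range_eq_univ, Set.preimage_univ, Set.univ_inter, differentiableWithinAt_univ] at h
  have hψX : ∀ v, ∀ y ∈ (extChartAt IG (1 : G)).target,
      (mfderiv 𝓘(ℝ, EG) IG ψ y (X v y) : EG) = mulInvariantVectorField v (ψ y) := by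
    intro v y hy
    have h := isInvertible_mfderivWithin_extChartAt_symm (I := IG) hy
    have h₂ := h.self_apply_inverse (mulInvariantVectorField v (ψ y))
    have h₃ : mfderivWithin 𝓘(ℝ, EG) IG ψ (Set.range IG) y = mfderiv 𝓘(ℝ, EG) IG ψ y := by
      rw [IG.range_eq_univ, mfderivWithin_univ]
    exact (DFunLike.congr_fun h₃ _).symm.trans h₂
  have hθ := smoothForm_mc' (IG := IG) (u := fun g : G => g) contMDiff_id μ
  let k : EG → EG →ₗ[ℝ] ℝ := fun y =>
    (μ ∘ₗ mc IG IG (fun g : G => g) (ψ y)) ∘ₗ (mfderiv 𝓘(ℝ, EG) IG ψ y).toLinearMap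
  -- The Maurer–Cartan form is constant on left-invariant fields. By the product rule, the
  -- derivative of the form on a frozen vector is therefore minus the form on the derivative of the
  -- field.
  have hkX : ∀ v, (fun y => k y (X v y)) =ᶠ[𝓝 z] fun _ => μ v := by
    intro v
    filter_upwards [extChartAt_target_mem_nhds (I := IG) (1 : G)] with y hy
    exact (congrArg (fun e : EG => μ (mc IG IG (fun g : G => g) (ψ y) e)) (hψX v y hy)).trans
      (congrArg μ (mc_id_mulInvariantVectorField v (ψ y)))
  have key : ∀ (v : GroupLieAlgebra IG G) (a : EG),
      fderiv ℝ (fun y => k y (X v z)) z a = -k z (fderiv ℝ (X v) z a) := by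
    intro v a
    have h := fderiv_pairing (k := k) (fun e => differentiableAt_form hθ hψ e) (hX v) a
    rw [show fderiv ℝ (fun y => k y (X v y)) z = 0 by
      rw [(hkX v).fderiv_eq]; exact fderiv_const_apply _] at h
    exact eq_neg_of_add_eq_zero_right h.symm
  have hzX : ∀ v : EG, (mfderiv 𝓘(ℝ, EG) IG ψ z (X v z) : EG) = v := by
    intro v
    refine (hψX v z (mem_extChartAt_target _)).trans ?_
    have : ∀ g : G, g = 1 → (mulInvariantVectorField (I := IG) v g : EG) = v := by
      rintro _ rfl
      exact mulInvariantVectorField_one v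
    exact this _ hz1
  -- The bracket at the unit, written as $D X_w(X_v)-D X_v(X_w)$ in the chart.
  have hbr : (⁅v, w⁆ : GroupLieAlgebra IG G) =
      mfderiv 𝓘(ℝ, EG) IG ψ z (fderiv ℝ (X w) z (X v z) - fderiv ℝ (X v) z (X w z)) := by
    have h₁ := isInvertible_mfderiv_extChartAt (I := IG) (mem_extChartAt_source (I := IG) (1 : G))
    have h₂ : VectorField.lieBracketWithin ℝ (X v) (X w)
        ((extChartAt IG (1 : G)).symm ⁻¹' Set.univ ∩ Set.range IG) z =
        fderiv ℝ (X w) z (X v z) - fderiv ℝ (X v) z (X w z) := by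
      rw [IG.range_eq_univ, Set.preimage_univ, Set.univ_inter, VectorField.lieBracketWithin_univ]
      rfl
    have h₃ : ∀ g : G, g = 1 → ∀ a : EG, (mfderiv IG 𝓘(ℝ, EG) (extChartAt IG (1 : G)) g a : EG) =
        mfderiv IG 𝓘(ℝ, EG) (extChartAt IG (1 : G)) 1 a := by
      rintro _ rfl _
      rfl
    refine h₁.inverse_apply_eq.2 (h₂.trans ?_)
    refine (mfderiv_chart_comp_symm (I := IG) (mem_extChartAt_target (1 : G)) _).symm.trans ?_
    exact h₃ _ hz1 _
  -- The chart returns to the unit only up to a propositional equality, so base points are replaced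
  -- while vectors stay fixed in the model space.
  have hpt : ∀ g : G, g = 1 → ∀ a b : EG,
      dForm (fun g => μ ∘ₗ mc IG IG (fun g : G => g) g) g a b =
        dForm (fun g => μ ∘ₗ mc IG IG (fun g : G => g) g) (1 : G) a b := by
    rintro _ rfl _ _
    rfl
  have hmc : ∀ g : G, g = 1 → ∀ a : EG, (mc IG IG (fun g : G => g) g a : EG) = a := by
    rintro _ rfl a
    exact mc_id_one a
  refine (hpt _ hz1 v w).symm.trans ?_
  refine (congrArg₂ (dForm (fun g => μ ∘ₗ mc IG IG (fun g : G => g) g) (ψ z)) (hzX v)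
    (hzX w)).symm.trans ?_
  refine (dForm_eq hθ hψ (X v z) (X w z)).trans ?_
  refine (congrArg₂ (· - ·) (key w (X v z)) (key v (X w z))).trans ?_
  rw [sub_neg_eq_add, neg_add_eq_sub, ← neg_sub, ← map_sub]
  refine congrArg Neg.neg ?_
  refine congrArg μ ((hmc _ hz1 _).trans hbr.symm)

end MaurerCartan

/-! ### Maurer–Cartan for maps into the group, and the derivative of the adjoint action -/

section Adjoint

set_option linter.unusedSectionVars false

open Filter Topology

variable {E H : Type*} [NormedAddCommGroup E] [NormedSpace ℝ E] [FiniteDimensional ℝ E]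
  [TopologicalSpace H] {I : ModelWithCorners ℝ E H} [I.Boundaryless]
  {M : Type*} [TopologicalSpace M] [ChartedSpace H M] [IsManifold I ∞ M]
  {EG HG : Type*} [NormedAddCommGroup EG] [NormedSpace ℝ EG] [FiniteDimensional ℝ EG]
  [TopologicalSpace HG] {IG : ModelWithCorners ℝ EG HG} [IG.Boundaryless]
  {G : Type*} [Group G] [TopologicalSpace G] [ChartedSpace HG G] [LieGroup IG ∞ G]

/-- The equation of Maurer and Cartan. -/
lemma dForm_mc {u : M → G} (hu : ContMDiff I IG ∞ u) (μ : Dual ℝ (GroupLieAlgebra IG G)) (x : M)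
    (a b : TangentSpace I x) : dForm (fun x => μ ∘ₗ mc IG I u x) x a b =
      -μ ⁅mc IG I u x a, mc IG I u x b⁆ := by
  have hu' : ContMDiff I IG ∞ (fun y => (u x)⁻¹ * u y) := contMDiff_mul_left.comp hu
  -- By left invariance `u` may be replaced by $u(x)^{-1}u$, which maps `x` to the unit. Pulling
  -- back the equation at the unit then suffices.
  have h₁ : (fun y => μ ∘ₗ mc IG I u y) = fun y =>
      (μ ∘ₗ mc IG IG (fun g : G => g) ((u x)⁻¹ * u y)) ∘ₗ
        (mfderiv I IG (fun y => (u x)⁻¹ * u y) y).toLinearMap := by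
    funext y
    rw [← mc_mul_left (IG := IG) (I := I) (u x)⁻¹ u]
    exact congrArg (μ ∘ₗ ·) (mc_comp (u := fun g : G => g) contMDiff_id hu' y)
  have h₂ := dForm_pullback (smoothForm_mc' (IG := IG) (u := fun g : G => g) contMDiff_id μ) hu' x a b
  have h₃ : ∀ g : G, g = 1 → ∀ a b : GroupLieAlgebra IG G,
      dForm (fun g => μ ∘ₗ mc IG IG (fun g : G => g) g) g a b = -μ ⁅a, b⁆ := by
    rintro _ rfl a b
    exact dForm_mc_id μ a b
  rw [h₁]
  exact h₂.trans (h₃ _ (inv_mul_cancel _) _ _)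

lemma contMDiff_conj (g : G) : ContMDiff IG IG ∞ (fun h : G => g * h * g⁻¹) :=
  contMDiff_mul_right.comp contMDiff_mul_left

lemma mfderiv_conj_comp {u : M → G} (hu : ContMDiff I IG ∞ u) (g : G) (x : M)
    (a : TangentSpace I x) :
    (mfderiv I IG (fun y => g * ((u x)⁻¹ * u y) * g⁻¹) x a : EG) = Ad IG g (mc IG I u x a) := by
  have h₁ : MDifferentiableAt I IG (fun y => (u x)⁻¹ * u y) x :=
    (contMDiff_mul_left.comp hu).mdifferentiableAt (by simp)
  have h₂ := mfderiv_comp x ((contMDiff_conj (IG := IG) g).mdifferentiableAt (by simp)) h₁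
  have h₃ : ∀ h : G, h = 1 → ∀ b : EG, (mfderiv IG IG (fun h : G => g * h * g⁻¹) h b : EG) =
      mfderiv IG IG (fun h : G => g * h * g⁻¹) 1 b := by
    rintro _ rfl _
    rfl
  exact (DFunLike.congr_fun h₂ a).trans (h₃ _ (inv_mul_cancel _) _)

lemma mc_conj {u : M → G} (hu : ContMDiff I IG ∞ u) (g : G) (x : M) :
    mc IG I (fun y => g * u y * g⁻¹) x = Ad IG g ∘ₗ mc IG I u x := by
  ext a
  refine Eq.trans ?_ (mfderiv_conj_comp hu g x a)
  have : (fun y => (g * u x * g⁻¹)⁻¹ * (g * u y * g⁻¹)) =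
      fun y => g * ((u x)⁻¹ * u y) * g⁻¹ := by
    funext y
    group
  unfold mc
  rw [this]
  rfl

/-- The adjoint action is compatible with the bracket. -/
lemma dual_Ad_bracket (μ : Dual ℝ (GroupLieAlgebra IG G)) (g : G) (v w : GroupLieAlgebra IG G) :
    μ (Ad IG g ⁅v, w⁆) = μ ⁅Ad IG g v, Ad IG g w⁆ := by
  -- The form of the conjugation map is $\mathrm{Ad}_g$ applied to the Maurer–Cartan form. Its
  -- derivative is computed once from the map and once from this expression.
  have h₁ : (fun h => μ ∘ₗ mc IG IG (fun h : G => g * h * g⁻¹) h) =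
      fun h => (μ ∘ₗ Ad IG g) ∘ₗ mc IG IG (fun h : G => h) h := by
    funext h
    rw [mc_conj (u := fun h : G => h) contMDiff_id g h]
    rfl
  have h₂ := dForm_mc (contMDiff_conj (IG := IG) g) μ (1 : G) v w
  rw [h₁, dForm_mc_id] at h₂
  have h₃ : ∀ v : GroupLieAlgebra IG G, mc IG IG (fun h : G => g * h * g⁻¹) 1 v = Ad IG g v := by
    intro v
    rw [mc_conj (u := fun h : G => h) contMDiff_id g 1]
    exact congrArg (Ad IG g) (mc_id_one (EG := EG) v)
  rw [h₃, h₃] at h₂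
  exact neg_injective h₂

lemma contMDiff_mul_prod {u : M → G} (hu : ContMDiff I IG ∞ u) :
    ContMDiff (I.prod IG) IG ∞ (fun p : M × G => p.2 * u p.1) :=
  contMDiff_snd.mul (hu.comp contMDiff_fst)

/-- The product rule $(wu)^{-1}d(wu)=u^{-1}du+u^{-1}(w^{-1}dw)u$. It puts $\mathrm{Ad}_{u^{-1}}$
inside a Maurer–Cartan form, so that the equation for the latter differentiates the former. -/
lemma mc_mul_prod {u : M → G} (hu : ContMDiff I IG ∞ u) (x : M) (w : G) (a : E) (b : EG) :
    (mc IG (I.prod IG) (fun p : M × G => p.2 * u p.1) (x, w) (a, b) : EG) =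
      mc IG I u x a + Ad IG (u x)⁻¹ (mc IG IG (fun g : G => g) w b) := by
  have h₁ := mfderiv_prod_eq_add_apply (I := I) (I' := IG) (I'' := IG)
    (f := fun p : M × G => (w * u x)⁻¹ * (p.2 * u p.1)) (p := (x, w))
    (v := (show TangentSpace (I.prod IG) (x, w) from (a, b)))
    ((contMDiff_mul_left.comp (contMDiff_mul_prod hu)).mdifferentiableAt (by simp))
  refine h₁.trans (congrArg₂ (fun a b : EG => a + b) ?_ ?_)
  · have : (fun y => (w * u x)⁻¹ * (w * u y)) = fun y => (u x)⁻¹ * u y := by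
      funext y
      group
    have h₂ : mfderiv I IG (fun y => (w * u x)⁻¹ * (w * u y)) x =
        mfderiv I IG (fun y => (u x)⁻¹ * u y) x := by rw [this]
    exact DFunLike.congr_fun h₂ a
  · refine Eq.trans ?_ (mfderiv_conj_comp (u := fun g : G => g) contMDiff_id (u x)⁻¹ w b)
    have : (fun y => (w * u x)⁻¹ * (y * u x)) = fun y => (u x)⁻¹ * (w⁻¹ * y) * (u x)⁻¹⁻¹ := by
      funext y
      group
    have h₂ : mfderiv IG IG (fun y => (w * u x)⁻¹ * (y * u x)) w =
        mfderiv IG IG (fun y => (u x)⁻¹ * (w⁻¹ * y) * (u x)⁻¹⁻¹) w := by rw [this]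
    exact DFunLike.congr_fun h₂ b

variable {F F' : Type*} [NormedAddCommGroup F] [NormedSpace ℝ F] [NormedAddCommGroup F']
  [NormedSpace ℝ F']

lemma mfderiv_prodMap_apply {ψ : F → M} {ψ' : F' → G} {p : F × F'}
    (h : MDifferentiableAt 𝓘(ℝ, F) I ψ p.1) (h' : MDifferentiableAt 𝓘(ℝ, F') IG ψ' p.2)
    (a : F) (b : F') :
    (mfderiv 𝓘(ℝ, F × F') (I.prod IG) (fun p : F × F' => (ψ p.1, ψ' p.2)) p (a, b) : E × EG) =
      (mfderiv 𝓘(ℝ, F) I ψ p.1 a, mfderiv 𝓘(ℝ, F') IG ψ' p.2 b) := by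
  have h₁ : HasMFDerivAt 𝓘(ℝ, F × F') 𝓘(ℝ, F) (fun p : F × F' => p.1) p
      (ContinuousLinearMap.fst ℝ F F') := hasFDerivAt_fst.hasMFDerivAt
  have h₂ : HasMFDerivAt 𝓘(ℝ, F × F') 𝓘(ℝ, F') (fun p : F × F' => p.2) p
      (ContinuousLinearMap.snd ℝ F F') := hasFDerivAt_snd.hasMFDerivAt
  have h₃ := (HasMFDerivAt.comp p h.hasMFDerivAt h₁).prodMk (HasMFDerivAt.comp p h'.hasMFDerivAt h₂)
  exact DFunLike.congr_fun h₃.mfderiv (a, b)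

/-- The differential of the adjoint action. -/
lemma diff_dual_Ad {u : M → G} (hu : ContMDiff I IG ∞ u) (μ : Dual ℝ (GroupLieAlgebra IG G))
    (e : GroupLieAlgebra IG G) (x : M) (a : TangentSpace I x) :
    diff I (fun x => μ (Ad IG (u x)⁻¹ e)) x a = -μ ⁅mc IG I u x a, Ad IG (u x)⁻¹ e⁆ := by
  obtain ⟨ψ, z, rfl, hψ, hs⟩ := exists_parametrization (I := I) x
  obtain ⟨α, rfl⟩ := hs a
  obtain ⟨ψ', z', hz', hψ', hs'⟩ := exists_parametrization (I := IG) (1 : G)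
  obtain ⟨ε, hε⟩ : ∃ ε : EG, (mfderiv 𝓘(ℝ, EG) IG ψ' z' ε : EG) = e := hs' e
  have hΨ : ContMDiffAt 𝓘(ℝ, E × EG) (I.prod IG) ∞ (fun p : E × EG => (ψ p.1, ψ' p.2)) (z, z') :=
    (ContMDiffAt.comp (z, z') (g := ψ) hψ contDiff_fst.contMDiff.contMDiffAt).prodMk
      (ContMDiffAt.comp (z, z') (g := ψ') hψ' contDiff_snd.contMDiff.contMDiffAt)
  -- The Maurer–Cartan equation for $(x,w)\mapsto w\,u(x)$ on $M\times G$ is evaluated at $w=1$ on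
  -- one vector along $M$ and one along $G$.
  have hf := contMDiff_mul_prod (IG := IG) hu
  have hθ := smoothForm_mc' hf μ
  have hd : ∀ᶠ p : E × EG in 𝓝 (z, z'), MDifferentiableAt 𝓘(ℝ, E) I ψ p.1 ∧
      MDifferentiableAt 𝓘(ℝ, EG) IG ψ' p.2 :=
    (continuousAt_fst.eventually (eventually_mdifferentiableAt hψ)).and
      (continuousAt_snd.eventually (eventually_mdifferentiableAt hψ'))
  have hval : ∀ p : E × EG, MDifferentiableAt 𝓘(ℝ, E) I ψ p.1 →
      MDifferentiableAt 𝓘(ℝ, EG) IG ψ' p.2 → ∀ (a : E) (b : EG),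
      mc IG (I.prod IG) (fun p : M × G => p.2 * u p.1) (ψ p.1, ψ' p.2)
        (mfderiv 𝓘(ℝ, E × EG) (I.prod IG) (fun p : E × EG => (ψ p.1, ψ' p.2)) p (a, b)) =
      mc IG I u (ψ p.1) (mfderiv 𝓘(ℝ, E) I ψ p.1 a) +
        Ad IG (u (ψ p.1))⁻¹ (mc IG IG (fun g : G => g) (ψ' p.2)
          (mfderiv 𝓘(ℝ, EG) IG ψ' p.2 b)) := by
    intro p h h' a b
    exact (congrArg (mc IG (I.prod IG) (fun p : M × G => p.2 * u p.1) (ψ p.1, ψ' p.2))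
      (mfderiv_prodMap_apply h h' a b)).trans (mc_mul_prod hu _ _ _ _)
  have hmc : ∀ g : G, g = 1 → ∀ a : EG, (mc IG IG (fun g : G => g) g a : EG) = a := by
    rintro _ rfl a
    exact mc_id_one a
  have he : mc IG IG (fun g : G => g) (ψ' z') (mfderiv 𝓘(ℝ, EG) IG ψ' z' ε) = e :=
    (hmc _ hz' _).trans hε
  have hval₁ : ∀ p : E × EG, MDifferentiableAt 𝓘(ℝ, E) I ψ p.1 →
      MDifferentiableAt 𝓘(ℝ, EG) IG ψ' p.2 → ∀ (a : E),
      mc IG (I.prod IG) (fun p : M × G => p.2 * u p.1) (ψ p.1, ψ' p.2)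
        (mfderiv 𝓘(ℝ, E × EG) (I.prod IG) (fun p : E × EG => (ψ p.1, ψ' p.2)) p (a, 0)) =
      mc IG I u (ψ p.1) (mfderiv 𝓘(ℝ, E) I ψ p.1 a) := by
    intro p h h' a
    refine (hval p h h' a 0).trans ?_
    exact (congrArg (_ + ·) (map_zero (Ad IG (u (ψ p.1))⁻¹ ∘ₗ mc IG IG (fun g : G => g) (ψ' p.2) ∘ₗ
      (mfderiv 𝓘(ℝ, EG) IG ψ' p.2).toLinearMap))).trans (add_zero _)
  have hval₂ : ∀ p : E × EG, MDifferentiableAt 𝓘(ℝ, E) I ψ p.1 →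
      MDifferentiableAt 𝓘(ℝ, EG) IG ψ' p.2 → ∀ (b : EG),
      mc IG (I.prod IG) (fun p : M × G => p.2 * u p.1) (ψ p.1, ψ' p.2)
        (mfderiv 𝓘(ℝ, E × EG) (I.prod IG) (fun p : E × EG => (ψ p.1, ψ' p.2)) p (0, b)) =
      Ad IG (u (ψ p.1))⁻¹ (mc IG IG (fun g : G => g) (ψ' p.2)
          (mfderiv 𝓘(ℝ, EG) IG ψ' p.2 b)) := by
    intro p h h' b
    refine (hval p h h' 0 b).trans ?_
    exact (congrArg (· + _) (map_zero (mc IG I u (ψ p.1) ∘ₗ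
      (mfderiv 𝓘(ℝ, E) I ψ p.1).toLinearMap))).trans (zero_add _)
  have hψd := hψ.mdifferentiableAt (by simp)
  have hψd' := hψ'.mdifferentiableAt (by simp)
  have h₁ := dForm_eq hθ hΨ ((α, 0) : E × EG) ((0, ε) : E × EG)
  have h₂ := dForm_mc hf μ (ψ z, ψ' z')
    (mfderiv 𝓘(ℝ, E × EG) (I.prod IG) (fun p : E × EG => (ψ p.1, ψ' p.2)) (z, z') (α, 0))
    (mfderiv 𝓘(ℝ, E × EG) (I.prod IG) (fun p : E × EG => (ψ p.1, ψ' p.2)) (z, z') (0, ε))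
  rw [hval₁ (z, z') hψd hψd' α, hval₂ (z, z') hψd hψd' ε] at h₂
  -- On vectors along $M$ the form does not depend on $w$, so its derivative along $G$ vanishes.
  have h₃ : fderiv ℝ (fun p : E × EG => (μ ∘ₗ mc IG (I.prod IG) (fun p : M × G => p.2 * u p.1)
      (ψ p.1, ψ' p.2)) (mfderiv 𝓘(ℝ, E × EG) (I.prod IG) (fun p : E × EG => (ψ p.1, ψ' p.2)) p
        (α, 0))) (z, z') (0, ε) = 0 := by
    have e₁ : (fun p : E × EG => (μ ∘ₗ mc IG (I.prod IG) (fun p : M × G => p.2 * u p.1)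
      (ψ p.1, ψ' p.2)) (mfderiv 𝓘(ℝ, E × EG) (I.prod IG) (fun p : E × EG => (ψ p.1, ψ' p.2)) p
        (α, 0))) =ᶠ[𝓝 (z, z')] (fun y : E => (μ ∘ₗ mc IG I u (ψ y)) (mfderiv 𝓘(ℝ, E) I ψ y α)) ∘
          Prod.fst := by
      filter_upwards [hd] with p hp
      exact congrArg μ (hval₁ p hp.1 hp.2 α)
    rw [e₁.fderiv_eq, fderiv_comp _ (differentiableAt_form (smoothForm_mc' hu μ) hψ α)
      differentiableAt_fst, fderiv_fst]
    exact (ContinuousLinearMap.comp_apply _ _ _).trans (ContinuousLinearMap.map_zero _)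
  -- On vectors along $G$ the form is $\mathrm{Ad}_{u^{-1}}$, so the remaining term is the
  -- derivative sought.
  have h₄ : fderiv ℝ (fun p : E × EG => (μ ∘ₗ mc IG (I.prod IG) (fun p : M × G => p.2 * u p.1)
      (ψ p.1, ψ' p.2)) (mfderiv 𝓘(ℝ, E × EG) (I.prod IG) (fun p : E × EG => (ψ p.1, ψ' p.2)) p
        (0, ε))) (z, z') (α, 0) = fderiv ℝ (fun y => μ (Ad IG (u (ψ y))⁻¹ e)) z α := by
    have e₁ := differentiableAt_form hθ hΨ ((0, ε) : E × EG)
    have e₂ : HasFDerivAt (fun y : E => (y, z')) (ContinuousLinearMap.inl ℝ E EG) z :=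
      hasFDerivAt_prodMk_left z z'
    have e₃ := (HasFDerivAt.comp (f := fun y : E => (y, z')) z e₁.hasFDerivAt e₂).fderiv
    have e₄ : (fun p : E × EG => (μ ∘ₗ mc IG (I.prod IG) (fun p : M × G => p.2 * u p.1)
      (ψ p.1, ψ' p.2)) (mfderiv 𝓘(ℝ, E × EG) (I.prod IG) (fun p : E × EG => (ψ p.1, ψ' p.2)) p
        (0, ε))) ∘ (fun y : E => (y, z')) =ᶠ[𝓝 z] fun y => μ (Ad IG (u (ψ y))⁻¹ e) := by
      filter_upwards [eventually_mdifferentiableAt hψ] with y hy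
      refine congrArg μ ((hval₂ (y, z') hy hψd' ε).trans ?_)
      exact congrArg (Ad IG (u (ψ y))⁻¹) he
    rw [← e₄.fderiv_eq]
    exact (DFunLike.congr_fun e₃ α).symm
  have h₅ := h₁.symm.trans h₂
  rw [h₃, h₄, sub_zero] at h₅
  have h₆ := (contMDiff_Ad hu μ e).mdifferentiableAt (x := ψ z) (by simp)
  refine (diff_comp h₆ hψd α).trans (h₅.trans ?_)
  exact congrArg (fun b => -μ ⁅mc IG I u (ψ z) (mfderiv 𝓘(ℝ, E) I ψ z α), Ad IG (u (ψ z))⁻¹ b⁆) he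

end Adjoint

/-! ### Curvature on two vectors and under pull-back -/

section Covariance

set_option linter.unusedSectionVars false

open Filter Topology

variable {E H : Type*} [NormedAddCommGroup E] [NormedSpace ℝ E] [FiniteDimensional ℝ E]
  [TopologicalSpace H] {I : ModelWithCorners ℝ E H} [I.Boundaryless]
  {M : Type*} [TopologicalSpace M] [ChartedSpace H M] [IsManifold I ∞ M]
  {E' H' : Type*} [NormedAddCommGroup E'] [NormedSpace ℝ E'] [FiniteDimensional ℝ E']
  [TopologicalSpace H'] {I' : ModelWithCorners ℝ E' H'} [I'.Boundaryless]
  {N : Type*} [TopologicalSpace N] [ChartedSpace H' N] [IsManifold I' ∞ N]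
  {𝔥 : Type*} [AddCommGroup 𝔥] [Module ℝ 𝔥] [Bracket 𝔥 𝔥] [FiniteDimensional ℝ 𝔥] [IsLieBracket 𝔥]

/-- The quadratic expression contributes $[A(a),A(b)]-[A(b),A(a)]$. The resulting factor $2$ is what
the $\tfrac12$ in the curvature removes. -/
lemma dLin_bracketSum (μ : Dual ℝ 𝔥) {V : Type*} [AddCommGroup V] [Module ℝ V] (A : V →ₗ[ℝ] 𝔥)
    (a b : V) : Lam.dLin (Fib.ev a b (bracketSum μ (fun ν => Fib.gen₁ Unit V (0, ν ∘ₗ A))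
      (fun ν => Fib.gen₁ Unit V (0, ν ∘ₗ A)))) = 2 * μ ⁅A a, A b⁆ := by
  have h₁ : ∀ x y : 𝔥, ∑ b, ∑ c, μ ⁅finBasis ℝ 𝔥 b, finBasis ℝ 𝔥 c⁆ *
      ((finBasis ℝ 𝔥).coord b x * (finBasis ℝ 𝔥).coord c y) = μ ⁅x, y⁆ := by
    intro x y
    have h₂ : ∀ b, ∑ c, μ ⁅finBasis ℝ 𝔥 b, finBasis ℝ 𝔥 c⁆ *
        ((finBasis ℝ 𝔥).coord b x * (finBasis ℝ 𝔥).coord c y) =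
        -(μ ⁅y, finBasis ℝ 𝔥 b⁆ * (finBasis ℝ 𝔥).coord b x) := by
      intro b
      rw [IsLieBracket.lie_skew y, map_neg, neg_mul, neg_neg, ← sum_dual_bracket μ _ y,
        Finset.sum_mul]
      exact Finset.sum_congr rfl fun c _ => by ring
    simp only [h₂, Finset.sum_neg_distrib, sum_dual_bracket]
    rw [IsLieBracket.lie_skew x, map_neg]
  rw [map_bracketSum, bracketSum]
  simp only [map_sum, map_smul, Fib.ev_gen₁]
  have h₃ : ∀ i j, μ ⁅finBasis ℝ 𝔥 i, finBasis ℝ 𝔥 j⁆ • Lam.dLin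
      ((⟨0, (finBasis ℝ 𝔥).coord i (A a), (finBasis ℝ 𝔥).coord i (A b), 0⟩ : Lam) *
        ⟨0, (finBasis ℝ 𝔥).coord j (A a), (finBasis ℝ 𝔥).coord j (A b), 0⟩) =
      μ ⁅finBasis ℝ 𝔥 i, finBasis ℝ 𝔥 j⁆ *
        ((finBasis ℝ 𝔥).coord i (A a) * (finBasis ℝ 𝔥).coord j (A b)) -
      μ ⁅finBasis ℝ 𝔥 i, finBasis ℝ 𝔥 j⁆ *
        ((finBasis ℝ 𝔥).coord i (A b) * (finBasis ℝ 𝔥).coord j (A a)) := by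
    intro i j
    simp only [Lam.dLin, LinearMap.coe_mk, AddHom.coe_mk, Lam.mul_d, smul_eq_mul]
    ring
  refine (Finset.sum_congr rfl fun i _ => Finset.sum_congr rfl fun j _ => h₃ i j).trans ?_
  simp only [Finset.sum_sub_distrib, h₁]
  rw [IsLieBracket.lie_skew (A b), map_neg]
  ring

/-- The value of the curvature on two vectors. -/
lemma Conn.ev_curv (A : Conn I M 𝔥) (x : M) (μ : Dual ℝ 𝔥) (a b : TangentSpace I x) :
    (Fib.ev a b (A.curv x μ)).d =
      dForm (fun y => μ ∘ₗ A.form y) x a b + μ ⁅A.form x a, A.form x b⁆ := by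
  have h : Lam.dLin (Fib.ev a b (bracketSum μ (A.comp x) (A.comp x))) = _ :=
    dLin_bracketSum μ (A.form x) a b
  have h₁ : A.curv x μ = extDer Unit (fun y => μ ∘ₗ A.form y) x +
    (1 / 2 : ℝ) • bracketSum μ (A.comp x) (A.comp x) := rfl
  have h₂ : Lam.dLin (Fib.ev a b (A.curv x μ)) =
      Lam.dLin (Fib.ev a b (extDer Unit (fun y => μ ∘ₗ A.form y) x)) +
      (1 / 2 : ℝ) • Lam.dLin (Fib.ev a b (bracketSum μ (A.comp x) (A.comp x))) := by
    rw [h₁, map_add, map_smul, map_add, map_smul]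
  rw [h, smul_eq_mul] at h₂
  refine h₂.trans ?_
  rw [dForm]
  have : (1 / 2 : ℝ) * (2 * μ ⁅A.form x a, A.form x b⁆) = μ ⁅A.form x a, A.form x b⁆ := by ring
  rw [this]
  rfl

/-- The pull-back of a connection form. -/
def Conn.pullback (A : Conn I' N 𝔥) (h : M → N) (hh : ContMDiff I I' ∞ h) : Conn I M 𝔥 where
  form x := A.form (h x) ∘ₗ (mfderiv I I' h x).toLinearMap
  smooth μ := (A.smooth μ).pullback hh

lemma Fib.ev_hom_pullback {V W : Type*} [AddCommGroup V] [Module ℝ V] [AddCommGroup W] [Module ℝ W]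
    (L : V →ₗ[ℝ] W) (a b : V) (w : Fib Unit W) :
    Fib.ev a b (Fib.hom LinearMap.id 0 L w) = Fib.ev (L a) (L b) w := by
  have h : (Fib.ev a b).comp (Fib.hom (LinearMap.id : Dual ℝ Unit →ₗ[ℝ] _) 0 L) =
      Fib.ev (L a) (L b) := by
    apply Fib.algHom_ext <;> intro u
    · rw [AlgHom.comp_apply, Fib.hom_gen₁, Fib.ev_gen₁, Fib.ev_gen₁]
      simp
    · rw [AlgHom.comp_apply, Fib.hom_gen₂, Fib.ev_gen₂, Fib.ev_gen₂]
  exact DFunLike.congr_fun h w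

lemma Fib.hom_mem_forms {V W : Type*} [AddCommGroup V] [Module ℝ V] [AddCommGroup W] [Module ℝ W]
    (L : V →ₗ[ℝ] W) {w : Fib Unit W} (hw : w ∈ Fib.forms Unit W * Fib.forms Unit W) :
    Fib.hom LinearMap.id 0 L w ∈ Fib.forms Unit V * Fib.forms Unit V :=
  Fib.deg_unit_two.le (Fib.hom_deg _ _ _ (Fib.deg_unit_two.ge hw))

/-- Two-forms are determined by their values on pairs of vectors. There it is the naturality of the
exterior derivative, the bracket term being natural pointwise. -/
lemma Conn.curv_pullback (A : Conn I' N 𝔥) {h : M → N} (hh : ContMDiff I I' ∞ h) (x : M)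
    (μ : Dual ℝ 𝔥) : (A.pullback h hh).curv x μ =
      Fib.hom LinearMap.id 0 (mfderiv I I' h x).toLinearMap (A.curv (h x) μ) := by
  have : FiniteDimensional ℝ (TangentSpace I x) := inferInstanceAs (FiniteDimensional ℝ E)
  refine Fib.eq_of_ev_d ((A.pullback h hh).curv_mem x μ) (Fib.hom_mem_forms _ (A.curv_mem _ μ))
    fun a b => ?_
  rw [Fib.ev_hom_pullback, Conn.ev_curv]
  refine Eq.trans ?_ (A.ev_curv (h x) μ _ _).symm
  exact congrArg (· + _) (dForm_pullback (A.smooth μ) hh x a b)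

end Covariance

/-! ### Gauge transformations of connection forms and of their curvature -/

section Gauge

set_option linter.unusedSectionVars false

variable {E H : Type*} [NormedAddCommGroup E] [NormedSpace ℝ E] [FiniteDimensional ℝ E]
  [TopologicalSpace H] {I : ModelWithCorners ℝ E H} [I.Boundaryless]
  {M : Type*} [TopologicalSpace M] [ChartedSpace H M] [IsManifold I ∞ M]
  {EG HG : Type*} [NormedAddCommGroup EG] [NormedSpace ℝ EG] [FiniteDimensional ℝ EG]
  [TopologicalSpace HG] {IG : ModelWithCorners ℝ EG HG} [IG.Boundaryless]
  {G : Type*} [Group G] [TopologicalSpace G] [ChartedSpace HG G] [LieGroup IG ∞ G]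

lemma comp_linear_eq_sum {𝔥 V : Type*} [AddCommGroup 𝔥] [Module ℝ 𝔥] [FiniteDimensional ℝ 𝔥]
    [AddCommGroup V] [Module ℝ V] (ν : Dual ℝ 𝔥) (A : V →ₗ[ℝ] 𝔥) :
    ν ∘ₗ A = ∑ b, ν (finBasis ℝ 𝔥 b) • ((finBasis ℝ 𝔥).coord b ∘ₗ A) := by
  conv_lhs => rw [← (finBasis ℝ 𝔥).sum_dual_apply_smul_coord ν]
  exact sum_smul_comp _ _ _

lemma SmoothForm.sum_smul {ι : Type*} [Fintype ι] {f : ι → M → ℝ}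
    {θ : ι → ∀ x : M, Dual ℝ (TangentSpace I x)} (hf : ∀ i, ContMDiff I 𝓘(ℝ, ℝ) ∞ (f i))
    (hθ : ∀ i, SmoothForm I (θ i) Set.univ) :
    SmoothForm I (fun x => ∑ i, f i x • θ i x) Set.univ := by
  have h : ContMDiffOn I.tangent 𝓘(ℝ, ℝ) ∞
      (fun p : TangentBundle I M => ∑ i, f i p.1 * θ i p.1 p.2)
      (Bundle.TotalSpace.proj ⁻¹' Set.univ) := by
    refine contMDiffOn_finsetSum fun i _ => ContMDiffOn.mul ?_ (hθ i)
    exact ((hf i).comp (Bundle.contMDiff_proj (TangentSpace I (M := M)))).contMDiffOn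
  refine h.congr fun p _ => ?_
  exact LinearMap.sum_apply _ _ _

/-- The form `u⁻¹ A u + u⁻¹ du`. -/
def Conn.gauge (A : Conn I M (GroupLieAlgebra IG G)) (u : M → G) (hu : ContMDiff I IG ∞ u) :
    Conn I M (GroupLieAlgebra IG G) where
  form x := Ad IG (u x)⁻¹ ∘ₗ A.form x + mc IG I u x
  smooth μ := by
    have h₁ := SmoothForm.sum_smul (fun b => contMDiff_Ad hu μ (finBasis ℝ (GroupLieAlgebra IG G) b))
      (fun b => A.smooth ((finBasis ℝ (GroupLieAlgebra IG G)).coord b))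
    have h₂ := ContMDiffOn.add h₁ (smoothForm_mc' hu μ)
    refine h₂.congr fun p _ => ?_
    have h₃ := comp_linear_eq_sum (μ ∘ₗ Ad IG (u p.1)⁻¹) (A.form p.1)
    refine (map_add μ _ _).trans (congrArg (· + _) ?_)
    exact DFunLike.congr_fun h₃ p.2

lemma dForm_const_comp (A : Conn I M (GroupLieAlgebra IG G)) (ν : Dual ℝ (GroupLieAlgebra IG G))
    (x : M) (a b : TangentSpace I x) : dForm (fun y => ν ∘ₗ A.form y) x a b =
      ∑ c, ν (finBasis ℝ _ c) *
        dForm (fun y => (finBasis ℝ (GroupLieAlgebra IG G)).coord c ∘ₗ A.form y) x a b := by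
  have h₁ : (fun y => ν ∘ₗ A.form y) = fun y => ∑ c, ν (finBasis ℝ _ c) •
      ((finBasis ℝ (GroupLieAlgebra IG G)).coord c ∘ₗ A.form y) :=
    funext fun y => comp_linear_eq_sum ν (A.form y)
  have h₂ := SmoothForm.sum_smul (I := I) (M := M)
    (fun c => contMDiff_const (c := ν (finBasis ℝ (GroupLieAlgebra IG G) c)))
    (fun c => A.smooth ((finBasis ℝ (GroupLieAlgebra IG G)).coord c))
  rw [h₁, dForm_sum_smul (fun _ => contMDiff_const)
    (fun c => A.smooth ((finBasis ℝ (GroupLieAlgebra IG G)).coord c)) h₂]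
  refine Finset.sum_congr rfl fun c _ => ?_
  have h₃ : diff I (fun _ : M => ν (finBasis ℝ (GroupLieAlgebra IG G) c)) x = 0 :=
    congrArg ContinuousLinearMap.toLinearMap mfderiv_const
  rw [h₃]
  simp

lemma sum_bracket_coord (μ : Dual ℝ (GroupLieAlgebra IG G)) (s : GroupLieAlgebra IG G)
    (L : GroupLieAlgebra IG G →ₗ[ℝ] GroupLieAlgebra IG G) (y : GroupLieAlgebra IG G) :
    ∑ c, μ ⁅s, L (finBasis ℝ (GroupLieAlgebra IG G) c)⁆ *
      (finBasis ℝ (GroupLieAlgebra IG G)).coord c y = μ ⁅s, L y⁆ := by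
  have h := congrArg (fun y => μ (IsLieBracket.bilin _ s (L y)))
    ((finBasis ℝ (GroupLieAlgebra IG G)).sum_repr y)
  simp only [map_sum, map_smul, IsLieBracket.bilin_apply, smul_eq_mul] at h
  rw [← h]
  exact Finset.sum_congr rfl fun c _ => mul_comm _ _

/-- The curvature transforms with the adjoint action. -/
lemma Conn.curv_gauge (A : Conn I M (GroupLieAlgebra IG G)) {u : M → G} (hu : ContMDiff I IG ∞ u)
    (x : M) (μ : Dual ℝ (GroupLieAlgebra IG G)) :
    (A.gauge u hu).curv x μ = A.curv x (μ ∘ₗ Ad IG (u x)⁻¹) := by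
  have : FiniteDimensional ℝ (TangentSpace I x) := inferInstanceAs (FiniteDimensional ℝ E)
  refine Fib.eq_of_ev_d ((A.gauge u hu).curv_mem x μ) (A.curv_mem x _) fun a b => ?_
  rw [Conn.ev_curv, Conn.ev_curv]
  set B := finBasis ℝ (GroupLieAlgebra IG G) with hB
  -- Expansion in a basis writes $\mathrm{Ad}_{u^{-1}}A$ as scalar functions times fixed components
  -- of $A$, so the Leibniz rule and `diff_dual_Ad` apply.
  have h₁ : (fun y => μ ∘ₗ (A.gauge u hu).form y) = fun y =>
      (∑ c, μ (Ad IG (u y)⁻¹ (B c)) • (B.coord c ∘ₗ A.form y)) + μ ∘ₗ mc IG I u y := by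
    funext y
    refine (LinearMap.comp_add (Ad IG (u y)⁻¹ ∘ₗ A.form y) (mc IG I u y) μ).trans (congrArg (· + _) ?_)
    exact comp_linear_eq_sum (μ ∘ₗ Ad IG (u y)⁻¹) (A.form y)
  have h₂ := SmoothForm.sum_smul (fun c => contMDiff_Ad hu μ (B c)) (fun c => A.smooth (B.coord c))
  rw [h₁, dForm_add h₂ (smoothForm_mc' hu μ), dForm_mc hu, dForm_sum_smul
    (fun c => contMDiff_Ad hu μ (B c)) (fun c => A.smooth (B.coord c)) h₂]
  simp only [diff_dual_Ad hu]
  rw [Finset.sum_add_distrib, Finset.sum_sub_distrib, dForm_const_comp A (μ ∘ₗ Ad IG (u x)⁻¹) x a b]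
  set p := Ad IG (u x)⁻¹ (A.form x a) with hp
  set q := Ad IG (u x)⁻¹ (A.form x b) with hq
  set s := mc IG I u x a with hs
  set t := mc IG I u x b with ht
  have h₃ : ∑ c, -μ ⁅s, Ad IG (u x)⁻¹ (B c)⁆ * (B.coord c ∘ₗ A.form x) b = -μ ⁅s, q⁆ := by
    simp only [neg_mul, Finset.sum_neg_distrib, LinearMap.comp_apply]
    rw [sum_bracket_coord]
  have h₄ : ∑ c, -μ ⁅t, Ad IG (u x)⁻¹ (B c)⁆ * (B.coord c ∘ₗ A.form x) a = -μ ⁅t, p⁆ := by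
    simp only [neg_mul, Finset.sum_neg_distrib, LinearMap.comp_apply]
    rw [sum_bracket_coord]
  rw [h₃, h₄, LinearMap.comp_apply, dual_Ad_bracket]
  have h₅ : (A.gauge u hu).form x a = p + s := rfl
  have h₆ : (A.gauge u hu).form x b = q + t := rfl
  have h₇ : ∀ v w w' : GroupLieAlgebra IG G, ⁅v, w + w'⁆ = ⁅v, w⁆ + ⁅v, w'⁆ :=
    fun v w w' => map_add (IsLieBracket.bilin _ v) w w'
  -- With $p,q$ the adjoint images of $A(a),A(b)$ and $s,t$ the values of $u^{-1}du$, the mixed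
  -- brackets in $[p+s,q+t]$ cancel the derivatives of $\mathrm{Ad}$, and $[s,t]$ cancels by
  -- Maurer–Cartan. Only $[p,q]$ survives.
  rw [h₅, h₆, IsLieBracket.add_lie, h₇, h₇, IsLieBracket.lie_skew t p]
  simp only [map_add, map_neg, LinearMap.comp_apply]
  ring

end Gauge

/-! ### Structure maps acting on pairs of a map and a form -/

section Composition

set_option linter.unusedSectionVars false

variable {E H : Type*} [NormedAddCommGroup E] [NormedSpace ℝ E] [FiniteDimensional ℝ E]
  [TopologicalSpace H] {I : ModelWithCorners ℝ E H} [I.Boundaryless]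
  {M : Type*} [TopologicalSpace M] [ChartedSpace H M] [IsManifold I ∞ M]
  {E' H' : Type*} [NormedAddCommGroup E'] [NormedSpace ℝ E'] [FiniteDimensional ℝ E']
  [TopologicalSpace H'] {I' : ModelWithCorners ℝ E' H'} [I'.Boundaryless]
  {N : Type*} [TopologicalSpace N] [ChartedSpace H' N] [IsManifold I' ∞ N]
  {F K : Type*} [NormedAddCommGroup F] [NormedSpace ℝ F] [FiniteDimensional ℝ F]
  [TopologicalSpace K] {J : ModelWithCorners ℝ F K} [J.Boundaryless]
  {P : Type*} [TopologicalSpace P] [ChartedSpace K P] [IsManifold J ∞ P]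
  {𝔥 : Type*} [AddCommGroup 𝔥] [Module ℝ 𝔥] [Bracket 𝔥 𝔥] [FiniteDimensional ℝ 𝔥]

lemma GrMap.ofConn_congr {h h' : M → N} (hh : ContMDiff I I' ∞ h) (hh' : ContMDiff I I' ∞ h')
    {A A' : Conn I M 𝔥} (e : h = h') (eA : A = A') :
    GrMap.ofConn h hh A = GrMap.ofConn h' hh' A' := by
  subst e
  subst eA
  rfl

/-- The images of the $\xi$ recover $\mu\circ A$ for every $\mu$, and linear forms separate points.
-/
lemma GrMap.conn_ofConn (h : M → N) (hh : ContMDiff I I' ∞ h) (A : Conn I M 𝔥) :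
    (GrMap.ofConn h hh A).conn = A := by
  refine Conn.ext (funext fun x => LinearMap.ext fun v => ?_)
  refine (Module.forall_dual_apply_eq_zero_iff ℝ _).1 (fun μ => ?_) |> sub_eq_zero.1
  have h₁ := (GrMap.pull_xi (GrMap.ofConn h hh A) μ x).symm.trans (A.hom_gen₁ h x μ)
  have h₂ := DFunLike.congr_fun (Fib.gen₁_inr_injective h₁) v
  rw [map_sub]
  exact sub_eq_zero.2 h₂

lemma GrMap.conn_eq_of_ofConn_eq {h h' : M → N} {hh : ContMDiff I I' ∞ h} {hh' : ContMDiff I I' ∞ h'}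
    {A A' : Conn I M 𝔥} (e : GrMap.ofConn h hh A = GrMap.ofConn h' hh' A') : A = A' := by
  rw [← GrMap.conn_ofConn h hh A, e, GrMap.conn_ofConn]

lemma GrMap.tangent_comp_ofConn {h : N → P} (hh : ContMDiff I' J ∞ h) {g : M → N}
    (hg : ContMDiff I I' ∞ g) (A : Conn I M 𝔥) :
    (GrMap.tangent 𝔥 h hh).comp (GrMap.ofConn g hg A) =
      GrMap.ofConn (fun x => h (g x)) (hh.comp hg) A := by
  have key : ∀ x, (A.hom g x).comp (Fib.hom LinearMap.id 0 (mfderiv I' J h (g x)).toLinearMap) =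
      A.hom (J := J) (fun x => h (g x)) x := by
    intro x
    apply Fib.algHom_ext
    · intro u
      refine (congrArg (A.hom g x) (Fib.hom_gen₁ _ _ _ u)).trans ?_
      refine (Fib.curvHom_gen₁ _ _ _ _ _).trans ((Fib.curvHom_gen₁ _ _ _ _ _).trans
        (congrArg (fun l => Fib.gen₁ Unit _ (0, l)) ?_)).symm
      refine congrArg ((A.form x).dualMap u.1 + ·) ?_
      have h₁ := mfderiv_comp x (hh.mdifferentiableAt (by simp)) (hg.mdifferentiableAt (by simp))
      have h₂ : (mfderiv I J (fun x => h (g x)) x).toLinearMap =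
          (mfderiv I' J h (g x)).toLinearMap ∘ₗ (mfderiv I I' g x).toLinearMap :=
        congrArg ContinuousLinearMap.toLinearMap h₁
      rw [h₂, LinearMap.zero_apply, zero_add]
      rfl
    · intro μ
      refine (congrArg (A.hom g x) (Fib.hom_gen₂ _ _ _ μ)).trans ?_
      exact (A.hom_gen₂ g x μ).trans (A.hom_gen₂ _ x μ).symm
  exact GrMap.ext rfl (heq_of_eq (funext fun _ => AlgHom.ext fun w => Subtype.ext (funext fun x =>
    DFunLike.congr_fun (key x.1) _)))

/-- Fibrewise both sides are algebra morphisms, so generators suffice. On forms it is the chain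
rule, and on $\bar\xi$ it is the naturality of the curvature. -/
lemma GrMap.ofConn_comp_tangent [IsLieBracket 𝔥] {g : N → P} (hg : ContMDiff I' J ∞ g)
    (A : Conn I' N 𝔥) {h : M → N} (hh : ContMDiff I I' ∞ h) :
    (GrMap.ofConn g hg A).comp (GrMap.tangent Unit h hh) =
      GrMap.ofConn (fun x => g (h x)) (hg.comp hh) (A.pullback h hh) := by
  have key : ∀ x, (Fib.hom (LinearMap.id : Dual ℝ Unit →ₗ[ℝ] _) 0
      (mfderiv I I' h x).toLinearMap).comp (A.hom (J := J) g (h x)) =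
      (A.pullback h hh).hom (J := J) (fun x => g (h x)) x := by
    intro x
    apply Fib.algHom_ext
    · intro u
      refine (congrArg (Fib.hom LinearMap.id 0 (mfderiv I I' h x).toLinearMap)
        (Fib.curvHom_gen₁ _ _ _ (A.curv_mem (h x)) u)).trans ?_
      refine (Fib.hom_gen₁ _ _ _ _).trans ((Fib.curvHom_gen₁ _ _ _ _ _).trans ?_).symm
      have h₁ := mfderiv_comp x (hg.mdifferentiableAt (by simp)) (hh.mdifferentiableAt (by simp))
      have h₂ : (mfderiv I J (fun x => g (h x)) x).toLinearMap =
          (mfderiv I' J g (h x)).toLinearMap ∘ₗ (mfderiv I I' h x).toLinearMap :=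
        congrArg ContinuousLinearMap.toLinearMap h₁
      rw [h₂]
      refine congrArg (fun l => Fib.gen₁ Unit _ (0, l)) ?_
      rw [LinearMap.zero_apply, zero_add]
      exact LinearMap.ext fun _ => rfl
    · intro μ
      refine (congrArg (Fib.hom LinearMap.id 0 (mfderiv I I' h x).toLinearMap)
        (A.hom_gen₂ g (h x) μ)).trans ?_
      exact (A.curv_pullback hh x μ).symm.trans (Conn.hom_gen₂ _ _ x μ).symm
  exact GrMap.ext rfl (heq_of_eq (funext fun _ => AlgHom.ext fun w => Subtype.ext (funext fun x =>
    DFunLike.congr_fun (key x.1) _)))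

lemma Conn.pullback_pullback (A : Conn J P 𝔥) {h : N → P} (hh : ContMDiff I' J ∞ h) {k : M → N}
    (hk : ContMDiff I I' ∞ k) :
    (A.pullback h hh).pullback k hk = A.pullback (fun x => h (k x)) (hh.comp hk) := by
  refine Conn.ext (funext fun x => ?_)
  have h₁ := mfderiv_comp x (hh.mdifferentiableAt (by simp)) (hk.mdifferentiableAt (by simp))
  have h₂ : (mfderiv I J (fun x => h (k x)) x).toLinearMap =
      (mfderiv I' J h (k x)).toLinearMap ∘ₗ (mfderiv I I' k x).toLinearMap :=
    congrArg ContinuousLinearMap.toLinearMap h₁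
  exact (congrArg (A.form (h (k x)) ∘ₗ ·) h₂).symm

lemma Conn.pullback_id (A : Conn I M 𝔥) (hh : ContMDiff I I ∞ (fun x : M => x)) :
    A.pullback (fun x : M => x) hh = A := by
  refine Conn.ext (funext fun x => ?_)
  have h₂ : (mfderiv I I (fun x : M => x) x).toLinearMap = LinearMap.id :=
    congrArg ContinuousLinearMap.toLinearMap (mfderiv_id (I := I) (x := x))
  exact (congrArg (A.form x ∘ₗ ·) h₂)

variable {EG HG : Type*} [NormedAddCommGroup EG] [NormedSpace ℝ EG] [FiniteDimensional ℝ EG]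
  [TopologicalSpace HG] {IG : ModelWithCorners ℝ EG HG} [IG.Boundaryless]
  {G : Type*} [Group G] [TopologicalSpace G] [ChartedSpace HG G] [LieGroup IG ∞ G]

lemma Conn.pullback_gauge (A : Conn I' N (GroupLieAlgebra IG G)) {u : N → G}
    (hu : ContMDiff I' IG ∞ u) {h : M → N} (hh : ContMDiff I I' ∞ h) :
    (A.gauge u hu).pullback h hh = (A.pullback h hh).gauge (fun x => u (h x)) (hu.comp hh) := by
  refine Conn.ext (funext fun x => ?_)
  refine (LinearMap.add_comp _ _ _).trans ?_
  exact congrArg (Ad IG (u (h x))⁻¹ ∘ₗ (A.pullback h hh).form x + ·) (mc_comp hu hh x).symm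

/-- On $\xi$ this is the formula for the transformed form, but on $\bar\xi$ the curvature of that
form must be the adjoint image of the old one; `Conn.curv_gauge` supplies this. -/
lemma GrMap.gauge_comp_ofConn {h : N → P} (hh : ContMDiff I' J ∞ h) {u : N → G}
    (hu : ContMDiff I' IG ∞ u) {g : M → N} (hg : ContMDiff I I' ∞ g)
    (A : Conn I M (GroupLieAlgebra IG G)) :
    (GrMap.gauge IG h hh u hu).comp (GrMap.ofConn g hg A) =
      GrMap.ofConn (fun x => h (g x)) (hh.comp hg) (A.gauge (fun x => u (g x)) (hu.comp hg)) := by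
  have key : ∀ x, (A.hom g x).comp (Fib.hom (Ad IG (u (g x))⁻¹).dualMap (mc IG I' u (g x)).dualMap
      (mfderiv I' J h (g x)).toLinearMap) =
      (A.gauge (fun x => u (g x)) (hu.comp hg)).hom (J := J) (fun x => h (g x)) x := by
    intro x
    apply Fib.algHom_ext
    · intro l
      refine (congrArg (A.hom g x) (Fib.hom_gen₁ _ _ _ l)).trans ?_
      refine (Fib.curvHom_gen₁ _ _ _ _ _).trans ((Fib.curvHom_gen₁ _ _ _ _ _).trans
        (congrArg (fun l => Fib.gen₁ Unit _ (0, l)) ?_)).symm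
      have h₁ := mfderiv_comp x (hh.mdifferentiableAt (by simp)) (hg.mdifferentiableAt (by simp))
      have h₂ : (mfderiv I J (fun x => h (g x)) x).toLinearMap =
          (mfderiv I' J h (g x)).toLinearMap ∘ₗ (mfderiv I I' g x).toLinearMap :=
        congrArg ContinuousLinearMap.toLinearMap h₁
      have h₃ : (A.gauge (fun x => u (g x)) (hu.comp hg)).form x = Ad IG (u (g x))⁻¹ ∘ₗ A.form x +
          mc IG I' u (g x) ∘ₗ (mfderiv I I' g x).toLinearMap :=
        congrArg (Ad IG (u (g x))⁻¹ ∘ₗ A.form x + ·) (mc_comp hu hg x)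
      rw [h₂, h₃]
      ext v
      show l.1 (_ + _) + _ = l.1 _ + (l.1 _ + _)
      rw [map_add, add_assoc]
      rfl
    · intro μ
      refine (congrArg (A.hom g x) (Fib.hom_gen₂ _ _ _ μ)).trans ?_
      refine (A.hom_gen₂ g x _).trans ?_
      exact (A.curv_gauge (hu.comp hg) x μ).symm.trans (Conn.hom_gen₂ _ _ x μ).symm
  exact GrMap.ext rfl (heq_of_eq (funext fun _ => AlgHom.ext fun w => Subtype.ext (funext fun x =>
    DFunLike.congr_fun (key x.1) _)))

end Composition

/-! ### Functors as cocycles, natural isomorphisms as gauge transformations -/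

section Correspondence

set_option linter.unusedSectionVars false

variable {X E H Y : Type*} [NormedAddCommGroup E] [NormedSpace ℝ E] [FiniteDimensional ℝ E]
  [TopologicalSpace H] {I : ModelWithCorners ℝ E H} [I.Boundaryless]
  [TopologicalSpace Y] [ChartedSpace H Y] [IsManifold I ∞ Y]
  {EG HG G : Type*} [NormedAddCommGroup EG] [NormedSpace ℝ EG] [FiniteDimensional ℝ EG]
  [TopologicalSpace HG] {IG : ModelWithCorners ℝ EG HG} [IG.Boundaryless]
  [Group G] [TopologicalSpace G] [ChartedSpace HG G] [LieGroup IG ∞ G]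
  {σ : Y → X}
  {E₂ H₂ : Type*} [NormedAddCommGroup E₂] [NormedSpace ℝ E₂] [FiniteDimensional ℝ E₂]
  [TopologicalSpace H₂] {I₂ : ModelWithCorners ℝ E₂ H₂} [I₂.Boundaryless]
  [ChartedSpace H₂ (Cech₂ σ)] [IsManifold I₂ ∞ (Cech₂ σ)]
  {E₃ H₃ : Type*} [NormedAddCommGroup E₃] [NormedSpace ℝ E₃] [FiniteDimensional ℝ E₃]
  [TopologicalSpace H₃] {I₃ : ModelWithCorners ℝ E₃ H₃} [I₃.Boundaryless]
  [ChartedSpace H₃ (Cech₃ σ)] [IsManifold I₃ ∞ (Cech₃ σ)]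
  {h : IsCech σ I I₂ I₃}

lemma GrMap.IsDG.eq_ofConn_unit {φ : GrMap I Unit Y 𝓘(ℝ, Unit) (GroupLieAlgebra IG G) Unit}
    (hφ : φ.IsDG) : φ = GrMap.ofConn (fun _ => ()) contMDiff_const φ.conn :=
  hφ.eq_ofConn.trans (GrMap.ofConn_congr _ _ rfl rfl)

section WeilMaps

variable {u v : Y → G} (hu : ContMDiff I IG ∞ u) (hv : ContMDiff I IG ∞ v)
  (A : Conn I Y (GroupLieAlgebra IG G))

lemma weilTarget_comp_ofConn : (weilTarget IG G).comp (GrMap.ofConn u hu A) =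
    GrMap.ofConn (fun _ => ()) contMDiff_const A :=
  GrMap.tangent_comp_ofConn _ _ _

lemma weilSource_comp_ofConn : (weilSource IG G).comp (GrMap.ofConn u hu A) =
    GrMap.ofConn (fun _ => ()) contMDiff_const (A.gauge u hu) :=
  GrMap.gauge_comp_ofConn _ _ _ _

lemma weilUnit_comp_ofConn :
    (weilUnit IG G).comp (GrMap.ofConn (fun _ => ()) contMDiff_const A) =
      GrMap.ofConn (fun _ => 1) contMDiff_const A :=
  GrMap.tangent_comp_ofConn _ _ _

lemma weilFst_comp_ofConn :
    (weilFst IG G).comp (GrMap.ofConn (fun y => (u y, v y)) (hu.prodMk hv) A) =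
      GrMap.ofConn u hu A :=
  GrMap.tangent_comp_ofConn _ _ _

lemma weilSnd_comp_ofConn :
    (weilSnd IG G).comp (GrMap.ofConn (fun y => (u y, v y)) (hu.prodMk hv) A) =
      GrMap.ofConn v hv (A.gauge u hu) :=
  GrMap.gauge_comp_ofConn _ _ _ _

lemma weilMul_comp_ofConn :
    (weilMul IG G).comp (GrMap.ofConn (fun y => (u y, v y)) (hu.prodMk hv) A) =
      GrMap.ofConn (fun y => u y * v y) (hu.mul hv) A :=
  GrMap.tangent_comp_ofConn _ _ _

end WeilMaps

lemma GrMap.IsDG.weilTarget_comp {φ : GrMap I Unit Y IG (GroupLieAlgebra IG G) G}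
    (hφ : φ.IsDG) :
    (weilTarget IG G).comp φ = GrMap.ofConn (fun _ => ()) contMDiff_const φ.conn :=
  (congrArg (weilTarget IG G).comp hφ.eq_ofConn).trans (weilTarget_comp_ofConn _ _)

lemma GrMap.IsDG.weilSource_comp {φ : GrMap I Unit Y IG (GroupLieAlgebra IG G) G}
    (hφ : φ.IsDG) :
    (weilSource IG G).comp φ = GrMap.ofConn (fun _ => ()) contMDiff_const
      (φ.conn.gauge φ.body φ.contMDiff_body) :=
  (congrArg (weilSource IG G).comp hφ.eq_ofConn).trans (weilSource_comp_ofConn _ _)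

/-- The target map keeps the form and forgets the map to $G$, so compatibility with targets leaves
no freedom for the form on $Y^{[2]}$. -/
lemma DGFunctor.mor_conn (Φ : DGFunctor IG G h) :
    Φ.mor.conn = Φ.obj.conn.pullback _ h.contMDiff_fst := by
  have h₁ : Φ.obj.comp h.target = _ := (congrArg (GrMap.comp · h.target) Φ.obj_dg.eq_ofConn).trans
    (GrMap.ofConn_comp_tangent _ _ _)
  exact GrMap.conn_eq_of_ofConn_eq (Φ.mor_dg.weilTarget_comp.symm.trans (Φ.map_target.trans h₁))

/-- Compatibility with sources, read on forms; together with `DGFunctor.mor_conn` it is the gluing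
law of the cocycle. -/
lemma DGFunctor.gauge_mor_conn (Φ : DGFunctor IG G h) :
    Φ.mor.conn.gauge Φ.mor.body Φ.mor.contMDiff_body =
      Φ.obj.conn.pullback _ h.contMDiff_snd := by
  have h₁ : Φ.obj.comp h.source = _ := (congrArg (GrMap.comp · h.source) Φ.obj_dg.eq_ofConn).trans
    (GrMap.ofConn_comp_tangent _ _ _)
  exact GrMap.conn_eq_of_ofConn_eq (Φ.mor_dg.weilSource_comp.symm.trans (Φ.map_source.trans h₁))

/-- The differential cocycle of a functor of dg-Lie groupoids. -/
def DGFunctor.toCocycle (Φ : DGFunctor IG G h) : DiffCocycle σ I I₂ IG G where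
  g := Φ.mor.body
  A := Φ.obj.conn.form
  smooth_g := Φ.mor.contMDiff_body
  smooth_A := Φ.obj.conn.smooth
  cocycle p := by
    obtain ⟨c, -, h₁, h₂, h₃⟩ := Φ.map_mul
    have e₁ := DFunLike.congr_fun (congrArg GrMap.body h₁) p
    have e₂ := DFunLike.congr_fun (congrArg GrMap.body h₂) p
    have e₃ := DFunLike.congr_fun (congrArg GrMap.body h₃) p
    exact (congrArg₂ (· * ·) e₁.symm e₂.symm).trans e₃
  glue p v := by
    have e := Φ.gauge_mor_conn
    rw [Φ.mor_conn] at e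
    exact (DFunLike.congr_fun (congrFun (congrArg Conn.form e) p) v).symm

namespace DiffCocycle

/-- The one-form of a differential cocycle. -/
def conn (C : DiffCocycle σ I I₂ IG G) : Conn I Y (GroupLieAlgebra IG G) := ⟨C.A, C.smooth_A⟩

lemma gauge_pullback_conn (h : IsCech σ I I₂ I₃) (C : DiffCocycle σ I I₂ IG G) :
    (C.conn.pullback _ h.contMDiff_fst).gauge C.g C.smooth_g =
      C.conn.pullback _ h.contMDiff_snd :=
  Conn.ext (funext fun p => LinearMap.ext fun v => (C.glue p v).symm)

/-- At $(y,y,y)$ the cocycle condition reads $g\cdot g=g$. Hence the unit axiom needs no separate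
hypothesis on cocycles. -/
lemma g_diag (C : DiffCocycle σ I I₂ IG G) (y : Y) : C.g (Cech₂.diag σ y) = 1 := by
  have := C.cocycle ⟨(y, y, y), rfl, rfl⟩
  exact mul_eq_left.1 this

variable (h) in
/-- The morphism of graded manifolds on the morphisms of the Čech groupoid of a differential
cocycle. -/
def mor (C : DiffCocycle σ I I₂ IG G) :
    GrMap I₂ Unit (Cech₂ σ) IG (GroupLieAlgebra IG G) G :=
  GrMap.ofConn C.g C.smooth_g (C.conn.pullback _ h.contMDiff_fst)

/-- The morphism of graded manifolds on the objects of the Čech groupoid of a differential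
cocycle. -/
def obj (C : DiffCocycle σ I I₂ IG G) :
    GrMap I Unit Y 𝓘(ℝ, Unit) (GroupLieAlgebra IG G) Unit :=
  GrMap.ofConn (fun _ => ()) contMDiff_const C.conn

lemma target_comp_mor (C : DiffCocycle σ I I₂ IG G) :
    (weilTarget IG G).comp (C.mor h) = C.obj.comp h.target := by
  have h₁ : C.obj.comp h.target = GrMap.ofConn (fun _ => ()) contMDiff_const
    (C.conn.pullback _ h.contMDiff_fst) := GrMap.ofConn_comp_tangent _ _ _
  exact (weilTarget_comp_ofConn _ _).trans h₁.symm

lemma source_comp_mor (C : DiffCocycle σ I I₂ IG G) :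
    (weilSource IG G).comp (C.mor h) = C.obj.comp h.source := by
  have h₁ : C.obj.comp h.source = GrMap.ofConn (fun _ => ()) contMDiff_const
    (C.conn.pullback _ h.contMDiff_snd) := GrMap.ofConn_comp_tangent _ _ _
  have h₂ := weilSource_comp_ofConn C.smooth_g (C.conn.pullback _ h.contMDiff_fst)
  rw [C.gauge_pullback_conn h] at h₂
  exact h₂.trans h₁.symm

lemma mor_comp_unit (C : DiffCocycle σ I I₂ IG G) :
    (C.mor h).comp h.unit = (weilUnit IG G).comp C.obj := by
  have h₁ : (C.mor h).comp h.unit = GrMap.ofConn (fun y => C.g (Cech₂.diag σ y))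
    (C.smooth_g.comp h.contMDiff_diag)
    ((C.conn.pullback _ h.contMDiff_fst).pullback _ h.contMDiff_diag) :=
    GrMap.ofConn_comp_tangent _ _ _
  have h₂ : (C.conn.pullback _ h.contMDiff_fst).pullback _ h.contMDiff_diag = C.conn :=
    (Conn.pullback_pullback _ _ _).trans (Conn.pullback_id _ contMDiff_id)
  rw [h₂] at h₁
  have h₃ : (fun y => C.g (Cech₂.diag σ y)) = fun _ => 1 := funext C.g_diag
  exact (h₁.trans (GrMap.ofConn_congr _ contMDiff_const h₃ rfl)).trans
    (weilUnit_comp_ofConn C.conn).symm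

variable (h) in
/-- The morphism of graded manifolds on the composable pairs of the Čech groupoid of a differential
cocycle. -/
def pair (C : DiffCocycle σ I I₂ IG G) :
    GrMap I₃ Unit (Cech₃ σ) (IG.prod IG) (GroupLieAlgebra IG G) (G × G) :=
  GrMap.ofConn (fun p => (C.g p.p₁₂, C.g p.p₂₃))
    ((C.smooth_g.comp h.contMDiff_p₁₂).prodMk (C.smooth_g.comp h.contMDiff_p₂₃))
    ((C.conn.pullback _ h.contMDiff_fst).pullback _ h.contMDiff_p₁₂)

lemma fst_comp_pair (C : DiffCocycle σ I I₂ IG G) :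
    (weilFst IG G).comp (C.pair h) = (C.mor h).comp h.fst := by
  have h₁ : (C.mor h).comp h.fst = GrMap.ofConn (fun p : Cech₃ σ => C.g p.p₁₂)
    (C.smooth_g.comp h.contMDiff_p₁₂)
    ((C.conn.pullback _ h.contMDiff_fst).pullback _ h.contMDiff_p₁₂) :=
    GrMap.ofConn_comp_tangent _ _ _
  exact (weilFst_comp_ofConn (C.smooth_g.comp h.contMDiff_p₁₂)
    (C.smooth_g.comp h.contMDiff_p₂₃) _).trans h₁.symm

lemma snd_comp_pair (C : DiffCocycle σ I I₂ IG G) :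
    (weilSnd IG G).comp (C.pair h) = (C.mor h).comp h.snd := by
  have h₁ : (C.mor h).comp h.snd = GrMap.ofConn (fun p : Cech₃ σ => C.g p.p₂₃)
    (C.smooth_g.comp h.contMDiff_p₂₃)
    ((C.conn.pullback _ h.contMDiff_fst).pullback _ h.contMDiff_p₂₃) :=
    GrMap.ofConn_comp_tangent _ _ _
  have h₂ := Conn.pullback_gauge (C.conn.pullback _ h.contMDiff_fst) C.smooth_g h.contMDiff_p₁₂
  rw [C.gauge_pullback_conn h] at h₂
  -- The source of $(y_1,y_2)$ and the target of $(y_2,y_3)$ are the same point $y_2$.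
  have h₃ : (C.conn.pullback _ h.contMDiff_snd).pullback _ h.contMDiff_p₁₂ =
      (C.conn.pullback _ h.contMDiff_fst).pullback _ h.contMDiff_p₂₃ :=
    (Conn.pullback_pullback _ _ _).trans
      (Conn.pullback_pullback C.conn h.contMDiff_fst h.contMDiff_p₂₃).symm
  exact ((weilSnd_comp_ofConn (C.smooth_g.comp h.contMDiff_p₁₂)
    (C.smooth_g.comp h.contMDiff_p₂₃) _).trans
    (GrMap.ofConn_congr _ (C.smooth_g.comp h.contMDiff_p₂₃) rfl (h₂.symm.trans h₃))).trans h₁.symm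

lemma mul_comp_pair (C : DiffCocycle σ I I₂ IG G) :
    (weilMul IG G).comp (C.pair h) = (C.mor h).comp h.mul := by
  have h₁ : (C.mor h).comp h.mul = GrMap.ofConn (fun p : Cech₃ σ => C.g p.p₁₃)
    (C.smooth_g.comp h.contMDiff_p₁₃)
    ((C.conn.pullback _ h.contMDiff_fst).pullback _ h.contMDiff_p₁₃) :=
    GrMap.ofConn_comp_tangent _ _ _
  have h₂ : (C.conn.pullback _ h.contMDiff_fst).pullback _ h.contMDiff_p₁₂ =
      (C.conn.pullback _ h.contMDiff_fst).pullback _ h.contMDiff_p₁₃ :=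
    (Conn.pullback_pullback _ _ _).trans
      (Conn.pullback_pullback C.conn h.contMDiff_fst h.contMDiff_p₁₃).symm
  have h₃ : (fun p : Cech₃ σ => C.g p.p₁₂ * C.g p.p₂₃) = fun p => C.g p.p₁₃ := funext C.cocycle
  exact ((weilMul_comp_ofConn (C.smooth_g.comp h.contMDiff_p₁₂)
    (C.smooth_g.comp h.contMDiff_p₂₃) _).trans
    (GrMap.ofConn_congr _ (C.smooth_g.comp h.contMDiff_p₁₃) h₃ h₂)).trans h₁.symm

variable (h) in
/-- The functor of dg-Lie groupoids of a differential cocycle. -/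
def toFunctor (C : DiffCocycle σ I I₂ IG G) : DGFunctor IG G h where
  obj := C.obj
  mor := C.mor h
  obj_dg := GrMap.ofConn_isDG _ _ _
  mor_dg := GrMap.ofConn_isDG _ _ _
  map_target := C.target_comp_mor
  map_source := C.source_comp_mor
  map_unit := C.mor_comp_unit
  map_mul := ⟨C.pair h, GrMap.ofConn_isDG _ _ _, C.fst_comp_pair, C.snd_comp_pair,
    C.mul_comp_pair⟩

end DiffCocycle

/-- By the classification the morphism part is fixed by its body and its form, and the form is the
pull-back of that on objects. -/
lemma DGFunctor.toCocycle_mor (Φ : DGFunctor IG G h) : Φ.toCocycle.mor h = Φ.mor := by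
  have h₁ : Φ.toCocycle.mor h = GrMap.ofConn Φ.mor.body Φ.mor.contMDiff_body
    (Φ.obj.conn.pullback _ h.contMDiff_fst) := rfl
  rw [← Φ.mor_conn] at h₁
  exact h₁.trans Φ.mor_dg.eq_ofConn.symm

lemma DGFunctor.toCocycle_obj (Φ : DGFunctor IG G h) : Φ.toCocycle.obj = Φ.obj :=
  Φ.obj_dg.eq_ofConn_unit.symm

lemma DiffCocycle.toFunctor_toCocycle (C : DiffCocycle σ I I₂ IG G) :
    (C.toFunctor h).toCocycle = C := by
  have h₁ : C.obj.conn = C.conn := GrMap.conn_ofConn _ _ C.conn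
  exact DiffCocycle.ext rfl (congrArg Conn.form h₁)

variable (h G IG) in
/-- Functors of dg-Lie groupoids correspond to differential cocycles. -/
def functorEquiv : DGFunctor IG G h ≃ DiffCocycle σ I I₂ IG G where
  toFun Φ := Φ.toCocycle
  invFun C := C.toFunctor h
  left_inv Φ := DGFunctor.ext Φ.toCocycle_obj Φ.toCocycle_mor
  right_inv C := C.toFunctor_toCocycle

lemma DGNatIso.app_conn {Φ Ψ : DGFunctor IG G h} (α : DGNatIso Φ Ψ) :
    α.app.conn = Φ.obj.conn :=
  GrMap.conn_eq_of_ofConn_eq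
    (α.app_dg.weilTarget_comp.symm.trans (α.app_target.trans Φ.obj_dg.eq_ofConn_unit))

lemma DGNatIso.gauge_conn {Φ Ψ : DGFunctor IG G h} (α : DGNatIso Φ Ψ) :
    Φ.obj.conn.gauge α.app.body α.app.contMDiff_body = Ψ.obj.conn := by
  rw [← α.app_conn]
  exact GrMap.conn_eq_of_ofConn_eq
    (α.app_dg.weilSource_comp.symm.trans (α.app_source.trans Ψ.obj_dg.eq_ofConn_unit))

/-- The gauge transformation of a natural isomorphism. -/
def DGNatIso.toGauge {Φ Ψ : DGFunctor IG G h} (α : DGNatIso Φ Ψ) :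
    GaugeTrafo Φ.toCocycle Ψ.toCocycle where
  p := α.app.body
  smooth_p := α.app.contMDiff_body
  map_g q := by
    obtain ⟨c, c', -, -, h₁, h₂, h₃, h₄, h₅⟩ := α.natural
    have e₁ := DFunLike.congr_fun (congrArg GrMap.body h₁) q
    have e₂ := DFunLike.congr_fun (congrArg GrMap.body h₂) q
    have e₃ := DFunLike.congr_fun (congrArg GrMap.body h₃) q
    have e₄ := DFunLike.congr_fun (congrArg GrMap.body h₄) q
    have e₅ := DFunLike.congr_fun (congrArg GrMap.body h₅) q
    -- Underlying spaces of the naturality square; solving for $\tilde g$ gives the transformation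
    -- law.
    have e : Φ.mor.body q * α.app.body q.snd = α.app.body q.fst * Ψ.mor.body q :=
      (congrArg₂ (· * ·) e₁.symm e₂.symm).trans (e₅.trans (congrArg₂ (· * ·) e₃ e₄))
    exact (eq_inv_mul_of_mul_eq e.symm).trans (mul_assoc _ _ _).symm
  map_A y v := (DFunLike.congr_fun (congrFun (congrArg Conn.form α.gauge_conn) y) v).symm

lemma GaugeTrafo.gauge_conn {Φ Ψ : DGFunctor IG G h} (u : GaugeTrafo Φ.toCocycle Ψ.toCocycle) :
    Φ.obj.conn.gauge u.p u.smooth_p = Ψ.obj.conn :=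
  Conn.ext (funext fun y => LinearMap.ext fun v => (u.map_A y v).symm)

/-- The two composable pairs over $(y_1,y_2)$ are $(g,p(y_2))$ and $(p(y_1),\tilde g)$, both with
the form of $\Phi_1$. Their products agree by the law for $\tilde g$, and their second morphisms
have the right forms by the gluing law and by the law for $\tilde A$. -/
lemma GaugeTrafo.natural {Φ Ψ : DGFunctor IG G h} (u : GaugeTrafo Φ.toCocycle Ψ.toCocycle) :
    ∃ c c' : GrMap I₂ Unit (Cech₂ σ) (IG.prod IG) (GroupLieAlgebra IG G) (G × G),
    c.IsDG ∧ c'.IsDG ∧ (weilFst IG G).comp c = Φ.mor ∧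
    (weilSnd IG G).comp c = (GrMap.ofConn u.p u.smooth_p Φ.obj.conn).comp h.source ∧
    (weilFst IG G).comp c' = (GrMap.ofConn u.p u.smooth_p Φ.obj.conn).comp h.target ∧
    (weilSnd IG G).comp c' = Ψ.mor ∧ (weilMul IG G).comp c = (weilMul IG G).comp c' := by
  have s₁ := u.smooth_p.comp h.contMDiff_fst
  have s₂ := u.smooth_p.comp h.contMDiff_snd
  refine ⟨GrMap.ofConn (fun q => (Φ.mor.body q, u.p q.snd))
    (Φ.mor.contMDiff_body.prodMk s₂) Φ.mor.conn,
    GrMap.ofConn (fun q => (u.p q.fst, Ψ.mor.body q))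
    (s₁.prodMk Ψ.mor.contMDiff_body) Φ.mor.conn,
    GrMap.ofConn_isDG _ _ _, GrMap.ofConn_isDG _ _ _, ?_, ?_, ?_, ?_, ?_⟩
  · exact (weilFst_comp_ofConn Φ.mor.contMDiff_body s₂ _).trans Φ.mor_dg.eq_ofConn.symm
  · have h₁ : (GrMap.ofConn u.p u.smooth_p Φ.obj.conn).comp h.source =
        GrMap.ofConn (fun q => u.p q.snd) s₂ (Φ.obj.conn.pullback _ h.contMDiff_snd) :=
      GrMap.ofConn_comp_tangent _ _ _
    have h₂ := weilSnd_comp_ofConn Φ.mor.contMDiff_body s₂ Φ.mor.conn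
    rw [Φ.gauge_mor_conn] at h₂
    exact h₂.trans h₁.symm
  · have h₁ : (GrMap.ofConn u.p u.smooth_p Φ.obj.conn).comp h.target =
        GrMap.ofConn (fun q => u.p q.fst) s₁ (Φ.obj.conn.pullback _ h.contMDiff_fst) :=
      GrMap.ofConn_comp_tangent _ _ _
    rw [← Φ.mor_conn] at h₁
    exact (weilFst_comp_ofConn s₁ Ψ.mor.contMDiff_body _).trans h₁.symm
  · have h₁ : Φ.mor.conn.gauge _ s₁ = Ψ.mor.conn := by
      rw [Ψ.mor_conn, Φ.mor_conn, ← u.gauge_conn]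
      exact (Conn.pullback_gauge _ u.smooth_p h.contMDiff_fst).symm
    have h₂ := weilSnd_comp_ofConn s₁ Ψ.mor.contMDiff_body Φ.mor.conn
    rw [h₁] at h₂
    exact h₂.trans Ψ.mor_dg.eq_ofConn.symm
  · have h₁ : (fun q : Cech₂ σ => Φ.mor.body q * u.p q.snd) =
        fun q => u.p q.fst * Ψ.mor.body q := by
      funext q
      have e : Ψ.mor.body q = (u.p q.fst)⁻¹ * Φ.mor.body q * u.p q.snd := u.map_g q
      rw [e, mul_assoc, mul_inv_cancel_left]
    exact ((weilMul_comp_ofConn Φ.mor.contMDiff_body s₂ _).trans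
      (GrMap.ofConn_congr _ (s₁.mul Ψ.mor.contMDiff_body) h₁ rfl)).trans
      (weilMul_comp_ofConn s₁ Ψ.mor.contMDiff_body _).symm

/-- The natural isomorphism of a gauge transformation. -/
def GaugeTrafo.toNatIso {Φ Ψ : DGFunctor IG G h} (u : GaugeTrafo Φ.toCocycle Ψ.toCocycle) :
    DGNatIso Φ Ψ where
  app := GrMap.ofConn u.p u.smooth_p Φ.obj.conn
  app_dg := GrMap.ofConn_isDG _ _ _
  app_target := (weilTarget_comp_ofConn _ _).trans Φ.obj_dg.eq_ofConn_unit.symm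
  app_source := by
    have h₁ := weilSource_comp_ofConn u.smooth_p Φ.obj.conn
    rw [u.gauge_conn] at h₁
    exact h₁.trans Ψ.obj_dg.eq_ofConn_unit.symm
  natural := u.natural

lemma DGNatIso.toGauge_toNatIso {Φ Ψ : DGFunctor IG G h} (α : DGNatIso Φ Ψ) :
    α.toGauge.toNatIso = α := by
  have h₁ : α.toGauge.toNatIso.app =
    GrMap.ofConn α.app.body α.app.contMDiff_body Φ.obj.conn := rfl
  rw [← α.app_conn] at h₁
  exact DGNatIso.ext (h₁.trans α.app_dg.eq_ofConn.symm)

/-- Natural isomorphisms correspond to gauge transformations. -/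
def natIsoEquiv (Φ Ψ : DGFunctor IG G h) :
    DGNatIso Φ Ψ ≃ GaugeTrafo Φ.toCocycle Ψ.toCocycle where
  toFun α := α.toGauge
  invFun u := u.toNatIso
  left_inv α := α.toGauge_toNatIso
  right_inv _ := GaugeTrafo.ext rfl

/-- The forms match automatically: $\alpha$ and $\gamma$ carry the form of $\Phi_0$, and its gauge
transform by $\alpha$ is the form carried by $\beta$. Only the maps to $G$ impose a condition. -/
lemma DGNatIso.isComp_iff {Φ Ψ Ξ : DGFunctor IG G h} (α : DGNatIso Φ Ψ) (β : DGNatIso Ψ Ξ)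
    (γ : DGNatIso Φ Ξ) :
    α.IsComp β γ ↔ ∀ y, γ.app.body y = α.app.body y * β.app.body y := by
  constructor
  · rintro ⟨c, -, h₁, h₂, h₃⟩ y
    have e₁ := DFunLike.congr_fun (congrArg GrMap.body h₁) y
    have e₂ := DFunLike.congr_fun (congrArg GrMap.body h₂) y
    have e₃ := DFunLike.congr_fun (congrArg GrMap.body h₃) y
    exact e₃.symm.trans (congrArg₂ (· * ·) e₁ e₂)
  · intro hγ
    refine ⟨GrMap.ofConn (fun y => (α.app.body y, β.app.body y))
      (α.app.contMDiff_body.prodMk β.app.contMDiff_body) Φ.obj.conn,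
      GrMap.ofConn_isDG _ _ _, ?_, ?_, ?_⟩
    · have h₁ := weilFst_comp_ofConn α.app.contMDiff_body β.app.contMDiff_body Φ.obj.conn
      rw [← α.app_conn] at h₁ ⊢
      exact h₁.trans α.app_dg.eq_ofConn.symm
    · have h₁ := weilSnd_comp_ofConn α.app.contMDiff_body β.app.contMDiff_body Φ.obj.conn
      rw [α.gauge_conn, ← β.app_conn] at h₁
      exact h₁.trans β.app_dg.eq_ofConn.symm
    · have h₁ := weilMul_comp_ofConn α.app.contMDiff_body β.app.contMDiff_body Φ.obj.conn
      have h₂ : (fun y => α.app.body y * β.app.body y) = γ.app.body :=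
        funext fun y => (hγ y).symm
      exact (h₁.trans (GrMap.ofConn_congr _ γ.app.contMDiff_body h₂ γ.app_conn.symm)).trans
        γ.app_dg.eq_ofConn.symm

end Correspondence

end

end DGBundle


theorem mainTheorem2
    {EX HX X : Type*} [NormedAddCommGroup EX] [NormedSpace ℝ EX] [FiniteDimensional ℝ EX]
    [TopologicalSpace HX] (IX : ModelWithCorners ℝ EX HX) [IX.Boundaryless]
    [TopologicalSpace X] [ChartedSpace HX X] [IsManifold IX ∞ X]
    [T2Space X] [SecondCountableTopology X]
    {E H Y : Type*} [NormedAddCommGroup E] [NormedSpace ℝ E] [FiniteDimensional ℝ E]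
    [TopologicalSpace H] (I : ModelWithCorners ℝ E H) [I.Boundaryless]
    [TopologicalSpace Y] [ChartedSpace H Y] [IsManifold I ∞ Y]
    [T2Space Y] [SecondCountableTopology Y]
    {EG HG G : Type*} [NormedAddCommGroup EG] [NormedSpace ℝ EG] [FiniteDimensional ℝ EG]
    [TopologicalSpace HG] (IG : ModelWithCorners ℝ EG HG) [IG.Boundaryless]
    [Group G] [TopologicalSpace G] [ChartedSpace HG G] [LieGroup IG ∞ G]
    [T2Space G] [SecondCountableTopology G]
    (σ : Y → X) (hσ : Function.Surjective σ) (hσ' : Manifold.IsSubmersion I IX ∞ σ)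
    {E₂ H₂ : Type*} [NormedAddCommGroup E₂] [NormedSpace ℝ E₂] [FiniteDimensional ℝ E₂]
    [TopologicalSpace H₂] (I₂ : ModelWithCorners ℝ E₂ H₂) [I₂.Boundaryless]
    [ChartedSpace H₂ (Cech₂ σ)] [IsManifold I₂ ∞ (Cech₂ σ)]
    {E₃ H₃ : Type*} [NormedAddCommGroup E₃] [NormedSpace ℝ E₃] [FiniteDimensional ℝ E₃]
    [TopologicalSpace H₃] (I₃ : ModelWithCorners ℝ E₃ H₃) [I₃.Boundaryless]
    [ChartedSpace H₃ (Cech₃ σ)] [IsManifold I₃ ∞ (Cech₃ σ)]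
    (h : IsCech σ I I₂ I₃) :
    ∃ e : DGFunctor IG G h ≃ DiffCocycle σ I I₂ IG G,
      (∀ (Φ : DGFunctor IG G h) (q : Cech₂ σ), (e Φ).g q = Φ.mor.body q) ∧
      (∀ (Φ : DGFunctor IG G h) (μ : Module.Dual ℝ (GroupLieAlgebra IG G)) (y : Y),
        (Φ.obj.pull ⊤ (xi IG G μ)).1 ⟨y, trivial⟩ = Fib.gen₁ Unit _ (0, μ ∘ₗ (e Φ).A y)) ∧
      (∀ Φ Ψ : DGFunctor IG G h, ∃ e' : DGNatIso Φ Ψ ≃ GaugeTrafo (e Φ) (e Ψ),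
        ∀ (α : DGNatIso Φ Ψ) (y : Y), (e' α).p y = α.app.body y) ∧
      ∀ (Φ Ψ Ξ : DGFunctor IG G h) (α : DGNatIso Φ Ψ) (β : DGNatIso Ψ Ξ) (γ : DGNatIso Φ Ξ),
        α.IsComp β γ ↔ ∀ y, γ.app.body y = α.app.body y * β.app.body y := by
  exact ⟨functorEquiv G IG h, fun _ _ => rfl, fun Φ μ y => GrMap.pull_xi Φ.obj μ y,
    fun Φ Ψ => ⟨natIsoEquiv Φ Ψ, fun _ _ => rfl⟩, fun _ _ _ α β γ => α.isComp_iff β γ⟩
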